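/- **Setting.** Let $d\ge 1$, let $\tilde{\mathcal M}$ be a $d$-dimensional $C^2$ manifold without boundary (Hausdorff, second countable) with a $C^1$ Riemannian metric $g$, and let $\mathcal M\subset\tilde{\mathcal M}$ be compact and connected, and such that every $m\in\partial\mathcal M$ lies in a $C^2$ chart $x=(x',z)$ of $\tilde{\mathcal M}$ in which $\mathcal M=\{z\ge 0\}$. Let $\mathcal L=\mathbb R\times\mathcal M$, $\hat{\mathcal L}=\mathbb R\times\tilde{\mathcal M}$, write points of $T^*\hat{\mathcal L}$ as $\varrho=(t,x;\tau,\xi)$, and let $p(\varrho)=-\tau^2+|\xi|_x^2$. For a function $f$ let $H_f$ be its Hamiltonian vector field, $H_fh=\{f,h\}$, so that $H_p=-2\tau\partial_t+\nabla_\xi p\cdot\nabla_x-\nabla_xp\cdot\nabla_\xi$. For $x\in\partial\mathcal M$ let $\mathsf n_x^*=dz/|dz|_x$ be the unit inward conormal and $\mathsf n_x=(\mathsf n^*_x)^\sharp$ the unit inward normal. Let $\partial(T^*\mathcal L)$ be the set of points of $T^*\mathcal L$ with $x\in\partial\mathcal M$, and let $\partial T^*\mathcal L_\parallel$ be the set of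 those with moreover $g_x^*(\xi,\mathsf n_x^*)=0$. On $\partial(T^*\mathcal L)$ let $\pi_\parallel$ and $\Sigma$ act on $\xi$ as the orthogonal projection onto, and the orthogonal reflection in, the hyperplane $\{g^*_x(\cdot,\mathsf n_x^*)=0\}$. Put $\mathcal H_\parallel=\partial T^*\mathcal L_\parallel\cap\{p<0\}$, $\mathcal G_\parallel=\partial T^*\mathcal L_\parallel\cap\{p=0\}$, and for $\varrho=(t,x;\tau,\xi)\in\mathcal H_\parallel\cup\mathcal G_\parallel$ put $\varrho^\pm=(t,x;\tau,\xi^\pm)$, $\xi^\pm=\xi\pm\sqrt{-p(\varrho)}\,\mathsf n_x^*$. Within $\partial(T^*\mathcal L)\cap\{p=0\}$ let $\mathcal H_\partial^{\pm}=\{\pm H_pz>0\}$, $\mathcal H_\partial=\mathcal H_\partial^+\cup\mathcal H_\partial^-$, $\mathcal G_\partial=\{H_pz=0\}$; within $\mathcal G_\partial$ let $\mathcal G^{3}_\partial=\{H_p^2z=0\}$ and $\mathcal G^{sg}_\partial=\{H_p^2z<0\}$. Let ${}^{\mathsf G}X=H_p+\frac{H_p^2z}{H_z^2p}H_z$ on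 $\mathcal G^{sg}_\partial$ and ${}^{\mathsf G}X=H_p$ elsewhere on $T^*\mathcal L$. A *generalized bicharacteristic* on $\mathbb R$ is a map $\gamma:\mathbb R\setminus B\to\{p=0\}\cap T^*\mathcal L$, where $B\subset\mathbb R$ is discrete (every point of $B$ is isolated in $B$; $B$ need not be closed), such that: for $s\notin B$, $\gamma(s)\notin\mathcal H_\partial$ and $\gamma$ is differentiable at $s$ (on $\mathbb R\setminus B$) with $\gamma'(s)={}^{\mathsf G}X(\gamma(s))$; and for $S\in B$, $\gamma(s)\notin\partial(T^*\mathcal L)$ for $s\notin B$ close to $S$, the limits $\gamma(S^-)\in\mathcal H_\partial^-$ and $\gamma(S^+)\in\mathcal H_\partial^+$ exist, and $\gamma(S^+)=\Sigma(\gamma(S^-))$. It is *nontrivial* if its cotangent component $(\tau,\xi)$ does not vanish identically (then it vanishes nowhere). **Theorem.** Let $\gamma:\mathbb R\setminus B\to T^*\mathcal L$ be a nontrivial generalized bicharacteristic. Then: 1. For every $a\in C^0_c(T^*\hat{\mathcal L})$ the function $s\mapsto a(\gamma(s))$ is integrable on $\mathbb R\setminus B$, and there is a nonnegative Radon measure $\mu$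 on $T^*\hat{\mathcal L}$ with $\langle\mu,a\rangle=\int_{\mathbb R\setminus B}a(\gamma(s))\,ds$ for all such $a$. 2. Let $\nu=\tfrac12\nu_G+\nu_H$, with $$d\nu_G=-(H_p^2z)\,\mathbf 1_{\mathcal G_\partial^3\cup\mathcal G_\partial^{sg}}\,d\mu,\qquad \nu_H=\sum_{\varrho\in\{\pi_\parallel(\gamma(S^-));\,S\in B\}}\langle\xi^+-\xi^-,\mathsf n_x\rangle\,\delta_\varrho ,$$ where in $\nu_G$ the function $z$ is normalized by $|dz|_x=1$ on $\partial\mathcal M$ (for an arbitrary boundary chart, replace $H_p^2z$ by $H_p^2z/|dz|_x$). Then $\nu$ is a nonnegative Radon measure carried by $\partial T^*\mathcal L_\parallel$, and $${}^tH_p\,\mu=-\int_{\varrho\in\mathcal H_\parallel\cup\mathcal G_\parallel}\frac{\delta_{\varrho^+}-\delta_{\varrho^-}}{\langle\xi^+-\xi^-,\mathsf n_x\rangle}\,d\nu(\varrho)\qquad\text{in the sense of distributions in }T^*\hat{\mathcal L},$$ that is, for every $a\in C^1_c(T^*\hat{\mathcal L})$ both integrands below are integrable and $$\int H_pa\,d\mu=-\int_{\mathcal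 H_\parallel\cup\mathcal G_\parallel}Q_a\,d\nu,$$ with $Q_a(\varrho)=\dfrac{a(\varrho^+)-a(\varrho^-)}{\langle\xi^+-\xi^-,\mathsf n_x\rangle}$ for $\varrho\in\mathcal H_\parallel$ and, for $\varrho=(t,x;\tau,\xi)\in\mathcal G_\parallel$, $Q_a(\varrho)=\frac{d}{dr}a(t,x;\tau,\xi+r\,\mathsf n_x^*)\big|_{r=0}$, the limit of the former quotient. -/

import Mathlib

open Set Filter Topology MeasureTheory Bundle
open scoped Manifold

noncomputable section

namespace GenBichar

/-- The model space `ℝ^d`, with `d = n + 1 ≥ 1`. The last coordinate is the one called `z`. -/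
abbrev Model (n : ℕ) : Type := EuclideanSpace ℝ (Fin (n + 1))

section Basic

variable {n : ℕ} {N : Type*} [TopologicalSpace N] [ChartedSpace (Model n) N]
  [IsManifold 𝓘(ℝ, Model n) 2 N]

/-- The cotangent space `T_x^* N`. -/
abbrev CotSpace (n : ℕ) {N : Type*} [TopologicalSpace N] [ChartedSpace (Model n) N]
    [IsManifold 𝓘(ℝ, Model n) 2 N] (x : N) : Type :=
  TangentSpace 𝓘(ℝ, Model n) x →L[ℝ] ℝ

/-- The cotangent bundle `T^* N`, with the topology and the `C^1` manifold structure of Mathlib's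
bundle of continuous linear maps. -/
abbrev CotBundle (n : ℕ) (N : Type*) [TopologicalSpace N] [ChartedSpace (Model n) N]
    [IsManifold 𝓘(ℝ, Model n) 2 N] : Type _ :=
  TotalSpace (Model n →L[ℝ] ℝ) (fun x : N => CotSpace n x)

/-- The cotangent bundle of `ℝ × N`; the element `((t, τ), ⟨x, ξ⟩)` is the
point `(t, x; τ, ξ)`. -/
abbrev PhaseSpace (n : ℕ) (N : Type*) [TopologicalSpace N] [ChartedSpace (Model n) N]
    [IsManifold 𝓘(ℝ, Model n) 2 N] : Type _ :=
  (ℝ × ℝ) × CotBundle n N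

/-- The space of coordinates `((t, τ), (x, ξ))`. -/
abbrev PhaseModel (n : ℕ) : Type := (ℝ × ℝ) × (Model n × (Model n →L[ℝ] ℝ))

/-- The model with corners (without boundary) of `T^*(ℝ × N)`. The preferred chart of this manifold
at a point `ϱ` above `x` is the canonical cotangent chart induced by the preferred chart of `N`
at `x`, so that tangent vectors at `ϱ` are given by their components `((t, τ), (x, ξ))` in
canonical coordinates. -/
abbrev phaseI (n : ℕ) :
    ModelWithCorners ℝ (PhaseModel n)
      (ModelProd (ℝ × ℝ) (ModelProd (Model n) (Model n →L[ℝ] ℝ))) :=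
  𝓘(ℝ, ℝ × ℝ).prod (𝓘(ℝ, Model n).prod 𝓘(ℝ, Model n →L[ℝ] ℝ))

namespace PhaseSpace

/-- The variable `t`. -/
def t (ϱ : PhaseSpace n N) : ℝ := ϱ.1.1

/-- The variable `τ`, dual to `t`. -/
def τ (ϱ : PhaseSpace n N) : ℝ := ϱ.1.2

/-- The base point `x ∈ N`. -/
def x (ϱ : PhaseSpace n N) : N := ϱ.2.proj

/-- The covector `ξ ∈ T_x^* N`. -/
def ξ (ϱ : PhaseSpace n N) : CotSpace n (x ϱ) := ϱ.2.snd

/-- The point `(t, x; τ, η)`, if `ϱ = (t, x; τ, ξ)`. -/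
def withCov (ϱ : PhaseSpace n N) (η : CotSpace n (x ϱ)) : PhaseSpace n N := (ϱ.1, ⟨x ϱ, η⟩)

end PhaseSpace

open PhaseSpace

/-! ### Hamiltonian vector fields -/

/-- The differential of a function on phase space, in the canonical coordinates at `ϱ`. -/
def dPhase (f : PhaseSpace n N → ℝ) (ϱ : PhaseSpace n N) : PhaseModel n →L[ℝ] ℝ :=
  mfderiv (phaseI n) 𝓘(ℝ, ℝ) f ϱ

/-- The Hamiltonian vector field
`H_f = ∂_τ f ∂_t - ∂_t f ∂_τ + ∇_ξ f · ∇_x - ∇_x f · ∇_ξ`, in canonical coordinates. -/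
def hamField (f : PhaseSpace n N → ℝ) (ϱ : PhaseSpace n N) : TangentSpace (phaseI n) ϱ :=
  (((dPhase f ϱ ((0, 1), 0), - dPhase f ϱ ((1, 0), 0)),
    (∑ i, dPhase f ϱ (0, (0, (EuclideanSpace.proj i : Model n →L[ℝ] ℝ))) •
        EuclideanSpace.single i (1 : ℝ),
      - (dPhase f ϱ ∘L ContinuousLinearMap.inr ℝ (ℝ × ℝ) (Model n × (Model n →L[ℝ] ℝ)) ∘L
          ContinuousLinearMap.inl ℝ (Model n) (Model n →L[ℝ] ℝ)))) : PhaseModel n)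

/-- The Poisson bracket `{f, h} = H_f h`. -/
def poisson (f h : PhaseSpace n N → ℝ) (ϱ : PhaseSpace n N) : ℝ :=
  dPhase h ϱ (hamField f ϱ)

end Basic

section Metric

variable {n : ℕ} {N : Type*} [TopologicalSpace N] [ChartedSpace (Model n) N]
  [IsManifold 𝓘(ℝ, Model n) 2 N]

open PhaseSpace

/-- `C^1` Riemannian metrics on `N`. -/
abbrev Metric1 (n : ℕ) (N : Type*) [TopologicalSpace N] [ChartedSpace (Model n) N]
    [IsManifold 𝓘(ℝ, Model n) 2 N] : Type _ :=
  ContMDiffRiemannianMetric 𝓘(ℝ, Model n) 1 (Model n) (fun x : N => TangentSpace 𝓘(ℝ, Model n) x)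

/-- `ξ ↦ ξ^♯`, the inverse of the isomorphism `v ↦ g_x(v, ·)`. -/
def sharp (g : Metric1 n N) {x : N} (ξ : CotSpace n x) : TangentSpace 𝓘(ℝ, Model n) x :=
  (g.inner x).inverse ξ

/-- The inner product `g_x^*` on `T_x^* N`. -/
def coMetric (g : Metric1 n N) {x : N} (ξ η : CotSpace n x) : ℝ := η (sharp g ξ)

/-- The symbol `p(t, x; τ, ξ) = - τ² + |ξ|_x²` of the wave operator. -/
def symb (g : Metric1 n N) (ϱ : PhaseSpace n N) : ℝ :=
  - (τ ϱ) ^ 2 + coMetric g (ξ ϱ) (ξ ϱ)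

/-! ### The domain and its boundary -/

/-- A chart `φ` of the `C^2` structure of `N` such that
`φ(O ∩ M) = φ(O) ∩ {z ≥ 0}`, where `O` is the domain of `φ` and `z` the last coordinate. -/
def IsBoundaryChart (M : Set N) (φ : OpenPartialHomeomorph N (Model n)) : Prop :=
  φ ∈ IsManifold.maximalAtlas 𝓘(ℝ, Model n) 2 N ∧
    ∀ y ∈ φ.source, y ∈ M ↔ 0 ≤ φ y (Fin.last n)

/-- `M ⊆ N` is a compact connected `d`-dimensional `C^2` manifold with boundary (where
`d = dim N`); its boundary is its topological boundary in `N`. -/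
structure IsC2Domain (n : ℕ) {N : Type*} [TopologicalSpace N] [ChartedSpace (Model n) N]
    [IsManifold 𝓘(ℝ, Model n) 2 N] (M : Set N) : Prop where
  isCompact : IsCompact M
  isConnected : IsConnected M
  exists_chart : ∀ m ∈ frontier M, ∃ φ : OpenPartialHomeomorph N (Model n),
    IsBoundaryChart M φ ∧ m ∈ φ.source

open Classical in
/-- A boundary chart at the boundary point `m`. The differential of `z` at `m` depends on this
choice by a positive factor; the unit conormal, the regions, the vector fields and the measures
below do not depend on it. -/
def bdryChartAt (M : Set N) (m : N) : OpenPartialHomeomorph N (Model n) :=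
  if h : ∃ φ : OpenPartialHomeomorph N (Model n), IsBoundaryChart M φ ∧ m ∈ φ.source
  then h.choose else chartAt (Model n) m

/-- The function `z` near the boundary point `m`. -/
def zAt (n : ℕ) {N : Type*} [TopologicalSpace N] [ChartedSpace (Model n) N]
    [IsManifold 𝓘(ℝ, Model n) 2 N] (M : Set N) (m : N) (y : N) : ℝ :=
  bdryChartAt (n := n) M m y (Fin.last n)

/-- The differential of `z` at the boundary point `m`. -/
def dz (n : ℕ) {N : Type*} [TopologicalSpace N] [ChartedSpace (Model n) N]
    [IsManifold 𝓘(ℝ, Model n) 2 N] (M : Set N) (m : N) : CotSpace n m :=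
  mfderiv 𝓘(ℝ, Model n) 𝓘(ℝ, ℝ) (zAt n M m) m

/-- The norm `|dz|_m`. It is one in quasi-normal geodesic coordinates. -/
def dzNorm (g : Metric1 n N) (M : Set N) (m : N) : ℝ :=
  Real.sqrt (coMetric g (dz n M m) (dz n M m))

/-- The unit inward conormal covector `n_m^*` at a boundary point `m`. -/
def conormal (g : Metric1 n N) (M : Set N) (m : N) : CotSpace n m :=
  (dzNorm g M m)⁻¹ • dz n M m

/-- The unit inward normal vector `n_m` at a boundary point `m`. -/
def normal (g : Metric1 n N) (M : Set N) (m : N) : TangentSpace 𝓘(ℝ, Model n) m :=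
  sharp g (conormal g M m)

/-- The function `z` near the base point of `ϱ`, lifted to phase space. -/
def zLift (M : Set N) (ϱ : PhaseSpace n N) : PhaseSpace n N → ℝ :=
  fun ϱ' => zAt n M (x ϱ) (x ϱ')

/-- `H_p z` at `ϱ`. -/
def Hpz (g : Metric1 n N) (M : Set N) (ϱ : PhaseSpace n N) : ℝ :=
  poisson (symb g) (zLift M ϱ) ϱ

/-- `H_p² z` at `ϱ`. -/
def Hp2z (g : Metric1 n N) (M : Set N) (ϱ : PhaseSpace n N) : ℝ :=
  poisson (symb g) (poisson (symb g) (zLift M ϱ)) ϱ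

/-- `H_z² p` at `ϱ`. -/
def Hz2p (g : Metric1 n N) (M : Set N) (ϱ : PhaseSpace n N) : ℝ :=
  poisson (zLift M ϱ) (poisson (zLift M ϱ) (symb g)) ϱ

/-! ### Regions of the cotangent bundle at the boundary -/

/-- `T^* L`, the part of phase space above `ℝ × M`. -/
def TL (n : ℕ) {N : Type*} [TopologicalSpace N] [ChartedSpace (Model n) N]
    [IsManifold 𝓘(ℝ, Model n) 2 N] (M : Set N) : Set (PhaseSpace n N) := {ϱ | x ϱ ∈ M}

/-- `∂(T^* L)`, the part of phase space above `ℝ × ∂M`. -/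
def bdryTL (n : ℕ) {N : Type*} [TopologicalSpace N] [ChartedSpace (Model n) N]
    [IsManifold 𝓘(ℝ, Model n) 2 N] (M : Set N) : Set (PhaseSpace n N) := {ϱ | x ϱ ∈ frontier M}

/-- The characteristic set `{p = 0}`. -/
def charSet (g : Metric1 n N) : Set (PhaseSpace n N) := {ϱ | symb g ϱ = 0}

/-- `∂T^* L_∥`: points `(t, x; τ, ξ)` with `x ∈ ∂M` and `ξ` orthogonal to the conormal. -/
def parTL (g : Metric1 n N) (M : Set N) : Set (PhaseSpace n N) :=
  {ϱ | ϱ ∈ bdryTL n M ∧ coMetric g (ξ ϱ) (conormal g M (x ϱ)) = 0}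

/-- The hyperbolic region of `∂T^* L_∥`. -/
def parHyp (g : Metric1 n N) (M : Set N) : Set (PhaseSpace n N) := parTL g M ∩ {ϱ | symb g ϱ < 0}

/-- The glancing region of `∂T^* L_∥`. -/
def parGla (g : Metric1 n N) (M : Set N) : Set (PhaseSpace n N) := parTL g M ∩ {ϱ | symb g ϱ = 0}

/-- The projection `π_∥` of `∂(T^* L)` onto `∂T^* L_∥`. -/
def projPar (g : Metric1 n N) (M : Set N) (ϱ : PhaseSpace n N) : PhaseSpace n N :=
  withCov ϱ (ξ ϱ - coMetric g (ξ ϱ) (conormal g M (x ϱ)) • conormal g M (x ϱ))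

/-- The reflection `Σ` of `∂(T^* L)`. -/
def reflect (g : Metric1 n N) (M : Set N) (ϱ : PhaseSpace n N) : PhaseSpace n N :=
  withCov ϱ (ξ ϱ - (2 * coMetric g (ξ ϱ) (conormal g M (x ϱ))) • conormal g M (x ϱ))

/-- `ξ^+ = ξ + (-p(ϱ))^{1/2} n_x^*`, for `ϱ` hyperbolic or glancing in `∂T^* L_∥`. -/
def ξPlus (g : Metric1 n N) (M : Set N) (ϱ : PhaseSpace n N) : CotSpace n (x ϱ) :=
  ξ ϱ + Real.sqrt (- symb g ϱ) • conormal g M (x ϱ)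

/-- `ξ^- = ξ - (-p(ϱ))^{1/2} n_x^*`, for `ϱ` hyperbolic or glancing in `∂T^* L_∥`. -/
def ξMinus (g : Metric1 n N) (M : Set N) (ϱ : PhaseSpace n N) : CotSpace n (x ϱ) :=
  ξ ϱ - Real.sqrt (- symb g ϱ) • conormal g M (x ϱ)

/-- `⟨ξ^+ - ξ^-, n_x⟩`. -/
def jump (g : Metric1 n N) (M : Set N) (ϱ : PhaseSpace n N) : ℝ :=
  (ξPlus g M ϱ - ξMinus g M ϱ) (normal g M (x ϱ))

/-- `𝓗_∂^+`: hyperbolic points of `∂(T^* L)` that point strictly inward. -/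
def hypPlus (g : Metric1 n N) (M : Set N) : Set (PhaseSpace n N) :=
  {ϱ | ϱ ∈ bdryTL n M ∧ symb g ϱ = 0 ∧ 0 < Hpz g M ϱ}

/-- `𝓗_∂^-`: hyperbolic points of `∂(T^* L)` that point strictly outward. -/
def hypMinus (g : Metric1 n N) (M : Set N) : Set (PhaseSpace n N) :=
  {ϱ | ϱ ∈ bdryTL n M ∧ symb g ϱ = 0 ∧ Hpz g M ϱ < 0}

/-- `𝓖_∂`: glancing points. -/
def glancing (g : Metric1 n N) (M : Set N) : Set (PhaseSpace n N) :=
  {ϱ | ϱ ∈ bdryTL n M ∧ symb g ϱ = 0 ∧ Hpz g M ϱ = 0}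

/-- Glancing points of order three: `H_p² z = 0`. -/
def glancing3 (g : Metric1 n N) (M : Set N) : Set (PhaseSpace n N) :=
  glancing g M ∩ {ϱ | Hp2z g M ϱ = 0}

/-- Gliding points: `H_p² z < 0`. -/
def gliding (g : Metric1 n N) (M : Set N) : Set (PhaseSpace n N) :=
  glancing g M ∩ {ϱ | Hp2z g M ϱ < 0}

/-! ### Generalized bicharacteristics -/

/-- The gliding vector field `H_p^𝓖 = H_p + (H_p² z / H_z² p) H_z`. -/
def glidingField (g : Metric1 n N) (M : Set N) (ϱ : PhaseSpace n N) :
    TangentSpace (phaseI n) ϱ :=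
  hamField (symb g) ϱ + (Hp2z g M ϱ / Hz2p g M ϱ) • hamField (zLift M ϱ) ϱ

open Classical in
/-- The vector field that is `H_p^𝓖` on the gliding set and `H_p` elsewhere. -/
def genField (g : Metric1 n N) (M : Set N) (ϱ : PhaseSpace n N) : TangentSpace (phaseI n) ϱ :=
  if ϱ ∈ gliding g M then glidingField g M ϱ else hamField (symb g) ϱ

/-- `γ : J ∖ B → T^* L` is a generalized bicharacteristic; the values of `γ` off `J ∖ B` are
irrelevant. The set `B` is discrete (each of its points is isolated in `B`), not
necessarily closed. -/
structure IsGenBichar (g : Metric1 n N) (M : Set N) (J B : Set ℝ) (γ : ℝ → PhaseSpace n N) :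
    Prop where
  ordConnected : J.OrdConnected
  subset : B ⊆ J
  discrete : IsDiscrete B
  mem : ∀ s ∈ J \ B, γ s ∈ charSet g ∩ TL n M
  notMem_hyp : ∀ s ∈ J \ B, γ s ∉ hypPlus g M ∪ hypMinus g M
  hasDeriv : ∀ s ∈ J \ B, HasMFDerivWithinAt 𝓘(ℝ, ℝ) (phaseI n) γ (J \ B) s
    ((1 : ℝ →L[ℝ] ℝ).smulRight (genField g M (γ s)))
  interior : ∀ S ∈ B, ∀ᶠ s in 𝓝[J \ B] S, γ s ∉ bdryTL n M
  left : ∀ S ∈ B, (∃ ε > 0, Icc (S - ε) S ⊆ J) →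
    ∃ ϱ ∈ hypMinus g M, Tendsto γ (𝓝[(J \ B) ∩ Iio S] S) (𝓝 ϱ)
  right : ∀ S ∈ B, (∃ ε > 0, Icc S (S + ε) ⊆ J) →
    ∃ ϱ ∈ hypPlus g M, Tendsto γ (𝓝[(J \ B) ∩ Ioi S] S) (𝓝 ϱ)
  reflection : ∀ S ∈ B, (∃ ε > 0, Icc (S - ε) (S + ε) ⊆ J) →
    ∀ ϱ₁ ϱ₂ : PhaseSpace n N, Tendsto γ (𝓝[(J \ B) ∩ Iio S] S) (𝓝 ϱ₁) →
      Tendsto γ (𝓝[(J \ B) ∩ Ioi S] S) (𝓝 ϱ₂) → ϱ₂ = reflect g M ϱ₁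

/-- The curve `γ` on `J ∖ B` is nontrivial: its cotangent component does not vanish. (On a
generalized bicharacteristic, it vanishes at one point if and only if it vanishes everywhere.) -/
def Nontriv (J B : Set ℝ) (γ : ℝ → PhaseSpace n N) : Prop :=
  ∃ s ∈ J \ B, ¬ (τ (γ s) = 0 ∧ ξ (γ s) = 0)

/-! ### The transport equation and the boundary measures -/

/-- `⟨δ_{ϱ^+} - δ_{ϱ^-}, a⟩ / ⟨ξ^+ - ξ^-, n_x⟩` at a hyperbolic point `ϱ` of `∂T^* L_∥`, and its
limit at a glancing point, that is, the derivative of `a` in the fibre in the direction `n_x^*`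
(in quasi-normal geodesic coordinates this is the derivative in the variable dual to `z`). -/
def bdryQuotient (g : Metric1 n N) (M : Set N) (a : PhaseSpace n N → ℝ) (ϱ : PhaseSpace n N) : ℝ :=
  if symb g ϱ < 0 then (a (withCov ϱ (ξPlus g M ϱ)) - a (withCov ϱ (ξMinus g M ϱ))) / jump g M ϱ
  else deriv (fun r : ℝ => a (withCov ϱ (ξ ϱ + r • conormal g M (x ϱ)))) 0

variable [MeasurableSpace (PhaseSpace n N)]

/-- The equation `ᵗH_p μ = f μ - ∫_{ϱ ∈ 𝓗_∥ ∪ 𝓖_∥} (δ_{ϱ^+} - δ_{ϱ^-}) / ⟨ξ^+ - ξ^-, n_x⟩ dν(ϱ)`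
in the sense of distributions on the whole phase space: it is tested against
all compactly supported `C^1` functions. -/
def TransportEq (g : Metric1 n N) (M : Set N) (f : PhaseSpace n N → ℝ)
    (μ ν : Measure (PhaseSpace n N)) : Prop :=
  ∀ a : PhaseSpace n N → ℝ, ContMDiff (phaseI n) 𝓘(ℝ, ℝ) 1 a → HasCompactSupport a →
    Integrable (poisson (symb g) a) μ ∧ Integrable (fun ϱ => f ϱ * a ϱ) μ ∧
    IntegrableOn (bdryQuotient g M a) (parHyp g M ∪ parGla g M) ν ∧
    ∫ ϱ, poisson (symb g) a ϱ ∂μ =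
      ∫ ϱ, f ϱ * a ϱ ∂μ - ∫ ϱ in parHyp g M ∪ parGla g M, bdryQuotient g M a ϱ ∂ν

/-- `ν_G`: the measure with density `- H_p² z` with respect to the restriction of `μ` to the
glancing points that are of order three or gliding, where `z` is normalized by `|dz| = 1` at the
boundary. The density is nonnegative on this set. -/
def nuG (g : Metric1 n N) (M : Set N) (μ : Measure (PhaseSpace n N)) :
    Measure (PhaseSpace n N) :=
  (μ.restrict (glancing3 g M ∪ gliding g M)).withDensity
    (fun ϱ => ENNReal.ofReal (- (Hp2z g M ϱ / dzNorm g M (x ϱ))))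

/-- The hyperbolic points `π_∥(γ(S^-))`, `S ∈ B`, of `∂T^* L_∥`, at which `γ` is reflected. -/
def reflPoints (g : Metric1 n N) (M : Set N) (B : Set ℝ) (γ : ℝ → PhaseSpace n N) :
    Set (PhaseSpace n N) :=
  {ϱ | ∃ S ∈ B, ∃ ϱ₁, Tendsto γ (𝓝[Bᶜ ∩ Iio S] S) (𝓝 ϱ₁) ∧ ϱ = projPar g M ϱ₁}

/-- `ν_H = ∑ ⟨ξ^+ - ξ^-, n_x⟩ δ_ϱ`, the sum being taken over the reflection points `ϱ`. -/
def nuH (g : Metric1 n N) (M : Set N) (B : Set ℝ) (γ : ℝ → PhaseSpace n N) :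
    Measure (PhaseSpace n N) :=
  Measure.sum (fun ϱ : reflPoints g M B γ =>
    ENNReal.ofReal (jump g M (ϱ : PhaseSpace n N)) • Measure.dirac (ϱ : PhaseSpace n N))

end Metric

end GenBichar

end

/-! Along the curve a test function `a` changes in three ways. Its derivative is `H_p a` as long as
the field is `H_p`. On the gliding set the field has the extra term `(H_p²z / H_z²p) H_z`; since
`H_z²p = 2|dz|²` and `H_z a` is `-|dz|` times the fibre derivative of `a` along the unit conormal,
this adds `-½ H_p²z / |dz|` times that derivative, which is the part `½ ν_G`. At a reflection `a`
jumps by `a(ϱ⁺) - a(ϱ⁻)`, which is the boundary quotient times the mass given by `ν_H`. Now τ is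
constant and nonzero, so `t` is a nonconstant affine function of `s`: the curve is injective and
leaves every compact set. Hence μ is the image of Lebesgue measure, and the net change of `a` over
the whole line is zero, which is the transport equation.

The difficulty is that `B` may have accumulation points, so that neither the summability of the
jumps nor the fundamental theorem of calculus is automatic.

For summability, look at `f = H_p z` along the curve, in a boundary chart. It involves no derivative
of the metric, hence is a `C¹` function on phase space, and it vanishes at glancing points. At a
boundary time which is a limit of later boundary times the derivative of `f` is therefore zero, and
all other boundary times form a countable set. So, off a countable set, boundary times are gliding
or of order three, and the derivative of `f` is either zero or the locally bounded `H_p²z`. At each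
reflection `f` jumps upwards, by `2|dz|⟨ξ⁺ - ξ⁻, n⟩`. A function with only upward jumps, whose
derivative is bounded below off a countable set, has summable jumps (`sum_jumps_le`); this gives
`hasJumpBound_of_chart` and the local finiteness of ν.

For the fundamental theorem, subtract from `a` along the curve its pure jump part. What remains is
Lipschitz, by the same comparison principle `sub_le_of_right_lower_bound`, and the jump part has
derivative zero almost everywhere: this is `integral_deriv_eq_sub_sub_jumps`, applied in
`integral_poisson_symb`. -/

noncomputable section

namespace GenBichar

/-! ### Functions of a real variable with countably many jumps -/

/-- The pure jump function, continuous from the left, whose jump at `S` is `w S`. -/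
def jumpFun (w : ℝ → ℝ) (s : ℝ) : ℝ := ∑' S, (Iio s).indicator w S

theorem jumpFun_sub {w : ℝ → ℝ} (hw : Summable w) {a b : ℝ} (hab : a ≤ b) :
    jumpFun w b - jumpFun w a = ∑' S, (Ico a b).indicator w S := by
  rw [jumpFun, jumpFun, ← (hw.indicator _).tsum_sub (hw.indicator _)]
  refine tsum_congr fun S => ?_
  by_cases h1 : S < a
  · simp [indicator, h1, h1.trans_le hab, h1.not_ge]
  · by_cases h2 : S < b <;> simp [indicator, h1, h2, not_lt.1 h1]

theorem jumpFun_mono {w : ℝ → ℝ} (hw : Summable w) (h0 : ∀ s, 0 ≤ w s) : Monotone (jumpFun w) := by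
  intro a b hab
  rw [← sub_nonneg, jumpFun_sub hw hab]
  exact tsum_nonneg fun S => indicator_nonneg (fun s _ => h0 s) S

theorem jumpFun_add_le {w : ℝ → ℝ} (hw : Summable w) (h0 : ∀ s, 0 ≤ w s) {a b : ℝ} (hab : a < b) :
    jumpFun w a + w a ≤ jumpFun w b := by
  have h := jumpFun_sub hw hab.le
  have h2 := (hw.indicator (Ico a b)).le_tsum a
    (fun S _ => indicator_nonneg (fun s _ => h0 s) S)
  rw [indicator_of_mem (left_mem_Ico.2 hab)] at h2
  linarith

theorem jumpFun_nonneg {w : ℝ → ℝ} (h0 : ∀ s, 0 ≤ w s) (s : ℝ) : 0 ≤ jumpFun w s :=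
  tsum_nonneg fun S => indicator_nonneg (fun s _ => h0 s) S

theorem jumpFun_le_tsum {w : ℝ → ℝ} (hw : Summable w) (h0 : ∀ s, 0 ≤ w s) (s : ℝ) :
    jumpFun w s ≤ ∑' S, w S :=
  (hw.indicator _).tsum_le_tsum (fun S => indicator_le_self' (fun _ _ => h0 _) S) hw

/-- Reduces questions on signed weights to monotone jump functions. -/
theorem abs_jumpFun_sub_le {w : ℝ → ℝ} (hw : Summable w) (a b : ℝ) :
    |jumpFun w b - jumpFun w a| ≤
      |jumpFun (fun s => |w s|) b - jumpFun (fun s => |w s|) a| := by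
  wlog hab : a ≤ b generalizing a b
  · rw [abs_sub_comm (jumpFun w b), abs_sub_comm (jumpFun _ b)]
    exact this b a (le_of_not_ge hab)
  rw [jumpFun_sub hw hab, jumpFun_sub hw.abs hab]
  refine le_trans ?_ (le_abs_self _)
  have h : (fun S => |(Ico a b).indicator w S|) = (Ico a b).indicator fun s => |w s| := by
    ext S
    by_cases hS : S ∈ Ico a b <;> simp [hS]
  rw [← h]
  simpa using norm_tsum_le_tsum_norm (f := (Ico a b).indicator w) (hw.indicator _).norm

theorem tendsto_jumpFun_left {w : ℝ → ℝ} (hw : Summable w) (s : ℝ) :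
    Tendsto (jumpFun w) (𝓝[<] s) (𝓝 (jumpFun w s)) := by
  refine tendsto_tsum_of_dominated_convergence hw.abs (fun S => ?_)
    (Eventually.of_forall fun r S => norm_indicator_le_norm_self _ _)
  refine tendsto_const_nhds.congr' ?_
  by_cases h : S < s
  · filter_upwards [Ioo_mem_nhdsLT h] with r hr
    simp [indicator, h, hr.1]
  · filter_upwards [self_mem_nhdsWithin] with r hr
    have : ¬ S < r := fun h' => h (h'.trans hr)
    simp [indicator, h, this]

theorem tendsto_jumpFun_right {w : ℝ → ℝ} (hw : Summable w) (s : ℝ) :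
    Tendsto (jumpFun w) (𝓝[>] s) (𝓝 (jumpFun w s + w s)) := by
  have h1 : jumpFun w s + w s = ∑' S, (Iic s).indicator w S := by
    have h2 : w s = ∑' S, ({s} : Set ℝ).indicator w S := by
      rw [tsum_eq_single s (fun S hS => by simp [hS])]; simp
    conv_lhs => rw [h2]
    rw [jumpFun, ← (hw.indicator _).tsum_add (hw.indicator _)]
    refine tsum_congr fun S => ?_
    rcases lt_trichotomy S s with h | rfl | h
    · simp [indicator, h, h.le, h.ne]
    · simp [indicator]
    · simp [indicator, h.not_gt, h.not_ge, h.ne']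
  rw [h1]
  refine tendsto_tsum_of_dominated_convergence hw.abs (fun S => ?_)
    (Eventually.of_forall fun r S => norm_indicator_le_norm_self _ _)
  refine tendsto_const_nhds.congr' ?_
  by_cases h : S ≤ s
  · filter_upwards [self_mem_nhdsWithin] with r hr
    simp [indicator, h, h.trans_lt hr]
  · filter_upwards [Ioo_mem_nhdsGT (not_le.1 h)] with r hr
    simp [indicator, h, hr.2.not_gt]

/-- A growth estimate with a countable exceptional set. -/
theorem sub_le_of_right_lower_bound {f : ℝ → ℝ} {a b C : ℝ} (hab : a ≤ b) {D : Set ℝ}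
    (hD : D.Countable)
    (hleft : ∀ s ∈ Ioc a b, ∀ ε > 0, ∀ᶠ r in 𝓝[<] s, f r ≤ f s + ε)
    (hright : ∀ s ∈ Ico a b, ∀ ε > 0, ∀ᶠ r in 𝓝[>] s, f s - ε ≤ f r)
    (hderiv : ∀ s ∈ Ico a b, s ∉ D → ∀ ε > 0, ∀ᶠ r in 𝓝[>] s, f s - (C + ε) * (r - s) ≤ f r) :
    f a - C * (b - a) ≤ f b := by
  have key : ∀ ε > 0, f a - (C + ε) * (b - a) - ε ≤ f b := by
    intro ε hε
    -- Each exceptional time receives a positive weight, of total at most `ε`. The jump of `jumpFun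
    -- k` there absorbs the small loss that `hright` allows, so that `Φ` never drops immediately to
    -- the right of a point.
    obtain ⟨e, he0, c, hec, hcε⟩ := hD.exists_pos_hasSum_le hε
    set k : ℝ → ℝ := D.indicator e with hk
    have hk0 : ∀ s, 0 ≤ k s := fun s => indicator_nonneg (fun _ _ => (he0 _).le) s
    have hks : HasSum k c := hasSum_subtype_iff_indicator.1 hec
    set Φ : ℝ → ℝ := fun s => f s + (C + ε) * (s - a) + jumpFun k s with hΦ
    have hΦl : ∀ s ∈ Ioc a b, ∀ δ > 0, ∀ᶠ r in 𝓝[<] s, Φ r ≤ Φ s + δ := by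
      intro s hs δ hδ
      have h1 : Tendsto (fun r => (C + ε) * (r - a)) (𝓝[<] s) (𝓝 ((C + ε) * (s - a))) :=
        (Continuous.tendsto (by fun_prop) s).mono_left nhdsWithin_le_nhds
      filter_upwards [hleft s hs (δ / 2) (half_pos hδ),
        h1.eventually_lt_const (show (C + ε) * (s - a) < (C + ε) * (s - a) + δ / 2 by linarith),
        self_mem_nhdsWithin] with r h2 h3 h4
      have := jumpFun_mono hks.summable hk0 (le_of_lt h4)
      simp only [hΦ]
      linarith
    have hΦr : ∀ s ∈ Ico a b, ∀ᶠ r in 𝓝[>] s, Φ s ≤ Φ r := by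
      intro s hs
      by_cases hsD : s ∈ D
      · have hks' : 0 < k s := by rw [hk, indicator_of_mem hsD]; exact he0 s
        have h1 : Tendsto (fun r => (C + ε) * (r - a)) (𝓝[>] s) (𝓝 ((C + ε) * (s - a))) :=
          (Continuous.tendsto (by fun_prop) s).mono_left nhdsWithin_le_nhds
        filter_upwards [hright s hs (k s / 2) (half_pos hks'),
          h1.eventually_const_lt (show (C + ε) * (s - a) - k s / 2 < (C + ε) * (s - a) by linarith),
          self_mem_nhdsWithin] with r h2 h3 h4
        have := jumpFun_add_le hks.summable hk0 h4
        simp only [hΦ]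
        linarith
      · filter_upwards [hderiv s hs hsD ε hε, self_mem_nhdsWithin] with r h2 h4
        have := jumpFun_mono hks.summable hk0 (le_of_lt h4)
        simp only [hΦ]
        nlinarith
    have hΦab : Φ a ≤ Φ b := by
      -- Continuous induction: `hΦl` carries the inequality to the supremum of `T`, and `hΦr`
      -- carries it beyond, unless the supremum is `b`.
      set T : Set ℝ := {s | s ∈ Icc a b ∧ ∀ r ∈ Icc a s, Φ a ≤ Φ r} with hT
      have haT : a ∈ T := ⟨left_mem_Icc.2 hab, fun r hr => by rw [le_antisymm hr.2 hr.1]⟩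
      have hbdd : BddAbove T := ⟨b, fun s hs => hs.1.2⟩
      have hac : a ≤ sSup T := le_csSup hbdd haT
      have hcb : sSup T ≤ b := csSup_le ⟨a, haT⟩ fun s hs => hs.1.2
      have hlt : ∀ r, a ≤ r → r < sSup T → Φ a ≤ Φ r := fun r har hr => by
        obtain ⟨s, hs, hrs⟩ := exists_lt_of_lt_csSup ⟨a, haT⟩ hr
        exact hs.2 r ⟨har, hrs.le⟩
      have hc : Φ a ≤ Φ (sSup T) := by
        rcases hac.eq_or_lt with h | h
        · rw [← h]
        · refine le_of_forall_pos_le_add fun δ hδ => ?_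
          obtain ⟨r, h1, h2⟩ := ((hΦl _ ⟨h, hcb⟩ δ hδ).and (Ioo_mem_nhdsLT h)).exists
          exact (hlt r h2.1.le h2.2).trans h1
      have hle : ∀ r ∈ Icc a (sSup T), Φ a ≤ Φ r := fun r hr => by
        rcases hr.2.eq_or_lt with h | h
        · rwa [h]
        · exact hlt r hr.1 h
      rcases hcb.eq_or_lt with h | h
      · rwa [h] at hc
      · exfalso
        obtain ⟨u, hu, hu'⟩ := mem_nhdsGT_iff_exists_Ioo_subset.1 (hΦr _ ⟨hac, h⟩)
        obtain ⟨v, hv1, hv2⟩ := exists_between (lt_min hu h)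
        have hvT : v ∈ T := by
          refine ⟨⟨hac.trans hv1.le, (hv2.trans_le (min_le_right _ _)).le⟩, fun r hr => ?_⟩
          rcases le_or_gt r (sSup T) with h5 | h5
          · exact hle r ⟨hr.1, h5⟩
          · exact hc.trans (hu' ⟨h5, hr.2.trans_lt (hv2.trans_le (min_le_left _ _))⟩)
        exact (le_csSup hbdd hvT).not_gt hv1
    have h1 := jumpFun_nonneg hk0 a
    have h2 := jumpFun_le_tsum hks.summable hk0 b
    rw [hks.tsum_eq] at h2
    simp only [hΦ, sub_self, mul_zero] at hΦab
    linarith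
  refine le_of_forall_pos_le_add fun δ hδ => ?_
  have h1 : 0 < b - a + 1 := by linarith
  -- With this `ε` the error `ε * (b - a) + ε` in `key` is exactly `δ`.
  have := key (δ / (b - a + 1)) (by positivity)
  have h2 : δ / (b - a + 1) * (b - a + 1) = δ := div_mul_cancel₀ _ h1.ne'
  nlinarith

/-- Left continuity, a right limit everywhere, and one-sided bounds for the derivative off a countable set,
control the jumps of a function. -/
theorem sub_sum_jumps_add_ge {f j k : ℝ → ℝ} {a b C : ℝ} (hab : a ≤ b) {D : Set ℝ}
    (hD : D.Countable)
    (hleft : ∀ s ∈ Ioc a b, Tendsto f (𝓝[<] s) (𝓝 (f s)))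
    (hright : ∀ s ∈ Ico a b, Tendsto f (𝓝[>] s) (𝓝 (f s + j s)))
    (hderiv : ∀ s ∈ Ico a b, s ∉ D → ∃ U, -C ≤ U ∧ HasDerivAt f U s)
    (F : Finset ℝ) (hk : Summable k) (hk0 : ∀ s, 0 ≤ k s)
    (hjk : ∀ s ∈ Ico a b, s ∉ F → 0 ≤ j s + k s) :
    -C * (b - a) ≤ f b - f a - (∑' S, (Ico a b).indicator ((F : Set ℝ).indicator j) S) +
      ∑' S, (Ico a b).indicator k S := by
  have hF : Summable ((F : Set ℝ).indicator j) :=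
    summable_of_hasFiniteSupport (F.finite_toSet.subset support_indicator_subset)
  rw [← jumpFun_sub hF hab, ← jumpFun_sub hk hab]
  -- The corrected function has no downward jump: the jumps in `F` are removed, and those outside
  -- `F` are compensated by `k`.
  have := sub_le_of_right_lower_bound (C := C)
    (f := fun s => f s - jumpFun ((F : Set ℝ).indicator j) s + jumpFun k s) hab
    (hD.union F.countable_toSet) ?_ ?_ ?_
  · linarith
  · intro s hs ε hε
    have h := (((hleft s hs).sub (tendsto_jumpFun_left hF s)).add (tendsto_jumpFun_left hk s))
    exact (h.eventually (gt_mem_nhds (lt_add_of_pos_right _ hε))).mono fun r hr => hr.le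
  · intro s hs ε hε
    have h := (((hright s hs).sub (tendsto_jumpFun_right hF s)).add (tendsto_jumpFun_right hk s))
    refine (h.eventually (lt_mem_nhds (sub_lt_self _ hε))).mono fun r hr => ?_
    refine le_trans ?_ hr.le
    by_cases hsF : s ∈ F
    · have := hk0 s
      simp [hsF]; linarith
    · have := hjk s hs hsF
      simp [hsF]; linarith
  · intro s hs hsD ε hε
    have hsF : s ∉ F := fun h => hsD (Or.inr h)
    obtain ⟨U, hU, hfU⟩ := hderiv s hs fun h => hsD (Or.inl h)
    -- Near a point outside the finite set `F` this jump function is constant, so it does not affect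
    -- the derivative; `jumpFun k` is monotone and can only help.
    have h1 : ∀ᶠ r in 𝓝[>] s, jumpFun ((F : Set ℝ).indicator j) r =
        jumpFun ((F : Set ℝ).indicator j) s := by
      have h2 : ∀ᶠ r in 𝓝 s, ∀ S ∈ F, (S < r ↔ S < s) := by
        rw [Filter.eventually_all_finset]
        intro S hS
        rcases lt_or_gt_of_ne (show S ≠ s from fun h => hsF (h ▸ hS)) with h | h
        · filter_upwards [lt_mem_nhds h] with r hr using by simp [h, hr]
        · filter_upwards [gt_mem_nhds h] with r hr using by simp [h.not_gt, hr.not_gt]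
      filter_upwards [nhdsWithin_le_nhds h2] with r hr
      refine tsum_congr fun S => ?_
      by_cases hS : S ∈ F
      · simp [indicator, hr S hS]
      · simp [indicator, hS]
    have h3 := hfU.isLittleO.bound hε
    filter_upwards [h1, nhdsWithin_le_nhds h3, self_mem_nhdsWithin] with r h4 h5 (h6 : s < r)
    have h7 := jumpFun_mono hk hk0 h6.le
    rw [h4]
    simp only [Real.norm_eq_abs, smul_eq_mul] at h5
    rw [abs_of_pos (sub_pos.2 h6)] at h5
    have h8 := (abs_le.1 h5).1
    have h9 : 0 < r - s := sub_pos.2 h6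
    nlinarith

/-- No compensation is needed for upward jumps, whence `k = 0`. As the bound does not depend on `F`,
it yields summability of the jumps without assuming it. -/
theorem sum_jumps_le {f j : ℝ → ℝ} {a b C : ℝ} (hab : a ≤ b) {D : Set ℝ}
    (hD : D.Countable)
    (hleft : ∀ s ∈ Ioc a b, Tendsto f (𝓝[<] s) (𝓝 (f s)))
    (hright : ∀ s ∈ Ico a b, Tendsto f (𝓝[>] s) (𝓝 (f s + j s)))
    (hderiv : ∀ s ∈ Ico a b, s ∉ D → ∃ U, -C ≤ U ∧ HasDerivAt f U s)
    (hj : ∀ s ∈ Ico a b, 0 ≤ j s) (F : Finset ℝ) (hF : ↑F ⊆ Ico a b) :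
    ∑ S ∈ F, j S ≤ f b - f a + C * (b - a) := by
  have h := sub_sum_jumps_add_ge (k := 0) hab hD hleft hright hderiv F summable_zero
    (fun _ => le_rfl) (fun s hs _ => by simpa using hj s hs)
  rw [indicator_indicator, inter_eq_right.2 hF, tsum_eq_sum (s := F)
    (fun S hS => by simp [hS])] at h
  rw [Finset.sum_congr rfl (g := j) fun S hS => by simp [hS]] at h
  simp only [indicator_zero', Pi.zero_apply, tsum_zero] at h
  linarith

/-- Finitely many jumps are removed exactly and the others are compensated by their absolute values;
the compensation is the tail of a convergent series and disappears as the finite set grows. -/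
theorem sub_jumpFun_lower {f j : ℝ → ℝ} {a b C : ℝ} (hab : a ≤ b) {D : Set ℝ}
    (hD : D.Countable) (hj : Summable j)
    (hleft : ∀ s ∈ Ioc a b, Tendsto f (𝓝[<] s) (𝓝 (f s)))
    (hright : ∀ s ∈ Ico a b, Tendsto f (𝓝[>] s) (𝓝 (f s + j s)))
    (hderiv : ∀ s ∈ Ico a b, s ∉ D → ∃ U, -C ≤ U ∧ HasDerivAt f U s) :
    -C * (b - a) ≤ (f b - jumpFun j b) - (f a - jumpFun j a) := by
  classical
  set j' := (Ico a b).indicator j with hj'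
  have hs' : Summable j' := hj.indicator _
  have h : ∀ F : Finset ℝ, -C * (b - a) ≤
      f b - f a - ∑ S ∈ F, j' S + (∑' S, |j' S| - ∑ S ∈ F, |j' S|) := by
    intro F
    have h1 : Summable ((F : Set ℝ).indicator fun s => |j' s|) :=  hs'.abs.indicator _
    have h2 : Summable ((F : Set ℝ)ᶜ.indicator fun s => |j' s|) := hs'.abs.indicator _
    have h := sub_sum_jumps_add_ge (k := (F : Set ℝ)ᶜ.indicator fun s => |j' s|) hab hD hleft
      hright hderiv F h2 (fun s => indicator_nonneg (fun _ _ => abs_nonneg _) s) (fun s hs hsF => by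
        simp only [mem_compl_iff, Finset.mem_coe, hsF, not_false_eq_true, indicator_of_mem, hj', hs]
        linarith [neg_abs_le (j s)])
    rw [indicator_indicator, inter_comm, ← indicator_indicator, tsum_eq_sum (s := F)
      (fun S hS => by simp [hS])] at h
    rw [Finset.sum_congr rfl (g := j') fun S hS => by simp [hS, hj']] at h
    have h3 : ∑' S, (Ico a b).indicator ((F : Set ℝ)ᶜ.indicator fun s => |j' s|) S =
        ∑' S, |j' S| - ∑ S ∈ F, |j' S| := by
      rw [eq_sub_iff_add_eq, show ∑ S ∈ F, |j' S| = ∑' S, (F : Set ℝ).indicator (fun s => |j' s|) S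
        from (by
          rw [tsum_eq_sum (s := F) (fun S hS => by simp [hS])]
          exact Finset.sum_congr rfl fun S hS => by simp [hS]), ← (h2.indicator _).tsum_add h1]
      refine tsum_congr fun S => ?_
      by_cases h4 : S ∈ Ico a b <;> by_cases h5 : S ∈ F <;> simp [indicator, h4, h5, hj']
    rw [h3] at h
    exact h
  rw [show (f b - jumpFun j b) - (f a - jumpFun j a) =
    f b - f a - (jumpFun j b - jumpFun j a) by ring, jumpFun_sub hj hab]
  have hlim := ((hs'.hasSum.const_sub (f b - f a)).add
    (hs'.abs.hasSum.const_sub (∑' S, |j' S|)))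
  simp only [sub_self, add_zero] at hlim
  exact ge_of_tendsto' hlim h

/-- The Stieltjes function is the right-continuous version `jumpFun w s + w s`, so the masses of
half-open intervals `Ioc a b` are compared. -/
theorem jumpFun_stieltjes_measure {w : ℝ → ℝ} (hw : Summable w) (h0 : ∀ s, 0 ≤ w s) :
    (jumpFun_mono hw h0).stieltjesFunction.measure =
      Measure.sum fun S : w.support => ENNReal.ofReal (w S) • Measure.dirac (S : ℝ) := by
  have hr : ∀ s, (jumpFun_mono hw h0).stieltjesFunction s = jumpFun w s + w s := fun s => by
    rw [Monotone.stieltjesFunction_eq]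
    exact rightLim_eq_of_tendsto (tendsto_jumpFun_right hw s)
  refine Measure.ext_of_Ioc _ _ fun {a b} hab => ?_
  rw [StieltjesFunction.measure_Ioc, hr, hr, Measure.sum_apply _ measurableSet_Ioc]
  have h1 : jumpFun w b + w b - (jumpFun w a + w a) = ∑' S : w.support, (Ioc a b).indicator w S := by
    have h2 : ∀ s, w s = ∑' S, ({s} : Set ℝ).indicator w S := fun s => by
      rw [tsum_eq_single s (fun S hS => by simp [hS])]; simp
    rw [tsum_subtype w.support ((Ioc a b).indicator w), add_sub_add_comm, jumpFun_sub hw hab.le]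
    conv_lhs => rw [h2 b, h2 a]
    rw [← (hw.indicator _).tsum_sub (hw.indicator _),
      ← (hw.indicator _).tsum_add ((hw.indicator _).sub (hw.indicator _))]
    refine tsum_congr fun S => ?_
    rw [indicator_indicator, inter_comm, ← indicator_indicator, indicator_support]
    rcases lt_trichotomy S a with h | rfl | h
    · simp [indicator, h.not_ge, h.not_gt, h.ne, (h.trans hab).ne]
    · simp [indicator, hab, hab.ne]
    · rcases lt_trichotomy S b with h' | rfl | h'
      · simp [indicator, h, h.le, h', h'.le, h'.ne, h.ne']
      · simp [indicator, h, h.ne']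
      · simp [indicator, h'.not_ge, h'.not_gt, h.ne', h'.ne']
  rw [h1, ENNReal.ofReal_tsum_of_nonneg (fun S => indicator_nonneg (fun _ _ => h0 _) _)
    ((hw.indicator _).subtype _)]
  refine tsum_congr fun S => ?_
  by_cases hS : (S : ℝ) ∈ Ioc a b
  · simp [Measure.dirac_apply' _ measurableSet_Ioc, indicator_of_mem hS]
  · simp [Measure.dirac_apply' _ measurableSet_Ioc, indicator_of_notMem hS]

/-- For the weights `|w|` the function is monotone, so its derivative is almost everywhere the
density of its Stieltjes measure; that measure is atomic, hence singular, and the density vanishes.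
The increments for `w` are dominated by those for `|w|`. -/
theorem ae_hasDerivAt_jumpFun {w : ℝ → ℝ} (hw : Summable w) :
    ∀ᵐ s, HasDerivAt (jumpFun w) 0 s := by
  have h0 : ∀ s, 0 ≤ |w s| := fun s => abs_nonneg _
  have hm := (jumpFun_mono hw.abs h0).ae_hasDerivAt
  have hc : (Function.support fun s => |w s|).Countable := hw.abs.countable_support
  have : Countable (Function.support fun s => |w s|) := hc
  have hsing : (jumpFun_mono hw.abs h0).stieltjesFunction.measure ⟂ₘ volume := by
    rw [jumpFun_stieltjes_measure hw.abs h0]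
    refine Measure.MutuallySingular.sum_left.2 fun S => Measure.MutuallySingular.smul _ ?_
    exact ⟨{(S : ℝ)}ᶜ, (measurableSet_singleton _).compl, by simp, by simp⟩
  filter_upwards [hm, hsing.rnDeriv_ae_eq_zero] with s hs1 hs2
  rw [hs2] at hs1
  rw [hasDerivAt_iff_isLittleO] at hs1 ⊢
  refine Asymptotics.IsBigO.trans_isLittleO ?_ hs1
  refine Asymptotics.IsBigO.of_bound 1 (Eventually.of_forall fun r => ?_)
  simpa using abs_jumpFun_sub_le hw s r

/-- The fundamental theorem of calculus for a function with summable jumps whose derivative exists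
and is bounded off a countable set. -/
theorem integral_deriv_eq_sub_sub_jumps {u U j : ℝ → ℝ} {a b C : ℝ} {D : Set ℝ}
    (hD : D.Countable) (hj : Summable j)
    (hleft : ∀ s, Tendsto u (𝓝[<] s) (𝓝 (u s)))
    (hright : ∀ s, Tendsto u (𝓝[>] s) (𝓝 (u s + j s)))
    (hderiv : ∀ s, s ∉ D → |U s| ≤ C ∧ HasDerivAt u (U s) s) :
    ∫ s in a..b, U s = (u b - u a) - (jumpFun j b - jumpFun j a) := by
  have hC : 0 ≤ C := by
    obtain ⟨s, hs⟩ : Dᶜ.Nonempty := by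
      by_contra h
      rw [not_nonempty_iff_eq_empty, compl_empty_iff] at h
      exact not_countable_univ (h ▸ hD)
    exact (abs_nonneg _).trans (hderiv s hs).1
  -- Applying `sub_jumpFun_lower` to `u` and to `-u` shows that `v` is Lipschitz, hence absolutely
  -- continuous, and its derivative is `U` almost everywhere.
  set v : ℝ → ℝ := fun s => u s - jumpFun j s with hv
  have hlow : ∀ x y, x ≤ y → |v y - v x| ≤ C * (y - x) := by
    intro x y hxy
    have h1 := sub_jumpFun_lower (C := C) hxy hD hj (fun s _ => hleft s) (fun s _ => hright s)
      (fun s _ hs => ⟨U s, (abs_le.1 (hderiv s hs).1).1, (hderiv s hs).2⟩)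
    have h2 := sub_jumpFun_lower (f := fun s => -u s) (j := fun s => -j s) (C := C) hxy hD hj.neg
      (fun s _ => (hleft s).neg) (fun s _ => by simpa [add_comm] using (hright s).neg)
      (fun s _ hs => ⟨-U s, neg_le_neg (abs_le.1 (hderiv s hs).1).2, (hderiv s hs).2.neg⟩)
    have h3 : ∀ s, jumpFun (fun s => -j s) s = - jumpFun j s := fun s => by
      rw [jumpFun, jumpFun, ← tsum_neg]
      refine tsum_congr fun S => ?_
      by_cases h : S < s <;> simp [indicator, h]
    rw [h3, h3] at h2
    rw [abs_le]
    constructor <;> simp only [hv] <;> linarith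
  have hlip : LipschitzWith C.toNNReal v := by
    refine LipschitzWith.of_dist_le_mul fun x y => ?_
    rw [Real.dist_eq, Real.dist_eq, Real.coe_toNNReal C hC]
    rcases le_total x y with h | h
    · rw [abs_sub_comm, abs_sub_comm x, abs_of_nonneg (sub_nonneg.2 h)]; exact hlow x y h
    · rw [abs_of_nonneg (sub_nonneg.2 h)]; exact hlow y x h
  have h := (hlip.lipschitzOnWith (s := uIcc a b)).absolutelyContinuousOnInterval.integral_deriv_eq_sub
  have hae : ∀ᵐ s, U s = deriv v s := by
    filter_upwards [ae_hasDerivAt_jumpFun hj, hD.ae_notMem volume] with s h1 h2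
    have := ((hderiv s h2).2.sub h1).deriv
    rw [sub_zero] at this
    exact this.symm
  rw [intervalIntegral.integral_congr_ae (hae.mono fun s hs _ => hs), h]
  simp only [hv]; ring

/-! ### Extending a curve by its left limits -/

theorem neBot_left_of_countable {B : Set ℝ} (hB : B.Countable) (s : ℝ) :
    (𝓝[Bᶜ ∩ Iio s] s).NeBot := by
  have h : s ∈ closure (Iio s) := by simp
  rw [← mem_closure_iff_nhdsWithin_neBot, inter_comm, ← closure_closure]
  exact closure_mono ((hB.dense_compl ℝ).open_subset_closure_inter isOpen_Iio) h

/-- `v` extends the function `u`, defined off `B`, by its limits from the left. -/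
structure IsLeftExt {X : Type*} [TopologicalSpace X] (B : Set ℝ) (u v : ℝ → X) : Prop where
  countable : B.Countable
  eq_of_notMem : ∀ s ∉ B, v s = u s
  tendsto : ∀ S ∈ B, Tendsto u (𝓝[Bᶜ ∩ Iio S] S) (𝓝 (v S))

namespace IsLeftExt

variable {X : Type*} [TopologicalSpace X] {B : Set ℝ} {u v : ℝ → X}

/-- A value of `v` on `B` is a limit of values of `u` at earlier times, which still lie in the open
set of times concerned, and a closed condition passes to the limit. The time is kept as a coordinate
so that difference quotients are covered. -/
theorem eventually_mem (h : IsLeftExt B u v) {V : Set ℝ} (hV : IsOpen V) {s : ℝ}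
    {K : Set (ℝ × X)} (hK : IsClosed K) (hu : ∀ᶠ r in 𝓝[Bᶜ ∩ V] s, (r, u r) ∈ K) :
    ∀ᶠ r in 𝓝[V] s, (r, v r) ∈ K := by
  obtain ⟨O, hO, hsO, hOK⟩ := mem_nhdsWithin.1 hu
  refine mem_nhdsWithin.2 ⟨O, hO, hsO, fun r hr => ?_⟩
  by_cases hrB : r ∈ B
  · have := neBot_left_of_countable h.countable r
    have ht : Tendsto (fun r => (r, u r)) (𝓝[Bᶜ ∩ Iio r] r) (𝓝 (r, v r)) :=
      (tendsto_id.mono_left nhdsWithin_le_nhds).prodMk_nhds (h.tendsto r hrB)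
    refine hK.mem_of_tendsto ht ?_
    filter_upwards [self_mem_nhdsWithin,
      nhdsWithin_le_nhds ((hO.inter hV).mem_nhds hr)] with q hq1 hq2
    exact hOK ⟨hq2.1, hq1.1, hq2.2⟩
  · have := hOK ⟨hr.1, hrB, hr.2⟩
    simpa [h.eq_of_notMem r hrB] using this

theorem tendsto_nhdsWithin [RegularSpace X] (h : IsLeftExt B u v) {V : Set ℝ} (hV : IsOpen V)
    {s : ℝ} {y : X} (hu : Tendsto u (𝓝[Bᶜ ∩ V] s) (𝓝 y)) : Tendsto v (𝓝[V] s) (𝓝 y) := by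
  refine (closed_nhds_basis y).tendsto_right_iff.2 fun K hK => ?_
  exact h.eventually_mem hV (K := univ ×ˢ K) (isClosed_univ.prod hK.2)
    ((hu.eventually hK.1).mono fun r hr => ⟨mem_univ _, hr⟩) |>.mono fun r hr => hr.2

theorem tendsto_left [RegularSpace X] (h : IsLeftExt B u v) {S : ℝ} (hS : S ∈ B) :
    Tendsto v (𝓝[<] S) (𝓝 (v S)) := h.tendsto_nhdsWithin isOpen_Iio (h.tendsto S hS)

theorem continuousAt [RegularSpace X] (h : IsLeftExt B u v) {s : ℝ} (hs : s ∉ B)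
    (hu : ContinuousWithinAt u Bᶜ s) : ContinuousAt v s := by
  have := h.tendsto_nhdsWithin isOpen_univ (s := s) (y := u s) (by rwa [inter_univ])
  rwa [nhdsWithin_univ, ← h.eq_of_notMem s hs] at this

/-- For each constant `c`, the first-order estimate with error `c * |r - s|` is a closed condition
on the pair of the time `r` and the value, so it extends from `u` to `v` even if `B` accumulates at
`s`. -/
theorem hasDerivAt {u v : ℝ → ℝ} (h : IsLeftExt B u v) {s U : ℝ} (hs : s ∉ B)
    (hu : HasDerivWithinAt u U Bᶜ s) : HasDerivAt v U s := by
  rw [hasDerivAt_iff_isLittleO, Asymptotics.isLittleO_iff]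
  intro c hc
  have h1 := (hasDerivWithinAt_iff_isLittleO.1 hu).bound hc
  have h2 := h.eventually_mem isOpen_univ (s := s)
    (K := {q | ‖q.2 - u s - (q.1 - s) • U‖ ≤ c * ‖q.1 - s‖})
    (isClosed_le (by fun_prop) (by fun_prop)) (by rwa [inter_univ])
  rw [nhdsWithin_univ] at h2
  simpa [h.eq_of_notMem s hs] using h2

theorem comp {Y : Type*} [TopologicalSpace Y] (h : IsLeftExt B u v) {f : X → Y}
    (hf : ∀ S ∈ B, ContinuousAt f (v S)) : IsLeftExt B (f ∘ u) (f ∘ v) where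
  countable := h.countable
  eq_of_notMem s hs := by simp [h.eq_of_notMem s hs]
  tendsto S hS := (hf S hS).tendsto.comp (h.tendsto S hS)

end IsLeftExt

/-! ### Canonical coordinates and the Poisson bracket -/

open PhaseSpace
variable {n : ℕ} {N : Type*} [TopologicalSpace N] [ChartedSpace (Model n) N]
  [IsManifold 𝓘(ℝ, Model n) 2 N]

/-- The covector `ξ`, as a linear form on the model space. -/
def cov (ϱ : PhaseSpace n N) : Model n →L[ℝ] ℝ := ξ ϱ

/-- Makes the bundle charts explicit: covectors transform by the differential of the coordinate
change. All chart computations on phase space rest on this. -/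
theorem trivializationAt_cot (x₀ : N) (q : CotBundle n N)
    (h : q.proj ∈ (chartAt (Model n) x₀).source) :
    trivializationAt (Model n →L[ℝ] ℝ) (fun x : N => CotSpace n x) x₀ q = (q.proj,
      (show Model n →L[ℝ] ℝ from q.2).comp (tangentCoordChange 𝓘(ℝ, Model n) x₀ q.proj q.proj)) := by
  have h0 := hom_trivializationAt_apply (σ := RingHom.id ℝ) (F₁ := Model n) (F₂ := ℝ)
    (E₁ := fun x : N => TangentSpace 𝓘(ℝ, Model n) x) (E₂ := fun _ : N => ℝ) x₀ q
  rw [h0, ContinuousLinearMap.inCoordinates, TangentBundle.symmL_trivializationAt_eq_core h]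
  refine Prod.ext rfl ?_
  change (ContinuousLinearMap.comp ((trivializationAt ℝ (Bundle.Trivial N ℝ) x₀).continuousLinearMapAt ℝ q.proj) _ : Model n →L[ℝ] ℝ) = _
  ext v
  simp [Bundle.Trivial.continuousLinearMapAt_trivialization]
  rfl

theorem extChartAt_phase (ϱ₀ ϱ : PhaseSpace n N) (h : x ϱ ∈ (chartAt (Model n) (x ϱ₀)).source) :
    extChartAt (phaseI n) ϱ₀ ϱ = (ϱ.1, (chartAt (Model n) (x ϱ₀) (x ϱ),
      (cov ϱ).comp (tangentCoordChange 𝓘(ℝ, Model n) (x ϱ₀) (x ϱ) (x ϱ)))) := by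
  rw [phaseI, extChartAt_prod]
  refine Prod.ext rfl ?_
  rw [FiberBundle.extChartAt]
  exact congrArg (fun q : N × (Model n →L[ℝ] ℝ) => (chartAt (Model n) (x ϱ₀) q.1, q.2))
    (trivializationAt_cot (x ϱ₀) ϱ.2 h)

theorem mem_extChartAt_phase_source {ϱ₀ ϱ : PhaseSpace n N} :
    ϱ ∈ (extChartAt (phaseI n) ϱ₀).source ↔ x ϱ ∈ (chartAt (Model n) (x ϱ₀)).source := by
  rw [extChartAt_source, prodChartedSpace_chartAt, OpenPartialHomeomorph.prod_source,
    FiberBundle.chartedSpace_chartAt]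
  simp only [x, mfld_simps]
  refine ⟨fun h => h.2.1.1, fun h => ⟨?_, ⟨h, mem_univ _⟩, ?_⟩⟩
  · exact mem_chart_source _ ϱ.1
  · exact Eq.mpr (congrArg (fun q => q ∈ (chartAt (Model n) (x ϱ₀)).source)
      (congrArg Prod.fst (trivializationAt_cot (x ϱ₀) ϱ.2 h))) h

/-- The vector `v` such that `L (0, (0, η)) = η v`. -/
def fibVec (L : PhaseModel n →L[ℝ] ℝ) : Model n :=
  ∑ i, L (0, (0, (EuclideanSpace.proj i : Model n →L[ℝ] ℝ))) • EuclideanSpace.single i (1 : ℝ)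

theorem apply_fibVec (L : PhaseModel n →L[ℝ] ℝ) (η : Model n →L[ℝ] ℝ) :
    η (fibVec L) = L (0, (0, η)) := by
  have hη : η = ∑ i, η (EuclideanSpace.single i (1 : ℝ)) •
      (EuclideanSpace.proj i : Model n →L[ℝ] ℝ) := by
    ext v
    have hv : v = ∑ i, v i • EuclideanSpace.single i (1 : ℝ) := by
      ext j; simp [Finset.sum_apply, Pi.single_apply]
    conv_lhs => rw [hv]
    simp [mul_comm]
  set M : (Model n →L[ℝ] ℝ) →L[ℝ] ℝ := L ∘L ContinuousLinearMap.inr ℝ (ℝ × ℝ) _ ∘L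
    ContinuousLinearMap.inr ℝ (Model n) _ with hM
  have h1 : ∀ η, L (0, (0, η)) = M η := fun η => rfl
  rw [h1]
  conv_rhs => rw [hη]
  simp only [fibVec, map_sum, map_smul, smul_eq_mul, h1]
  exact Finset.sum_congr rfl fun i _ => mul_comm _ _

/-- The canonical Poisson bracket of two linear forms on the space of coordinates. -/
def linPoisson (L L' : PhaseModel n →L[ℝ] ℝ) : ℝ :=
  L ((0, 1), 0) * L' ((1, 0), 0) - L ((1, 0), 0) * L' ((0, 1), 0) + L' (0, (fibVec L, 0)) -
    L (0, (fibVec L', 0))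

theorem poisson_eq_linPoisson (f h : PhaseSpace n N → ℝ) (ϱ : PhaseSpace n N) :
    poisson f h ϱ = linPoisson (dPhase f ϱ) (dPhase h ϱ) := by
  have h1 : ∀ (L : PhaseModel n →L[ℝ] ℝ) (a b : ℝ) (v : Model n) (η : Model n →L[ℝ] ℝ),
      L ((a, b), (v, η)) = a * L ((1, 0), 0) + b * L ((0, 1), 0) + L (0, (v, 0)) +
        L (0, (0, η)) := by
    intro L a b v η
    rw [← smul_eq_mul, ← smul_eq_mul, ← map_smul, ← map_smul, ← map_add, ← map_add, ← map_add]
    congr 1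
    simp
  have h2 : poisson f h ϱ = dPhase h ϱ ((dPhase f ϱ ((0, 1), 0), - dPhase f ϱ ((1, 0), 0)),
    (fibVec (dPhase f ϱ), - (dPhase f ϱ ∘L ContinuousLinearMap.inr ℝ (ℝ × ℝ) (Model n × (Model n →L[ℝ] ℝ)) ∘L
          ContinuousLinearMap.inl ℝ (Model n) (Model n →L[ℝ] ℝ)))) := rfl
  rw [h2, h1, ← apply_fibVec (dPhase h ϱ), linPoisson]
  simp
  ring

/-- The cotangent lift of `θ`, where `ϑ` is the inverse of `θ`. -/
def cotLift (θ ϑ : Model n → Model n) (w : PhaseModel n) : PhaseModel n :=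
  (w.1, (θ w.2.1, w.2.2 ∘L fderiv ℝ ϑ (θ w.2.1)))

/-- The derivative is block triangular; its off-diagonal block contains the second derivative of the
inverse map `ϑ`. -/
theorem hasFDerivAt_cotLift {θ ϑ : Model n → Model n} {w : PhaseModel n}
    (hθ : DifferentiableAt ℝ θ w.2.1) (hϑ : DifferentiableAt ℝ (fderiv ℝ ϑ) (θ w.2.1)) :
    ∃ T : PhaseModel n →L[ℝ] PhaseModel n, HasFDerivAt (cotLift θ ϑ) T w ∧
      ∀ e v η, T (e, (v, η)) = (e, (fderiv ℝ θ w.2.1 v, η ∘L fderiv ℝ ϑ (θ w.2.1) +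
        w.2.2 ∘L fderiv ℝ (fderiv ℝ ϑ) (θ w.2.1) (fderiv ℝ θ w.2.1 v))) := by
  have h1 : HasFDerivAt (fun w : PhaseModel n => θ w.2.1) _ w :=
    HasFDerivAt.comp w hθ.hasFDerivAt (hasFDerivAt_fst.comp w (hasFDerivAt_snd (𝕜 := ℝ) (p := w)))
  have h2 : HasFDerivAt (fun w : PhaseModel n => fderiv ℝ ϑ (θ w.2.1)) _ w :=
    HasFDerivAt.comp w hϑ.hasFDerivAt h1
  have h3 : HasFDerivAt (fun w : PhaseModel n => w.2.2) _ w :=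
    HasFDerivAt.comp w hasFDerivAt_snd (hasFDerivAt_snd (𝕜 := ℝ) (p := w))
  refine ⟨_, (hasFDerivAt_fst (p := w)).prodMk (h1.prodMk (h3.clm_comp h2)), fun e v η => ?_⟩
  simp [add_comm]

/-- Cotangent lifts are symplectic. The off-diagonal block contributes `ζ (S v w)` to one half of
the bracket and `ζ (S w v)` to the other; they cancel because second derivatives are symmetric. -/
theorem linPoisson_comp_cotLift {T : PhaseModel n →L[ℝ] PhaseModel n} {A A' : Model n →L[ℝ] Model n}
    {S : Model n →L[ℝ] Model n →L[ℝ] Model n} {ζ : Model n →L[ℝ] ℝ}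
    (hT : ∀ e v η, T (e, (v, η)) = (e, (A v, η ∘L A' + ζ ∘L S (A v))))
    (hA : ∀ v, A (A' v) = v) (hS : ∀ v w, S v w = S w v) (L L' : PhaseModel n →L[ℝ] ℝ) :
    linPoisson (L ∘L T) (L' ∘L T) = linPoisson L L' := by
  have hf : ∀ L : PhaseModel n →L[ℝ] ℝ, fibVec (L ∘L T) = A' (fibVec L) := by
    intro L
    have h : ∀ η : Model n →L[ℝ] ℝ, η (fibVec (L ∘L T)) = η (A' (fibVec L)) := by
      intro η
      rw [apply_fibVec]
      have := apply_fibVec L (η ∘L A')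
      simp only [ContinuousLinearMap.comp_apply] at this ⊢
      rw [this, hT]
      simp
    ext i
    exact h (EuclideanSpace.proj i)
  have h1 : ∀ L L' : PhaseModel n →L[ℝ] ℝ, L (T (0, (A' (fibVec L'), 0))) =
      L (0, (fibVec L', 0)) + ζ (S (fibVec L') (fibVec L)) := by
    intro L L'
    have := apply_fibVec L (ζ ∘L S (fibVec L'))
    simp only [ContinuousLinearMap.comp_apply] at this
    rw [hT, hA, this, ← map_add]
    simp
  have h2 : ∀ e : ℝ × ℝ, T (e, 0) = (e, 0) := fun e => by
    have := hT e 0 0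
    refine this.trans (Prod.ext rfl ?_)
    simp
  simp only [linPoisson, hf, ContinuousLinearMap.comp_apply, h1, h2, hS (fibVec L') (fibVec L)]
  ring

theorem hasFDerivAt_dPhase {f : PhaseSpace n N → ℝ} {ϱ : PhaseSpace n N}
    (hf : MDifferentiableAt (phaseI n) 𝓘(ℝ, ℝ) f ϱ) :
    HasFDerivAt (f ∘ (extChartAt (phaseI n) ϱ).symm) (dPhase f ϱ) (extChartAt (phaseI n) ϱ ϱ) := by
  have h : HasFDerivWithinAt (f ∘ (extChartAt (phaseI n) ϱ).symm) (dPhase f ϱ) (range (phaseI n))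
    (extChartAt (phaseI n) ϱ ϱ) := hf.hasMFDerivAt.2
  rw [ModelWithCorners.range_eq_univ, hasFDerivWithinAt_univ] at h
  exact h

theorem differentiableAt_comp_extChartAt_symm {f : PhaseSpace n N → ℝ} {ϱ₀ ϱ : PhaseSpace n N}
    (h : x ϱ ∈ (chartAt (Model n) (x ϱ₀)).source)
    (hf : MDifferentiableAt (phaseI n) 𝓘(ℝ, ℝ) f ϱ) :
    DifferentiableAt ℝ (f ∘ (extChartAt (phaseI n) ϱ₀).symm) (extChartAt (phaseI n) ϱ₀ ϱ) := by
  have h' := mem_extChartAt_phase_source.2 h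
  rw [← mdifferentiableAt_iff_differentiableAt]
  refine MDifferentiableAt.comp (I' := phaseI n) _ ?_ ?_
  · rwa [(extChartAt (phaseI n) ϱ₀).left_inv h']
  · have := (contMDiffOn_extChartAt_symm (n := 1) (I := phaseI n) ϱ₀).contMDiffAt
      (extChartAt_target_mem_nhds' ((extChartAt (phaseI n) ϱ₀).map_source h'))
    exact this.mdifferentiableAt one_ne_zero

theorem contDiffAt_coordChange {x y z : N} (hy : z ∈ (chartAt (Model n) y).source)
    (hx : z ∈ (chartAt (Model n) x).source) :
    ContDiffAt ℝ 2 (chartAt (Model n) y ∘ (chartAt (Model n) x).symm) (chartAt (Model n) x z) := by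
  have := contDiffWithinAt_ext_coord_change (I := 𝓘(ℝ, Model n)) (n := 2) y x
    (y := chartAt (Model n) x z) (by simp [hx, hy])
  simpa [contDiffWithinAt_univ] using this

theorem tangentCoordChange_eq_fderiv {x y z : N} :
    tangentCoordChange 𝓘(ℝ, Model n) x y z =
      fderiv ℝ (chartAt (Model n) y ∘ (chartAt (Model n) x).symm) (chartAt (Model n) x z) := by
  rw [tangentCoordChange_def, ModelWithCorners.range_eq_univ, fderivWithin_univ]
  rfl

theorem extChartAt_phase_comp_symm {ϱ₀ ϱ : PhaseSpace n N}
    (h : x ϱ ∈ (chartAt (Model n) (x ϱ₀)).source) :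
    extChartAt (phaseI n) ϱ₀ ∘ (extChartAt (phaseI n) ϱ).symm =ᶠ[𝓝 (extChartAt (phaseI n) ϱ ϱ)]
      cotLift (chartAt (Model n) (x ϱ₀) ∘ (chartAt (Model n) (x ϱ)).symm)
        (chartAt (Model n) (x ϱ) ∘ (chartAt (Model n) (x ϱ₀)).symm) := by
  have h0 : ∀ᶠ ϱ' in 𝓝 ϱ, ϱ' ∈ (extChartAt (phaseI n) ϱ₀).source :=
    (isOpen_extChartAt_source ϱ₀).mem_nhds (mem_extChartAt_phase_source.2 h)
  have h1 := (continuousAt_extChartAt_symm (I := phaseI n) ϱ).tendsto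
  rw [extChartAt_to_inv] at h1
  filter_upwards [h1.eventually h0, extChartAt_target_mem_nhds (I := phaseI n) ϱ] with w hw hw1
  obtain ⟨ϱ', hϱ', rfl⟩ : ∃ ϱ' ∈ (extChartAt (phaseI n) ϱ).source, extChartAt (phaseI n) ϱ ϱ' = w :=
    ⟨_, (extChartAt (phaseI n) ϱ).map_target hw1, (extChartAt (phaseI n) ϱ).right_inv hw1⟩
  rw [(extChartAt (phaseI n) ϱ).left_inv hϱ'] at hw
  rw [Function.comp_apply, (extChartAt (phaseI n) ϱ).left_inv hϱ']
  rw [mem_extChartAt_phase_source] at hw hϱ'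
  rw [extChartAt_phase _ _ hw, extChartAt_phase _ _ hϱ', cotLift]
  have h2 : (chartAt (Model n) (x ϱ)).symm (chartAt (Model n) (x ϱ) (x ϱ')) = x ϱ' :=
    (chartAt (Model n) (x ϱ)).left_inv hϱ'
  simp only [Function.comp_apply, h2]
  rw [← tangentCoordChange_eq_fderiv]
  refine Prod.ext rfl (Prod.ext rfl ?_)
  ext v
  simp only [ContinuousLinearMap.comp_apply]
  rw [tangentCoordChange_comp]
  simp [hw, hϱ']

theorem fderiv_coordChange_comp {x y z : N} (hy : z ∈ (chartAt (Model n) y).source)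
    (hx : z ∈ (chartAt (Model n) x).source) (v : Model n) :
    fderiv ℝ (chartAt (Model n) y ∘ (chartAt (Model n) x).symm) (chartAt (Model n) x z)
      (fderiv ℝ (chartAt (Model n) x ∘ (chartAt (Model n) y).symm) (chartAt (Model n) y z) v)
      = v := by
  rw [← tangentCoordChange_eq_fderiv, ← tangentCoordChange_eq_fderiv, tangentCoordChange_comp,
    tangentCoordChange_self] <;> simp [hx, hy]

/-- The canonical Poisson bracket can be computed in any chart. -/
theorem poisson_eq_chart {f h : PhaseSpace n N → ℝ} {ϱ₀ ϱ : PhaseSpace n N}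
    (hϱ : x ϱ ∈ (chartAt (Model n) (x ϱ₀)).source)
    (hf : MDifferentiableAt (phaseI n) 𝓘(ℝ, ℝ) f ϱ)
    (hh : MDifferentiableAt (phaseI n) 𝓘(ℝ, ℝ) h ϱ) :
    poisson f h ϱ =
      linPoisson (fderiv ℝ (f ∘ (extChartAt (phaseI n) ϱ₀).symm) (extChartAt (phaseI n) ϱ₀ ϱ))
        (fderiv ℝ (h ∘ (extChartAt (phaseI n) ϱ₀).symm) (extChartAt (phaseI n) ϱ₀ ϱ)) := by
  set θ := chartAt (Model n) (x ϱ₀) ∘ (chartAt (Model n) (x ϱ)).symm with hθ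
  set ϑ := chartAt (Model n) (x ϱ) ∘ (chartAt (Model n) (x ϱ₀)).symm with hϑ
  have hxϱ := mem_chart_source (Model n) (x ϱ)
  have hΨ := extChartAt_phase ϱ ϱ hxϱ
  have h0 : θ (chartAt (Model n) (x ϱ) (x ϱ)) = chartAt (Model n) (x ϱ₀) (x ϱ) := by
    simp [hθ]
  have h1 : ContDiffAt ℝ 2 θ (extChartAt (phaseI n) ϱ ϱ).2.1 := by
    rw [hΨ]; exact contDiffAt_coordChange hϱ hxϱ
  have h2 : ContDiffAt ℝ 2 ϑ (θ (extChartAt (phaseI n) ϱ ϱ).2.1) := by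
    rw [hΨ, h0]; exact contDiffAt_coordChange hxϱ hϱ
  obtain ⟨T, hT, hT'⟩ := hasFDerivAt_cotLift (w := extChartAt (phaseI n) ϱ ϱ)
    (h1.differentiableAt two_ne_zero)
    ((h2.fderiv_right (m := 1) (by norm_num)).differentiableAt one_ne_zero)
  -- Chain rule: the two differentials of a function differ by the derivative `T` of the transition
  -- map, which is a cotangent lift.
  have key : ∀ f : PhaseSpace n N → ℝ, MDifferentiableAt (phaseI n) 𝓘(ℝ, ℝ) f ϱ →
      dPhase f ϱ = fderiv ℝ (f ∘ (extChartAt (phaseI n) ϱ₀).symm) (extChartAt (phaseI n) ϱ₀ ϱ) ∘L T := by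
    intro f hf
    have h3 := extChartAt_phase_comp_symm hϱ
    have h4 := hT.congr_of_eventuallyEq h3
    have h5 := (differentiableAt_comp_extChartAt_symm hϱ hf).hasFDerivAt
    have h6 : (extChartAt (phaseI n) ϱ₀ ∘ (extChartAt (phaseI n) ϱ).symm) (extChartAt (phaseI n) ϱ ϱ)
        = extChartAt (phaseI n) ϱ₀ ϱ := by
      rw [Function.comp_apply, extChartAt_to_inv]
    rw [← h6] at h5
    have h7 := h5.comp _ h4
    rw [h6] at h7
    refine (hasFDerivAt_dPhase hf).unique (h7.congr_of_eventuallyEq ?_)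
    have h8 := (continuousAt_extChartAt_symm (I := phaseI n) ϱ).tendsto
    rw [extChartAt_to_inv] at h8
    have h9 : ∀ᶠ ϱ' in 𝓝 ϱ, ϱ' ∈ (extChartAt (phaseI n) ϱ₀).source :=
      (isOpen_extChartAt_source ϱ₀).mem_nhds (mem_extChartAt_phase_source.2 hϱ)
    filter_upwards [h8.eventually h9] with w hw
    simp only [Function.comp_apply]
    rw [(extChartAt (phaseI n) ϱ₀).left_inv hw]
  rw [poisson_eq_linPoisson, key f hf, key h hh]
  refine linPoisson_comp_cotLift hT' ?_ ?_ _ _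
  · intro v
    rw [hΨ, h0]
    exact fderiv_coordChange_comp hϱ hxϱ v
  · exact (h2.isSymmSndFDerivAt (by simp))

theorem continuous_linPoisson :
    Continuous fun q : (PhaseModel n →L[ℝ] ℝ) × (PhaseModel n →L[ℝ] ℝ) => linPoisson q.1 q.2 := by
  unfold linPoisson fibVec
  fun_prop

/-- The definition of the bracket uses a chart that changes with the point. By invariance a single
chart serves near `ϱ`, and there the bracket is a continuous function of first derivatives. -/
theorem continuousAt_poisson {f h : PhaseSpace n N → ℝ} {ϱ : PhaseSpace n N}
    (hf : ContMDiffAt (phaseI n) 𝓘(ℝ, ℝ) 1 f ϱ) (hh : ContMDiffAt (phaseI n) 𝓘(ℝ, ℝ) 1 h ϱ) :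
    ContinuousAt (poisson f h) ϱ := by
  have key : ∀ f : PhaseSpace n N → ℝ, ContMDiffAt (phaseI n) 𝓘(ℝ, ℝ) 1 f ϱ →
      ContinuousAt (fun ϱ' => fderiv ℝ (f ∘ (extChartAt (phaseI n) ϱ).symm)
        (extChartAt (phaseI n) ϱ ϱ')) ϱ := by
    intro f hf
    have h1 := (contMDiffAt_iff.1 hf).2
    rw [ModelWithCorners.range_eq_univ, contDiffWithinAt_univ] at h1
    have h2 : ContDiffAt ℝ 0 (fderiv ℝ (f ∘ (extChartAt (phaseI n) ϱ).symm))
        (extChartAt (phaseI n) ϱ ϱ) := h1.fderiv_right (m := 0) (by norm_num)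
    exact h2.continuousAt.comp (continuousAt_extChartAt ϱ)
  have h1 : ∀ᶠ ϱ' in 𝓝 ϱ, ϱ' ∈ (extChartAt (phaseI n) ϱ).source := extChartAt_source_mem_nhds ϱ
  have h2 := ContinuousAt.comp (x := ϱ) continuous_linPoisson.continuousAt
    ((key f hf).prodMk (key h hh))
  refine h2.congr ?_
  filter_upwards [h1, (contMDiffAt_iff_contMDiffAt_nhds (by simp)).1 hf,
    (contMDiffAt_iff_contMDiffAt_nhds (by simp)).1 hh] with ϱ' h3 h4 h5
  exact (poisson_eq_chart (mem_extChartAt_phase_source.1 h3) (h4.mdifferentiableAt one_ne_zero)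
    (h5.mdifferentiableAt one_ne_zero)).symm

theorem tangentCoordChange_self_self (y : N) :
    tangentCoordChange 𝓘(ℝ, Model n) y y y = ContinuousLinearMap.id ℝ (Model n) := by
  ext1 v
  exact tangentCoordChange_self (mem_extChartAt_source y)

/-- Vertical derivatives. -/
theorem hasDerivAt_vertical {f : PhaseSpace n N → ℝ} {ϱ : PhaseSpace n N}
    (hf : MDifferentiableAt (phaseI n) 𝓘(ℝ, ℝ) f ϱ) (e : ℝ × ℝ) (η : Model n →L[ℝ] ℝ) :
    HasDerivAt (fun r : ℝ => f (ϱ.1 + r • e, ⟨x ϱ, (cov ϱ + r • η : Model n →L[ℝ] ℝ)⟩))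
      (dPhase f ϱ (e, (0, η))) 0 := by
  set q : ℝ → PhaseSpace n N := fun r => (ϱ.1 + r • e, ⟨x ϱ, (cov ϱ + r • η : Model n →L[ℝ] ℝ)⟩)
    with hq
  have hx := mem_chart_source (Model n) (x ϱ)
  have h1 : ∀ r, extChartAt (phaseI n) ϱ (q r) = extChartAt (phaseI n) ϱ ϱ + r • (e, (0, η)) := by
    intro r
    rw [extChartAt_phase ϱ (q r) hx, extChartAt_phase ϱ ϱ hx]
    simp only [hq, x, cov, ξ]
    rw [tangentCoordChange_self_self]
    refine Prod.ext rfl (Prod.ext ?_ rfl)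
    simp
  have h2 : ∀ r, f (q r) = (f ∘ (extChartAt (phaseI n) ϱ).symm)
      (extChartAt (phaseI n) ϱ ϱ + r • (e, (0, η))) := by
    intro r
    have hq' : q r ∈ (extChartAt (phaseI n) ϱ).source := mem_extChartAt_phase_source.2 hx
    rw [← h1, Function.comp_apply, (extChartAt (phaseI n) ϱ).left_inv hq']
  have h3 : HasDerivAt (fun r : ℝ => extChartAt (phaseI n) ϱ ϱ + r • ((e, (0, η)) : PhaseModel n))
      (e, (0, η)) 0 := by
    simpa using ((hasDerivAt_id (0 : ℝ)).smul_const ((e, (0, η)) : PhaseModel n)).const_add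
      (extChartAt (phaseI n) ϱ ϱ)
  have h4 := hasFDerivAt_dPhase hf
  have h5 : HasFDerivAt (f ∘ (extChartAt (phaseI n) ϱ).symm) (dPhase f ϱ)
      (extChartAt (phaseI n) ϱ ϱ + (0 : ℝ) • ((e, (0, η)) : PhaseModel n)) := by simpa using h4
  exact (h5.comp_hasDerivAt (0 : ℝ) h3).congr_of_eventuallyEq (Eventually.of_forall h2)

/-! ### Algebra of the metric -/

section Sharp

variable (g : Metric1 n N)

/-- The metric at `y`, on the model space. -/
def flat (y : N) : Model n →L[ℝ] Model n →L[ℝ] ℝ := g.inner y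

theorem exists_equiv_flat (y : N) :
    ∃ e : Model n ≃L[ℝ] (Model n →L[ℝ] ℝ), (e : Model n →L[ℝ] Model n →L[ℝ] ℝ) = flat g y := by
  have hinj : Function.Injective (flat g y : Model n →ₗ[ℝ] (Model n →L[ℝ] ℝ)) := by
    rw [← LinearMap.ker_eq_bot, LinearMap.ker_eq_bot']
    intro v hv
    by_contra h
    have := g.pos y v h
    have h2 : g.inner y v v = flat g y v v := rfl
    rw [h2, show flat g y v = 0 from hv] at this
    simp at this
  have hfin : Module.finrank ℝ (Model n) = Module.finrank ℝ (Model n →L[ℝ] ℝ) := by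
    rw [← LinearEquiv.finrank_eq (LinearMap.toContinuousLinearMap (𝕜 := ℝ) (E := Model n) (F' := ℝ)),
      Module.finrank_linearMap, Module.finrank_self, mul_one]
  refine ⟨(LinearEquiv.ofInjectiveOfFinrankEq _ hinj hfin).toContinuousLinearEquiv, ?_⟩
  ext v w
  rfl

/-- The inverse of the metric at `y`, on the model space. -/
def sharpL (y : N) : (Model n →L[ℝ] ℝ) →L[ℝ] Model n := (flat g y).inverse

theorem flat_sharpL (y : N) (η : Model n →L[ℝ] ℝ) : flat g y (sharpL g y η) = η := by
  obtain ⟨e, he⟩ := exists_equiv_flat g y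
  rw [sharpL, ← he, ContinuousLinearMap.inverse_equiv]
  exact e.apply_symm_apply η

theorem flat_symm (y : N) (v w : Model n) : flat g y v w = flat g y w v := g.symm y v w

theorem coMetric_eq {y : N} (η θ : CotSpace n y) :
    coMetric g η θ = flat g y (sharpL g y η) (sharpL g y θ) := by
  rw [flat_symm]
  exact (DFunLike.congr_fun (flat_sharpL g y θ) (sharpL g y η)).symm

theorem coMetric_comm {y : N} (η θ : CotSpace n y) : coMetric g η θ = coMetric g θ η := by
  rw [coMetric_eq, coMetric_eq, flat_symm]

theorem coMetric_sub_right {y : N} (η θ κ : CotSpace n y) :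
    coMetric g η (θ - κ) = coMetric g η θ - coMetric g η κ := rfl

theorem coMetric_smul_right {y : N} (c : ℝ) (η θ : CotSpace n y) :
    coMetric g η (c • θ) = c * coMetric g η θ := rfl

theorem coMetric_sub_left {y : N} (η θ κ : CotSpace n y) :
    coMetric g (θ - κ) η = coMetric g θ η - coMetric g κ η := by
  simp only [coMetric_comm g _ η, coMetric_sub_right]

theorem coMetric_smul_left {y : N} (c : ℝ) (η θ : CotSpace n y) :
    coMetric g (c • θ) η = c * coMetric g θ η := by
  simp only [coMetric_comm g _ η, coMetric_smul_right]

theorem coMetric_self_pos {y : N} {η : CotSpace n y} (h : η ≠ 0) : 0 < coMetric g η η := by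
  rw [coMetric_eq]
  refine g.pos y (sharpL g y η) fun h0 => h ?_
  have h1 := flat_sharpL g y η
  have h2 : sharpL g y η = 0 := h0
  rw [h2, map_zero] at h1
  exact h1.symm

theorem coMetric_self_nonneg {y : N} (η : CotSpace n y) : 0 ≤ coMetric g η η := by
  by_cases h : η = 0
  · subst h
    exact le_of_eq (show (0 : ℝ) = coMetric g 0 0 from rfl)
  · exact (coMetric_self_pos g h).le

end Sharp

/-! ### Smoothness of the symbol -/

section Smooth

variable (g : Metric1 n N)

/-- The matrix of the metric in the chart at `x₀`: the smoothness of the section is unfolded into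
that of an honest map between fixed vector spaces. -/
theorem contMDiffAt_flat_coord (x₀ : N) :
    ContMDiffAt 𝓘(ℝ, Model n) 𝓘(ℝ, Model n →L[ℝ] Model n →L[ℝ] ℝ) 1
      (fun y => (ContinuousLinearMap.precomp ℝ (tangentCoordChange 𝓘(ℝ, Model n) x₀ y y)) ∘L
        (flat g y ∘L tangentCoordChange 𝓘(ℝ, Model n) x₀ y y)) x₀ := by
  have h := (contMDiffAt_section x₀).1 (g.contMDiff x₀)
  refine h.congr_of_eventuallyEq ?_
  filter_upwards [(chartAt (Model n) x₀).open_source.mem_nhds (mem_chart_source _ x₀)] with y hy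
  rw [hom_trivializationAt_apply, ContinuousLinearMap.inCoordinates,
    TangentBundle.symmL_trivializationAt_eq_core hy]
  ext1 v
  set φ : CotSpace n y := g.inner y (tangentCoordChange 𝓘(ℝ, Model n) x₀ y y v) with hφ
  have hb : y ∈ (trivializationAt (Model n →L[ℝ] ℝ) (fun x : N => CotSpace n x) x₀).baseSet :=
    And.intro hy (mem_univ _)
  have h2 := congrFun (Trivialization.coe_linearMapAt_of_mem (R := ℝ) _ hb) φ
  have h3 := congrArg Prod.snd (trivializationAt_cot x₀ ⟨y, φ⟩ hy)
  exact (h2.trans h3).symm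

theorem contMDiffAt_phase_coord (ϱ₀ : PhaseSpace n N) :
    ContMDiffAt (phaseI n) 𝓘(ℝ, Model n →L[ℝ] ℝ) 1
      (fun ϱ => (cov ϱ).comp (tangentCoordChange 𝓘(ℝ, Model n) (x ϱ₀) (x ϱ) (x ϱ))) ϱ₀ := by
  have h1 : ContMDiffAt (phaseI n) 𝓘(ℝ, PhaseModel n) 1 (extChartAt (phaseI n) ϱ₀) ϱ₀ :=
    contMDiffAt_extChartAt
  have h2 : ContMDiffAt 𝓘(ℝ, PhaseModel n) 𝓘(ℝ, Model n →L[ℝ] ℝ) 1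
      (fun w : PhaseModel n => w.2.2) (extChartAt (phaseI n) ϱ₀ ϱ₀) :=
    (contDiff_snd.comp contDiff_snd).contMDiff.contMDiffAt
  refine (h2.comp ϱ₀ h1).congr_of_eventuallyEq ?_
  filter_upwards [extChartAt_source_mem_nhds (I := phaseI n) ϱ₀] with ϱ hϱ
  rw [Function.comp_apply, extChartAt_phase _ _ (mem_extChartAt_phase_source.1 hϱ)]

theorem contMDiff_x : ContMDiff (phaseI n) 𝓘(ℝ, Model n) 1 (x : PhaseSpace n N → N) :=
  (contMDiff_proj (fun x : N => CotSpace n x)).comp contMDiff_snd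

/-- The pairing of a `C^1` covector with `ξ^♯` is `C^1`. -/
theorem contMDiffAt_apply_sharp {D : PhaseSpace n N → Model n →L[ℝ] ℝ} {ϱ₀ : PhaseSpace n N}
    (hD : ContMDiffAt (phaseI n) 𝓘(ℝ, Model n →L[ℝ] ℝ) 1
      (fun ϱ => (D ϱ).comp (tangentCoordChange 𝓘(ℝ, Model n) (x ϱ₀) (x ϱ) (x ϱ))) ϱ₀) :
    ContMDiffAt (phaseI n) 𝓘(ℝ, ℝ) 1 (fun ϱ => D ϱ (sharpL g (x ϱ) (cov ϱ))) ϱ₀ := by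
  have hΓ := (contMDiffAt_flat_coord g (x ϱ₀)).comp ϱ₀ contMDiff_x.contMDiffAt
  set Γ : N → Model n →L[ℝ] Model n →L[ℝ] ℝ := fun y =>
    (ContinuousLinearMap.precomp ℝ (tangentCoordChange 𝓘(ℝ, Model n) (x ϱ₀) y y)) ∘L
        (flat g y ∘L tangentCoordChange 𝓘(ℝ, Model n) (x ϱ₀) y y) with hΓdef
  have hΓ0 : Γ (x ϱ₀) = flat g (x ϱ₀) := by
    ext v w
    simp only [hΓdef, ContinuousLinearMap.comp_apply, ContinuousLinearMap.precomp_apply,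
      tangentCoordChange_self_self, ContinuousLinearMap.id_apply]
  obtain ⟨e, he⟩ := exists_equiv_flat g (x ϱ₀)
  have hinv : ContMDiffAt (phaseI n) 𝓘(ℝ, (Model n →L[ℝ] ℝ) →L[ℝ] Model n) 1
      (fun ϱ => (Γ (x ϱ)).inverse) ϱ₀ := by
    have h := contDiffAt_map_inverse (n := 1) e
    rw [he, ← hΓ0] at h
    exact h.contMDiffAt.comp ϱ₀ hΓ
  have h := hD.clm_apply (hinv.clm_apply (contMDiffAt_phase_coord ϱ₀))
  refine h.congr_of_eventuallyEq ?_
  filter_upwards [extChartAt_source_mem_nhds (I := phaseI n) ϱ₀] with ϱ hϱ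
  have hϱ' := mem_extChartAt_phase_source.1 hϱ
  have hx := mem_chart_source (Model n) (x ϱ)
  set C := tangentCoordChange 𝓘(ℝ, Model n) (x ϱ₀) (x ϱ) (x ϱ) with hC
  set C' := tangentCoordChange 𝓘(ℝ, Model n) (x ϱ) (x ϱ₀) (x ϱ) with hC'
  have hCC' : ∀ v, C (C' v) = v := fun v => by
    rw [hC, hC', tangentCoordChange_comp, tangentCoordChange_self] <;> simp [hϱ', hx]
  have hC'C : ∀ v, C' (C v) = v := fun v => by
    rw [hC, hC', tangentCoordChange_comp, tangentCoordChange_self] <;> simp [hϱ', hx]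
  obtain ⟨f, hf⟩ := exists_equiv_flat g (x ϱ)
  -- Inversion commutes with the change of coordinates, so the inverse of the coordinate matrix,
  -- which is `C^1`, represents `sharpL` at every nearby point.
  have hkey : (Γ (x ϱ)).inverse = C' ∘L sharpL g (x ϱ) ∘L ContinuousLinearMap.precomp ℝ C' := by
    refine ContinuousLinearMap.inverse_eq ?_ ?_
    · ext η v
      simp only [hΓdef, ContinuousLinearMap.comp_apply, ContinuousLinearMap.precomp_apply, ← hC,
        hCC', flat_sharpL, hC'C, ContinuousLinearMap.id_apply]
    · ext1 v
      refine (show Function.Injective (Γ (x ϱ)) from ?_) ?_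
      · intro v w hvw
        have h2 : flat g (x ϱ) (C v) = flat g (x ϱ) (C w) := by
          ext u
          have := DFunLike.congr_fun hvw (C' u)
          simpa only [hΓdef, ContinuousLinearMap.comp_apply, ContinuousLinearMap.precomp_apply,
            ← hC, hCC'] using this
        rw [← hf] at h2
        have h3 : C v = C w := f.injective h2
        rw [← hC'C v, h3, hC'C]
      · ext u
        simp only [hΓdef, ContinuousLinearMap.comp_apply, ContinuousLinearMap.precomp_apply, ← hC,
        hCC', flat_sharpL, hC'C, ContinuousLinearMap.id_apply]
  rw [hkey]
  simp only [ContinuousLinearMap.comp_apply, ContinuousLinearMap.precomp_apply, hCC']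
  congr 2
  ext v
  simp [hCC']

theorem contMDiff_symb : ContMDiff (phaseI n) 𝓘(ℝ, ℝ) 1 (symb (N := N) g) := by
  intro ϱ₀
  have h1 := contMDiffAt_apply_sharp g (contMDiffAt_phase_coord ϱ₀)
  have h2 : ContMDiff (phaseI n) 𝓘(ℝ, ℝ) 1 (τ : PhaseSpace n N → ℝ) :=
    (contDiff_snd.contMDiff (n := 1)).comp contMDiff_fst
  exact (h2.contMDiffAt.pow 2).neg.add h1

end Smooth

/-! ### Functions of the base point -/

/-- The differential of `z`, as a linear form on the model space. -/
def dcov (z : N → ℝ) (y : N) : Model n →L[ℝ] ℝ := mfderiv 𝓘(ℝ, Model n) 𝓘(ℝ, ℝ) z y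

theorem hasFDerivAt_dcov {z : N → ℝ} {y : N} (hz : MDifferentiableAt 𝓘(ℝ, Model n) 𝓘(ℝ, ℝ) z y) :
    HasFDerivAt (z ∘ (chartAt (Model n) y).symm) (dcov z y) (chartAt (Model n) y y) := by
  have h : HasFDerivWithinAt (z ∘ (chartAt (Model n) y).symm) (dcov z y)
    (range 𝓘(ℝ, Model n)) (chartAt (Model n) y y) := hz.hasMFDerivAt.2
  rwa [ModelWithCorners.range_eq_univ, hasFDerivWithinAt_univ] at h

theorem mdifferentiableAt_base {z : N → ℝ} {ϱ : PhaseSpace n N}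
    (hz : MDifferentiableAt 𝓘(ℝ, Model n) 𝓘(ℝ, ℝ) z (x ϱ)) :
    MDifferentiableAt (phaseI n) 𝓘(ℝ, ℝ) (fun ϱ' => z (x ϱ')) ϱ :=
  hz.comp ϱ (contMDiff_x.mdifferentiable one_ne_zero ϱ)

theorem dPhase_base {z : N → ℝ} {ϱ : PhaseSpace n N}
    (hz : MDifferentiableAt 𝓘(ℝ, Model n) 𝓘(ℝ, ℝ) z (x ϱ)) (w : PhaseModel n) :
    dPhase (fun ϱ' : PhaseSpace n N => z (x ϱ')) ϱ w = dcov z (x ϱ) w.2.1 := by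
  have h1 := hasFDerivAt_dPhase (mdifferentiableAt_base hz)
  have hx := mem_chart_source (Model n) (x ϱ)
  have h2 : HasFDerivAt (z ∘ (chartAt (Model n) (x ϱ)).symm) (dcov z (x ϱ))
      (extChartAt (phaseI n) ϱ ϱ).2.1 := by
    rw [extChartAt_phase ϱ ϱ hx]; exact hasFDerivAt_dcov hz
  have h3 : HasFDerivAt (fun w : PhaseModel n => w.2.1) _ (extChartAt (phaseI n) ϱ ϱ) :=
    HasFDerivAt.comp _ hasFDerivAt_fst (hasFDerivAt_snd (𝕜 := ℝ))
  have h4 := HasFDerivAt.comp (f := fun w : PhaseModel n => w.2.1) (extChartAt (phaseI n) ϱ ϱ) h2 h3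
  have h5 : (fun ϱ' : PhaseSpace n N => z (x ϱ')) ∘ (extChartAt (phaseI n) ϱ).symm
      =ᶠ[𝓝 (extChartAt (phaseI n) ϱ ϱ)]
      (z ∘ (chartAt (Model n) (x ϱ)).symm) ∘ fun w : PhaseModel n => w.2.1 := by
    filter_upwards [extChartAt_target_mem_nhds (I := phaseI n) ϱ] with w hw
    obtain ⟨ϱ', hϱ', rfl⟩ : ∃ ϱ' ∈ (extChartAt (phaseI n) ϱ).source,
        extChartAt (phaseI n) ϱ ϱ' = w :=
      ⟨_, (extChartAt (phaseI n) ϱ).map_target hw, (extChartAt (phaseI n) ϱ).right_inv hw⟩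
    have h6 := mem_extChartAt_phase_source.1 hϱ'
    simp only [Function.comp_apply]
    rw [(extChartAt (phaseI n) ϱ).left_inv hϱ', extChartAt_phase ϱ ϱ' h6,
      (chartAt (Model n) (x ϱ)).left_inv h6]
  rw [h1.unique (h4.congr_of_eventuallyEq h5)]
  rfl

theorem linPoisson_anticomm (L L' : PhaseModel n →L[ℝ] ℝ) : linPoisson L L' = - linPoisson L' L := by
  simp only [linPoisson]; ring

theorem poisson_anticomm (f h : PhaseSpace n N → ℝ) (ϱ : PhaseSpace n N) :
    poisson f h ϱ = - poisson h f ϱ := by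
  rw [poisson_eq_linPoisson, poisson_eq_linPoisson, linPoisson_anticomm]

theorem poisson_base_right {z : N → ℝ} {ϱ : PhaseSpace n N}
    (hz : MDifferentiableAt 𝓘(ℝ, Model n) 𝓘(ℝ, ℝ) z (x ϱ)) (h : PhaseSpace n N → ℝ) :
    poisson h (fun ϱ' => z (x ϱ')) ϱ = dPhase h ϱ (0, (0, dcov z (x ϱ))) := by
  have hf : fibVec (dPhase (fun ϱ' : PhaseSpace n N => z (x ϱ')) ϱ) = 0 := by
    simp [fibVec, dPhase_base hz]
  rw [poisson_eq_linPoisson, linPoisson, hf, dPhase_base hz, dPhase_base hz, dPhase_base hz]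
  have h0 : dPhase h ϱ (0, (0, 0)) = 0 := map_zero _
  simpa [h0] using apply_fibVec (dPhase h ϱ) (dcov z (x ϱ))

theorem poisson_base_left {z : N → ℝ} {ϱ : PhaseSpace n N}
    (hz : MDifferentiableAt 𝓘(ℝ, Model n) 𝓘(ℝ, ℝ) z (x ϱ)) (h : PhaseSpace n N → ℝ) :
    poisson (fun ϱ' => z (x ϱ')) h ϱ = - dPhase h ϱ (0, (0, dcov z (x ϱ))) := by
  rw [poisson_anticomm, poisson_base_right hz]

theorem dPhase_fst (L : ℝ × ℝ →L[ℝ] ℝ) (ϱ : PhaseSpace n N) (w : PhaseModel n) :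
    dPhase (fun ϱ' : PhaseSpace n N => L ϱ'.1) ϱ w = L w.1 := by
  have h0 : MDifferentiableAt (phaseI n) 𝓘(ℝ, ℝ) (fun ϱ' : PhaseSpace n N => L ϱ'.1) ϱ :=
    L.differentiableAt.mdifferentiableAt.comp ϱ mdifferentiableAt_fst
  have h1 := hasFDerivAt_dPhase h0
  have h2 : HasFDerivAt (fun w : PhaseModel n => L w.1) (L ∘L ContinuousLinearMap.fst ℝ _ _)
      (extChartAt (phaseI n) ϱ ϱ) := L.hasFDerivAt.comp _ hasFDerivAt_fst
  have h5 : (fun ϱ' : PhaseSpace n N => L ϱ'.1) ∘ (extChartAt (phaseI n) ϱ).symm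
      =ᶠ[𝓝 (extChartAt (phaseI n) ϱ ϱ)] fun w : PhaseModel n => L w.1 := by
    filter_upwards [extChartAt_target_mem_nhds (I := phaseI n) ϱ] with w hw
    obtain ⟨ϱ', hϱ', rfl⟩ : ∃ ϱ' ∈ (extChartAt (phaseI n) ϱ).source,
        extChartAt (phaseI n) ϱ ϱ' = w :=
      ⟨_, (extChartAt (phaseI n) ϱ).map_target hw, (extChartAt (phaseI n) ϱ).right_inv hw⟩
    simp only [Function.comp_apply]
    rw [(extChartAt (phaseI n) ϱ).left_inv hϱ', extChartAt_phase ϱ ϱ'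
      (mem_extChartAt_phase_source.1 hϱ')]
  rw [h1.unique (h2.congr_of_eventuallyEq h5)]
  rfl

/-! ### Brackets with the symbol -/

section Metric

variable (g : Metric1 n N)

/-- On a fibre the symbol is a quadratic polynomial, whose coefficients are read off using the
symmetry of the dual metric. -/
theorem dPhase_symb_vertical (ϱ : PhaseSpace n N) (e : ℝ × ℝ) (η : Model n →L[ℝ] ℝ) :
    dPhase (symb g) ϱ (e, (0, η)) = -2 * τ ϱ * e.2 + 2 * η (sharpL g (x ϱ) (cov ϱ)) := by
  have h1 := hasDerivAt_vertical ((contMDiff_symb g).mdifferentiable one_ne_zero ϱ) e η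
  have h2 : ∀ r : ℝ, symb g ((ϱ.1 + r • e, ⟨x ϱ, (cov ϱ + r • η : Model n →L[ℝ] ℝ)⟩) :
      PhaseSpace n N) = - (τ ϱ + r * e.2) ^ 2 + (cov ϱ + r • η)
        (sharpL g (x ϱ) (cov ϱ + r • η)) := fun r => rfl
  have h3 : HasDerivAt (fun r : ℝ => - (τ ϱ + r * e.2) ^ 2 + (coMetric g (ξ ϱ) (ξ ϱ) + 
      r * (2 * η (sharpL g (x ϱ) (cov ϱ))) + r ^ 2 * η (sharpL g (x ϱ) η)))
      (-2 * τ ϱ * e.2 + 2 * η (sharpL g (x ϱ) (cov ϱ))) 0 := by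
    have h4 : HasDerivAt (fun r : ℝ => τ ϱ + r * e.2) (1 * e.2) 0 :=
      ((hasDerivAt_id (0 : ℝ)).mul_const e.2).const_add _
    have h5 : HasDerivAt (fun r : ℝ => coMetric g (ξ ϱ) (ξ ϱ) + 
      r * (2 * η (sharpL g (x ϱ) (cov ϱ)))) (1 * (2 * η (sharpL g (x ϱ) (cov ϱ)))) 0 :=
      ((hasDerivAt_id (0 : ℝ)).mul_const _).const_add _
    have h6 : HasDerivAt (fun r : ℝ => r ^ 2 * η (sharpL g (x ϱ) η)) _ 0 :=
      (hasDerivAt_pow 2 (0 : ℝ)).mul_const _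
    refine (((h4.pow 2).neg).add (h5.add h6)).congr_deriv ?_
    norm_num
  refine h1.unique (h3.congr_of_eventuallyEq (Eventually.of_forall fun r => ?_))
  refine (h2 r).trans ?_
  have h7 : (cov ϱ) (sharpL g (x ϱ) η) = η (sharpL g (x ϱ) (cov ϱ)) :=
    coMetric_comm (y := x ϱ) g η (cov ϱ)
  have h8 : coMetric g (ξ ϱ) (ξ ϱ) = cov ϱ (sharpL g (x ϱ) (cov ϱ)) := rfl
  rw [h8]
  simp only [map_add, map_smul, add_apply, smul_apply,
    smul_eq_mul, h7]
  ring

/-- `H_p z = 2 ⟨dz, ξ^♯⟩`. -/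
theorem poisson_symb_base {z : N → ℝ} {ϱ : PhaseSpace n N}
    (hz : MDifferentiableAt 𝓘(ℝ, Model n) 𝓘(ℝ, ℝ) z (x ϱ)) :
    poisson (symb g) (fun ϱ' => z (x ϱ')) ϱ = 2 * dcov z (x ϱ) (sharpL g (x ϱ) (cov ϱ)) := by
  rw [poisson_base_right hz, dPhase_symb_vertical]
  simp

theorem dcov_comp_coordChange {z : N → ℝ} {x₀ y : N} (hy : y ∈ (chartAt (Model n) x₀).source)
    (hz : MDifferentiableAt 𝓘(ℝ, Model n) 𝓘(ℝ, ℝ) z y) :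
    (dcov z y).comp (tangentCoordChange 𝓘(ℝ, Model n) x₀ y y) =
      fderiv ℝ (z ∘ (chartAt (Model n) x₀).symm) (chartAt (Model n) x₀ y) := by
  have hy' := mem_chart_source (Model n) y
  have h1 : HasFDerivAt (chartAt (Model n) y ∘ (chartAt (Model n) x₀).symm)
      (tangentCoordChange 𝓘(ℝ, Model n) x₀ y y) (chartAt (Model n) x₀ y) := by
    rw [tangentCoordChange_eq_fderiv]
    exact ((contDiffAt_coordChange hy' hy).differentiableAt two_ne_zero).hasFDerivAt
  have h2 : HasFDerivAt (z ∘ (chartAt (Model n) y).symm) (dcov z y)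
      ((chartAt (Model n) y ∘ (chartAt (Model n) x₀).symm) (chartAt (Model n) x₀ y)) := by
    rw [Function.comp_apply, (chartAt (Model n) x₀).left_inv hy]
    exact hasFDerivAt_dcov hz
  refine ((h2.comp _ h1).congr_of_eventuallyEq ?_).fderiv.symm
  have h3 := ((chartAt (Model n) x₀).continuousAt_symm ((chartAt (Model n) x₀).map_source hy)).tendsto
  rw [(chartAt (Model n) x₀).left_inv hy] at h3
  filter_upwards [h3.eventually ((chartAt (Model n) y).open_source.mem_nhds hy')] with w hw
  simp only [Function.comp_apply]
  rw [(chartAt (Model n) y).left_inv hw]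

theorem contMDiffAt_dcov_coord {z : N → ℝ} {x₀ : N}
    (hz : ContMDiffAt 𝓘(ℝ, Model n) 𝓘(ℝ, ℝ) 2 z x₀) :
    ContMDiffAt 𝓘(ℝ, Model n) 𝓘(ℝ, Model n →L[ℝ] ℝ) 1
      (fun y => (dcov z y).comp (tangentCoordChange 𝓘(ℝ, Model n) x₀ y y)) x₀ := by
  have h1 := (contMDiffAt_iff.1 hz).2
  rw [ModelWithCorners.range_eq_univ, contDiffWithinAt_univ] at h1
  have h2 : ContDiffAt ℝ 1 (fderiv ℝ (z ∘ (chartAt (Model n) x₀).symm)) (chartAt (Model n) x₀ x₀) :=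
    h1.fderiv_right (m := 1) (by norm_num)
  have h3 : ContMDiffAt 𝓘(ℝ, Model n) 𝓘(ℝ, Model n) 1 (chartAt (Model n) x₀) x₀ :=
    contMDiffAt_extChartAt
  have : IsManifold 𝓘(ℝ, Model n) 1 N := .of_le (n := 2) one_le_two
  refine (h2.contMDiffAt.comp x₀ h3).congr_of_eventuallyEq ?_
  filter_upwards [(chartAt (Model n) x₀).open_source.mem_nhds (mem_chart_source _ x₀),
    (contMDiffAt_iff_contMDiffAt_nhds (by simp)).1 hz] with y hy hy2
  exact dcov_comp_coordChange hy (hy2.mdifferentiableAt two_ne_zero)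

theorem eventually_contMDiffAt_base {z : N → ℝ} {ϱ : PhaseSpace n N}
    (hz : ContMDiffAt 𝓘(ℝ, Model n) 𝓘(ℝ, ℝ) 2 z (x ϱ)) :
    ∀ᶠ ϱ' in 𝓝 ϱ, ContMDiffAt 𝓘(ℝ, Model n) 𝓘(ℝ, ℝ) 2 z (x ϱ') :=
  (contMDiff_x.continuous.tendsto ϱ).eventually ((contMDiffAt_iff_contMDiffAt_nhds (by simp)).1 hz)

theorem contMDiffAt_base {z : N → ℝ} {ϱ : PhaseSpace n N}
    (hz : ContMDiffAt 𝓘(ℝ, Model n) 𝓘(ℝ, ℝ) 2 z (x ϱ)) :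
    ContMDiffAt (phaseI n) 𝓘(ℝ, ℝ) 1 (fun ϱ' => z (x ϱ')) ϱ :=
  (hz.of_le one_le_two).comp ϱ contMDiff_x.contMDiffAt

/-- The bracket only differentiates the symbol in the fibre, so no derivative of the metric enters:
a `C^1` metric and a `C^2` function `z` suffice. This is what makes `H_p² z` defined and continuous.
-/
theorem contMDiffAt_poisson_symb_base {z : N → ℝ} {ϱ : PhaseSpace n N}
    (hz : ContMDiffAt 𝓘(ℝ, Model n) 𝓘(ℝ, ℝ) 2 z (x ϱ)) :
    ContMDiffAt (phaseI n) 𝓘(ℝ, ℝ) 1 (poisson (symb g) (fun ϱ' => z (x ϱ'))) ϱ := by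
  have h1 := contMDiffAt_apply_sharp g (D := fun ϱ => dcov z (x ϱ))
    ((contMDiffAt_dcov_coord hz).comp ϱ contMDiff_x.contMDiffAt)
  refine ((contMDiffAt_const (c := (2 : ℝ))).mul h1).congr_of_eventuallyEq ?_
  filter_upwards [eventually_contMDiffAt_base hz] with ϱ' h
  exact poisson_symb_base g (h.mdifferentiableAt two_ne_zero)

theorem dPhase_poisson_symb_base_vertical {z : N → ℝ} {ϱ : PhaseSpace n N}
    (hz : ContMDiffAt 𝓘(ℝ, Model n) 𝓘(ℝ, ℝ) 2 z (x ϱ)) (η : Model n →L[ℝ] ℝ) :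
    dPhase (poisson (symb g) (fun ϱ' => z (x ϱ'))) ϱ (0, (0, η)) =
      2 * dcov z (x ϱ) (sharpL g (x ϱ) η) := by
  have h1 := hasDerivAt_vertical
    ((contMDiffAt_poisson_symb_base g hz).mdifferentiableAt one_ne_zero) 0 η
  have h2 : ∀ r : ℝ, poisson (symb g) (fun ϱ' => z (x ϱ')) ((ϱ.1 + r • (0 : ℝ × ℝ),
      ⟨x ϱ, (cov ϱ + r • η : Model n →L[ℝ] ℝ)⟩) : PhaseSpace n N) =
        2 * dcov z (x ϱ) (sharpL g (x ϱ) (cov ϱ)) + r * (2 * dcov z (x ϱ) (sharpL g (x ϱ) η)) := by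
    intro r
    refine (poisson_symb_base g (ϱ := (ϱ.1 + r • (0 : ℝ × ℝ),
      ⟨x ϱ, (cov ϱ + r • η : Model n →L[ℝ] ℝ)⟩)) (hz.mdifferentiableAt two_ne_zero)).trans ?_
    change 2 * dcov z (x ϱ) (sharpL g (x ϱ) (cov ϱ + r • η)) = _
    simp only [map_add, map_smul, smul_eq_mul]
    ring
  have h3 : HasDerivAt (fun r : ℝ => 2 * dcov z (x ϱ) (sharpL g (x ϱ) (cov ϱ)) +
      r * (2 * dcov z (x ϱ) (sharpL g (x ϱ) η))) (1 * (2 * dcov z (x ϱ) (sharpL g (x ϱ) η))) 0 :=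
    ((hasDerivAt_id (0 : ℝ)).mul_const _).const_add _
  rw [one_mul] at h3
  exact h1.unique (h3.congr_of_eventuallyEq (Eventually.of_forall h2))

theorem poisson_symb_fst (L : ℝ × ℝ →L[ℝ] ℝ) (ϱ : PhaseSpace n N) :
    poisson (symb g) (fun ϱ' : PhaseSpace n N => L ϱ'.1) ϱ = L (-2 * τ ϱ, 0) := by
  refine (dPhase_fst L ϱ (hamField (symb g) ϱ)).trans ?_
  have h1 : dPhase (symb g) ϱ ((0, 1), 0) = -2 * τ ϱ := 
    (dPhase_symb_vertical g ϱ (0, 1) 0).trans (by simp)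
  have h2 : dPhase (symb g) ϱ ((1, 0), 0) = 0 := 
    (dPhase_symb_vertical g ϱ (1, 0) 0).trans (by simp)
  change L (dPhase (symb g) ϱ ((0, 1), 0), - dPhase (symb g) ϱ ((1, 0), 0)) = _
  rw [h1, h2, neg_zero]

theorem poisson_base_fst {z : N → ℝ} {ϱ : PhaseSpace n N}
    (hz : MDifferentiableAt 𝓘(ℝ, Model n) 𝓘(ℝ, ℝ) z (x ϱ)) (L : ℝ × ℝ →L[ℝ] ℝ) :
    poisson (fun ϱ' => z (x ϱ')) (fun ϱ' : PhaseSpace n N => L ϱ'.1) ϱ = 0 := by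
  rw [poisson_base_left hz, dPhase_fst, neg_eq_zero]
  exact map_zero L

/-- `H_{z'} H_p z = - 2 g*(dz, dz')`. -/
theorem poisson_base_poisson_symb_base {z z' : N → ℝ} {ϱ : PhaseSpace n N}
    (hz : ContMDiffAt 𝓘(ℝ, Model n) 𝓘(ℝ, ℝ) 2 z (x ϱ))
    (hz' : MDifferentiableAt 𝓘(ℝ, Model n) 𝓘(ℝ, ℝ) z' (x ϱ)) :
    poisson (fun ϱ' => z' (x ϱ')) (poisson (symb g) (fun ϱ' => z (x ϱ'))) ϱ =
      - (2 * dcov z (x ϱ) (sharpL g (x ϱ) (dcov z' (x ϱ)))) := by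
  rw [poisson_base_left hz', dPhase_poisson_symb_base_vertical g hz]

theorem dPhase_neg (f : PhaseSpace n N → ℝ) (ϱ : PhaseSpace n N) :
    dPhase (-f) ϱ = - dPhase f ϱ := mfderiv_neg

/-- `H_z² p = 2 |dz|²`. -/
theorem poisson_base_poisson_base_symb {z : N → ℝ} {ϱ : PhaseSpace n N}
    (hz : ContMDiffAt 𝓘(ℝ, Model n) 𝓘(ℝ, ℝ) 2 z (x ϱ)) :
    poisson (fun ϱ' => z (x ϱ')) (poisson (fun ϱ' => z (x ϱ')) (symb g)) ϱ =
      2 * dcov z (x ϱ) (sharpL g (x ϱ) (dcov z (x ϱ))) := by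
  have h : poisson (fun ϱ' => z (x ϱ')) (symb g) =
      -(poisson (symb g) (fun ϱ' : PhaseSpace n N => z (x ϱ'))) :=
    funext fun ϱ' => poisson_anticomm _ _ _
  rw [h, poisson_base_left (hz.mdifferentiableAt two_ne_zero), dPhase_neg, neg_apply, neg_neg,
    dPhase_poisson_symb_base_vertical g hz]

open Classical in
theorem dPhase_genField (M : Set N) (h : PhaseSpace n N → ℝ) (ϱ : PhaseSpace n N) :
    dPhase h ϱ (genField g M ϱ) = poisson (symb g) h ϱ +
      if ϱ ∈ gliding g M then Hp2z g M ϱ / Hz2p g M ϱ * poisson (zLift M ϱ) h ϱ else 0 := by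
  rw [genField]
  split_ifs with hϱ
  · exact ((dPhase h ϱ).map_add _ _).trans (congrArg _ ((dPhase h ϱ).map_smul _ _))
  · exact (add_zero _).symm

end Metric

/-! ### Boundary charts -/

/-- The last coordinate of a chart. -/
def lastCoord (φ : OpenPartialHomeomorph N (Model n)) (y : N) : ℝ := φ y (Fin.last n)

variable {M : Set N} {φ ψ : OpenPartialHomeomorph N (Model n)} {m : N}

theorem IsBoundaryChart.contMDiffAt (hφ : IsBoundaryChart M φ) (hm : m ∈ φ.source) :
    ContMDiffAt 𝓘(ℝ, Model n) 𝓘(ℝ, ℝ) 2 (lastCoord φ) m := by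
  have h1 := (contMDiffOn_of_mem_maximalAtlas hφ.1).contMDiffAt (φ.open_source.mem_nhds hm)
  have h2 : ContMDiffAt 𝓘(ℝ, Model n) 𝓘(ℝ, ℝ) 2 (EuclideanSpace.proj (Fin.last n) : Model n →L[ℝ] ℝ)
    (φ m) := (ContinuousLinearMap.contDiff _).contMDiff.contMDiffAt
  exact h2.comp m h1

theorem IsBoundaryChart.mdifferentiableAt (hφ : IsBoundaryChart M φ) (hm : m ∈ φ.source) :
    MDifferentiableAt 𝓘(ℝ, Model n) 𝓘(ℝ, ℝ) (lastCoord φ) m :=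
  (hφ.contMDiffAt hm).mdifferentiableAt two_ne_zero

theorem eventually_mem_source_vertical (hm : m ∈ φ.source) :
    ∀ᶠ r : ℝ in 𝓝 0, φ m + r • EuclideanSpace.single (Fin.last n) (1 : ℝ) ∈ φ.target := by
  have h : Tendsto (fun r : ℝ => φ m + r • EuclideanSpace.single (Fin.last n) (1 : ℝ)) (𝓝 0)
      (𝓝 (φ m)) := by
    have : Continuous (fun r : ℝ => φ m + r • EuclideanSpace.single (Fin.last n) (1 : ℝ)) := by
      fun_prop
    simpa using this.tendsto 0
  exact h.eventually (φ.open_target.mem_nhds (φ.map_source hm))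

theorem lastCoord_symm_vertical {r : ℝ}
    (hr : φ m + r • EuclideanSpace.single (Fin.last n) (1 : ℝ) ∈ φ.target) :
    lastCoord φ (φ.symm (φ m + r • EuclideanSpace.single (Fin.last n) (1 : ℝ))) =
      lastCoord φ m + r := by
  simp [lastCoord, φ.right_inv hr]

/-- Where `z ≠ 0` its sign is locally constant, so the point is interior or exterior; from a point
with `z = 0`, decreasing `z` alone leaves `M`. -/
theorem IsBoundaryChart.mem_frontier_iff (hφ : IsBoundaryChart M φ) (hm : m ∈ φ.source) :
    m ∈ frontier M ↔ lastCoord φ m = 0 := by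
  have hc : ContinuousAt (lastCoord φ) m := (hφ.contMDiffAt hm).continuousAt
  have hs := φ.open_source.mem_nhds hm
  constructor
  · intro h
    by_contra h0
    rcases lt_or_gt_of_ne h0 with h0 | h0
    · have : ∀ᶠ y in 𝓝 m, y ∉ M := by
        filter_upwards [hs, hc.eventually (gt_mem_nhds h0)] with y hy hy2
        rw [hφ.2 y hy]; exact not_le.2 hy2
      exact mem_closure_iff_frequently.1 h.1 this
    · refine h.2 (mem_interior_iff_mem_nhds.2 ?_)
      filter_upwards [hs, hc.eventually (lt_mem_nhds h0)] with y hy hy2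
      exact (hφ.2 y hy).2 hy2.le
  · intro h
    refine ⟨subset_closure ((hφ.2 m hm).2 h.ge), fun hi => ?_⟩
    have h1 : Tendsto (fun r : ℝ => φ.symm (φ m + r • EuclideanSpace.single (Fin.last n) (1 : ℝ)))
        (𝓝 0) (𝓝 m) := by
      have h2 := φ.continuousAt_symm (φ.map_source hm)
      rw [ContinuousAt, φ.left_inv hm] at h2
      refine h2.comp ?_
      have : Continuous (fun r : ℝ => φ m + r • EuclideanSpace.single (Fin.last n) (1 : ℝ)) := by
        fun_prop
      simpa using this.tendsto 0
    have h3 : ∀ᶠ r : ℝ in 𝓝[<] 0, False := by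
      filter_upwards [nhdsWithin_le_nhds (h1.eventually (mem_interior_iff_mem_nhds.1 hi)),
        nhdsWithin_le_nhds (eventually_mem_source_vertical hm), self_mem_nhdsWithin] with r h4 h5 h6
      have h7 := (hφ.2 _ (φ.map_target h5)).1 h4
      have h8 := lastCoord_symm_vertical h5
      rw [h, zero_add] at h8
      exact absurd (h8 ▸ h7 : (0 : ℝ) ≤ r) (not_le.2 h6)
    exact (h3.exists).elim fun _ h => h

theorem IsBoundaryChart.dcov_ne_zero (hφ : IsBoundaryChart M φ) (hm : m ∈ φ.source) :
    dcov (n := n) (lastCoord φ) m ≠ 0 := by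
  set e : Model n := EuclideanSpace.single (Fin.last n) (1 : ℝ)
  have h1 : MDifferentiableAt 𝓘(ℝ, Model n) 𝓘(ℝ, Model n) φ.symm (φ m) :=
    ((contMDiffOn_symm_of_mem_maximalAtlas hφ.1).contMDiffAt
      (φ.open_target.mem_nhds (φ.map_source hm))).mdifferentiableAt two_ne_zero
  have h2 : HasMFDerivAt 𝓘(ℝ, Model n) 𝓘(ℝ, ℝ) (lastCoord φ) (φ.symm (φ m))
      (dcov (lastCoord φ) m) := by
    rw [φ.left_inv hm]; exact (hφ.mdifferentiableAt hm).hasMFDerivAt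
  have h3 : HasFDerivAt (lastCoord φ ∘ φ.symm) ((dcov (n := n) (lastCoord φ) m) ∘L
      (mfderiv 𝓘(ℝ, Model n) 𝓘(ℝ, Model n) φ.symm (φ m) : Model n →L[ℝ] Model n)) (φ m) :=
    (h2.comp (φ m) h1.hasMFDerivAt).hasFDerivAt
  have h4 : HasFDerivAt (lastCoord φ ∘ φ.symm) (EuclideanSpace.proj (Fin.last n) : Model n →L[ℝ] ℝ)
      (φ m) := by
    refine (ContinuousLinearMap.hasFDerivAt _).congr_of_eventuallyEq ?_
    filter_upwards [φ.open_target.mem_nhds (φ.map_source hm)] with w hw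
    simp [lastCoord, φ.right_inv hw]
  intro h0
  have h7 : (EuclideanSpace.proj (Fin.last n) : Model n →L[ℝ] ℝ) e = 1 := by simp [e]
  have h5 : dcov (n := n) (lastCoord φ) m
      ((mfderiv 𝓘(ℝ, Model n) 𝓘(ℝ, Model n) φ.symm (φ m) : Model n →L[ℝ] Model n) e) = 1 :=
    (congrArg (fun L : Model n →L[ℝ] ℝ => L e) (h3.unique h4)).trans h7
  rw [h0] at h5
  exact zero_ne_one h5

/-- The differentials of two boundary charts are proportional at boundary points. -/
theorem IsBoundaryChart.exists_dcov_eq (hφ : IsBoundaryChart M φ) (hψ : IsBoundaryChart M ψ)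
    (hm : m ∈ frontier M) (hmφ : m ∈ φ.source) (hmψ : m ∈ ψ.source) :
    ∃ k > (0 : ℝ), dcov (n := n) (lastCoord ψ) m = k • dcov (lastCoord φ) m := by
  set L := dcov (n := n) (lastCoord φ) m
  set L' := dcov (n := n) (lastCoord ψ) m
  -- A straight segment leaving `m` in a direction with `L v > 0` enters `M`, so the other defining
  -- function is nonnegative along it.
  have key : ∀ v, 0 < L v → 0 ≤ L' v := by
    intro v hv
    set χ := chartAt (Model n) m
    have hcur : HasDerivAt (fun r : ℝ => χ m + r • v) v 0 := by
      simpa using ((hasDerivAt_id (0 : ℝ)).smul_const v).const_add (χ m)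
    have hd : ∀ {θ : OpenPartialHomeomorph N (Model n)}, IsBoundaryChart M θ → m ∈ θ.source →
        HasDerivAt (fun r : ℝ => lastCoord θ (χ.symm (χ m + r • v)))
          (dcov (lastCoord θ) m v) 0 := by
      intro θ hθ hmθ
      have h1 := hasFDerivAt_dcov (hθ.mdifferentiableAt hmθ)
      have h2 : χ m = χ m + (0 : ℝ) • v := by simp
      change HasFDerivAt _ _ (χ m) at h1
      rw [h2] at h1
      exact h1.comp_hasDerivAt 0 hcur
    have ht : Tendsto (fun r : ℝ => χ.symm (χ m + r • v)) (𝓝 0) (𝓝 m) := by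
      have h1 := χ.continuousAt_symm (χ.map_source (mem_chart_source (Model n) m))
      rw [ContinuousAt, χ.left_inv (mem_chart_source (Model n) m)] at h1
      have h2 := hcur.continuousAt.tendsto
      simp only [zero_smul, add_zero] at h2
      exact h1.comp h2
    have h0 : ∀ {θ : OpenPartialHomeomorph N (Model n)}, IsBoundaryChart M θ → m ∈ θ.source →
        lastCoord θ (χ.symm (χ m + (0 : ℝ) • v)) = 0 := by
      intro θ hθ hmθ
      rw [zero_smul, add_zero, χ.left_inv (mem_chart_source (Model n) m)]
      exact (hθ.mem_frontier_iff hmθ).1 hm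
    have h1 := (hasDerivAt_iff_tendsto_slope.1 (hd hφ hmφ)).eventually (lt_mem_nhds hv)
    have hle : 𝓝[>] (0 : ℝ) ≤ 𝓝[≠] 0 := nhdsWithin_mono _ fun r hr => (mem_Ioi.1 hr).ne'
    have h2 := (hasDerivAt_iff_tendsto_slope.1 (hd hψ hmψ)).mono_left hle
    refine ge_of_tendsto h2 ?_
    filter_upwards [h1.filter_mono hle,
      nhdsWithin_le_nhds (ht.eventually (φ.open_source.mem_nhds hmφ)),
      nhdsWithin_le_nhds (ht.eventually (ψ.open_source.mem_nhds hmψ)),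
      self_mem_nhdsWithin] with r h3 h4 h5 h6
    rw [slope_def_field, h0 hφ hmφ, sub_zero, sub_zero] at h3
    rw [slope_def_field, h0 hψ hmψ, sub_zero, sub_zero]
    have h7 : 0 < lastCoord φ (χ.symm (χ m + r • v)) := (div_pos_iff_of_pos_right h6).1 h3
    exact div_nonneg ((hψ.2 _ h5).1 ((hφ.2 _ h4).2 h7.le)) (le_of_lt h6)
  obtain ⟨v, hv⟩ : ∃ v, L v ≠ 0 := by
    by_contra! h
    exact hφ.dcov_ne_zero hmφ (ContinuousLinearMap.ext h)
  set v₀ := (L v)⁻¹ • v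
  have hv₀ : L v₀ = 1 := by simp [v₀, hv]
  -- Otherwise a suitable multiple of `w` could be added to `v₀`, keeping `L` equal to `1` and
  -- making `L'` equal to `-1`.
  have hker : ∀ w, L w = 0 → L' w = 0 := by
    intro w hw
    by_contra h
    have h1 := key (v₀ + (-(L' v₀ + 1) / L' w) • w) (by simp [hv₀, hw])
    simp only [map_add, map_smul, smul_eq_mul] at h1
    rw [div_mul_cancel₀ _ h] at h1
    linarith
  have heq : L' = L' v₀ • L := by
    ext w
    have h1 := hker (w - L w • v₀) (by simp [hv₀])
    simp only [map_sub, map_smul, smul_eq_mul] at h1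
    simp only [smul_apply, smul_eq_mul]
    linarith
  refine ⟨L' v₀, lt_of_le_of_ne (key v₀ (by simp [hv₀])) fun h => ?_, heq⟩
  rw [← h, zero_smul] at heq
  exact hψ.dcov_ne_zero hmψ heq

/-! ### The conormal -/

theorem IsC2Domain.isBoundaryChart_bdryChartAt (hM : IsC2Domain n M) (hm : m ∈ frontier M) :
    IsBoundaryChart M (bdryChartAt (n := n) M m) ∧ m ∈ (bdryChartAt (n := n) M m).source := by
  have h := hM.exists_chart m hm
  rw [bdryChartAt, dif_pos h]
  exact h.choose_spec

variable (g : Metric1 n N)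

theorem dz_ne_zero (hM : IsC2Domain n M) (hm : m ∈ frontier M) : dz n M m ≠ 0 :=
  (hM.isBoundaryChart_bdryChartAt hm).1.dcov_ne_zero (hM.isBoundaryChart_bdryChartAt hm).2

theorem dzNorm_pos (hM : IsC2Domain n M) (hm : m ∈ frontier M) : 0 < dzNorm g M m :=
  Real.sqrt_pos.2 (coMetric_self_pos g (dz_ne_zero hM hm))

theorem coMetric_dz_dz (m : N) : coMetric g (dz n M m) (dz n M m) = dzNorm g M m ^ 2 :=
  (Real.sq_sqrt (coMetric_self_nonneg g _)).symm

theorem dz_eq_smul_conormal (hM : IsC2Domain n M) (hm : m ∈ frontier M) :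
    dz n M m = dzNorm g M m • conormal g M m := by
  rw [conormal]
  exact (smul_inv_smul₀ (dzNorm_pos g hM hm).ne' (dz n M m)).symm

theorem coMetric_conormal_conormal (hM : IsC2Domain n M) (hm : m ∈ frontier M) :
    coMetric g (conormal g M m) (conormal g M m) = 1 := by
  have h := (dzNorm_pos g hM hm).ne'
  rw [conormal, coMetric_smul_left, coMetric_smul_right, coMetric_dz_dz]
  field_simp

/-- In a boundary chart, `dz` is a positive multiple of the conormal. -/
theorem IsBoundaryChart.dcov_eq_smul_conormal (hM : IsC2Domain n M) (hφ : IsBoundaryChart M φ)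
    (hm : m ∈ frontier M) (hmφ : m ∈ φ.source) :
    ∃ k > (0 : ℝ), dcov (lastCoord φ) m = k • (show Model n →L[ℝ] ℝ from conormal g M m) := by
  obtain ⟨k, hk, h⟩ := (hM.isBoundaryChart_bdryChartAt hm).1.exists_dcov_eq hφ hm
    (hM.isBoundaryChart_bdryChartAt hm).2 hmφ
  refine ⟨k * dzNorm g M m, mul_pos hk (dzNorm_pos g hM hm), h.trans ?_⟩
  rw [mul_smul]
  exact congrArg (k • ·) (dz_eq_smul_conormal g hM hm)

variable {ϱ : PhaseSpace n N}

theorem contMDiffAt_zAt (hM : IsC2Domain n M) (hm : m ∈ frontier M) :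
    ContMDiffAt 𝓘(ℝ, Model n) 𝓘(ℝ, ℝ) 2 (zAt n M m) m :=
  (hM.isBoundaryChart_bdryChartAt hm).1.contMDiffAt (hM.isBoundaryChart_bdryChartAt hm).2

theorem Hpz_eq (hM : IsC2Domain n M) (hϱ : ϱ ∈ bdryTL n M) :
    Hpz g M ϱ = 2 * dzNorm g M (x ϱ) * coMetric g (ξ ϱ) (conormal g M (x ϱ)) := by
  have h1 : Hpz g M ϱ = 2 * coMetric g (ξ ϱ) (dz n M (x ϱ)) :=
    poisson_symb_base g ((contMDiffAt_zAt hM hϱ).mdifferentiableAt two_ne_zero)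
  rw [h1, dz_eq_smul_conormal g hM hϱ, coMetric_smul_right, mul_assoc]

theorem Hz2p_eq (hM : IsC2Domain n M) (hϱ : ϱ ∈ bdryTL n M) :
    Hz2p g M ϱ = 2 * dzNorm g M (x ϱ) ^ 2 := by
  have h1 : Hz2p g M ϱ = 2 * coMetric g (dz n M (x ϱ)) (dz n M (x ϱ)) :=
    poisson_base_poisson_base_symb g (contMDiffAt_zAt hM hϱ)
  rw [h1, coMetric_dz_dz]

theorem Hpz_eq_zero_iff (hM : IsC2Domain n M) (hϱ : ϱ ∈ bdryTL n M) :
    Hpz g M ϱ = 0 ↔ coMetric g (ξ ϱ) (conormal g M (x ϱ)) = 0 := by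
  rw [Hpz_eq g hM hϱ]
  simp [(dzNorm_pos g hM hϱ).ne']

theorem Hpz_neg_iff (hM : IsC2Domain n M) (hϱ : ϱ ∈ bdryTL n M) :
    Hpz g M ϱ < 0 ↔ coMetric g (ξ ϱ) (conormal g M (x ϱ)) < 0 := by
  rw [Hpz_eq g hM hϱ]
  have := dzNorm_pos g hM hϱ
  rw [← neg_pos, ← mul_neg, mul_pos_iff_of_pos_left (by positivity), neg_pos]

theorem jump_eq (hM : IsC2Domain n M) (hϱ : ϱ ∈ bdryTL n M) :
    jump g M ϱ = 2 * Real.sqrt (- symb g ϱ) := by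
  have h1 : ξPlus g M ϱ - ξMinus g M ϱ = (2 * Real.sqrt (- symb g ϱ)) • conormal g M (x ϱ) := by
    rw [ξPlus, ξMinus, two_mul, add_smul]; abel
  have h2 : jump g M ϱ = 2 * Real.sqrt (- symb g ϱ) *
      coMetric g (conormal g M (x ϱ)) (conormal g M (x ϱ)) := by
    rw [jump, h1]; rfl
  rw [h2, coMetric_conormal_conormal g hM hϱ, mul_one]


/-- Pythagoras: projecting removes the square of the normal component from the norm of the covector.
-/
theorem symb_projPar (hM : IsC2Domain n M) (hϱ : ϱ ∈ bdryTL n M) (h0 : symb g ϱ = 0) :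
    symb g (projPar g M ϱ) = - coMetric g (ξ ϱ) (conormal g M (x ϱ)) ^ 2 := by
  have h1 : symb g (projPar g M ϱ) = - τ ϱ ^ 2 + coMetric g
    (ξ ϱ - coMetric g (ξ ϱ) (conormal g M (x ϱ)) • conormal g M (x ϱ))
    (ξ ϱ - coMetric g (ξ ϱ) (conormal g M (x ϱ)) • conormal g M (x ϱ)) := rfl
  have h2 : symb g ϱ = - τ ϱ ^ 2 + coMetric g (ξ ϱ) (ξ ϱ) := rfl
  rw [h1, coMetric_sub_left, coMetric_sub_right, coMetric_sub_right, coMetric_smul_left,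
    coMetric_smul_left, coMetric_smul_right, coMetric_smul_right,
    coMetric_conormal_conormal g hM hϱ, coMetric_comm g (conormal g M (x ϱ)) (ξ ϱ)]
  linear_combination h0 - h2

/-- The sign comes from outgoing points having negative normal component. It makes `ϱ` the point
`ϱ^-` above its projection, and its reflection the point `ϱ^+`. -/
theorem sqrt_neg_symb_projPar (hM : IsC2Domain n M) (hϱ : ϱ ∈ hypMinus g M) :
    Real.sqrt (- symb g (projPar g M ϱ)) = - coMetric g (ξ ϱ) (conormal g M (x ϱ)) := by
  rw [symb_projPar g hM hϱ.1 hϱ.2.1, neg_neg, Real.sqrt_sq_eq_abs,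
    abs_of_neg ((Hpz_neg_iff g hM hϱ.1).1 hϱ.2.2)]

theorem jump_projPar (hM : IsC2Domain n M) (hϱ : ϱ ∈ hypMinus g M) :
    jump g M (projPar g M ϱ) = - (2 * coMetric g (ξ ϱ) (conormal g M (x ϱ))) := by
  have h : projPar g M ϱ ∈ bdryTL n M := hϱ.1
  rw [jump_eq g hM h, sqrt_neg_symb_projPar g hM hϱ, mul_neg]

theorem projPar_mem_parHyp (hM : IsC2Domain n M) (hϱ : ϱ ∈ hypMinus g M) :
    projPar g M ϱ ∈ parHyp g M := by
  refine ⟨⟨hϱ.1, ?_⟩, ?_⟩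
  · change coMetric g (ξ ϱ - coMetric g (ξ ϱ) (conormal g M (x ϱ)) • conormal g M (x ϱ))
      (conormal g M (x ϱ)) = 0
    rw [coMetric_sub_left, coMetric_smul_left, coMetric_conormal_conormal g hM hϱ.1]
    ring
  · have h := (Hpz_neg_iff g hM hϱ.1).1 hϱ.2.2
    rw [mem_ofPred_eq, symb_projPar g hM hϱ.1 hϱ.2.1]
    nlinarith

theorem sub_smul_sub_neg_smul {V : Type*} [AddCommGroup V] [Module ℝ V] (u w : V) (c : ℝ) :
    u - c • w - (-c) • w = u := by module

theorem sub_smul_add_neg_smul {V : Type*} [AddCommGroup V] [Module ℝ V] (u w : V) (c : ℝ) :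
    u - c • w + (-c) • w = u - (2 * c) • w := by module

theorem withCov_ξMinus_projPar (hM : IsC2Domain n M) (hϱ : ϱ ∈ hypMinus g M) :
    withCov (projPar g M ϱ) (ξMinus g M (projPar g M ϱ)) = ϱ := by
  have h1 : ξMinus g M (projPar g M ϱ) =
    (ξ ϱ - coMetric g (ξ ϱ) (conormal g M (x ϱ)) • conormal g M (x ϱ)) -
      Real.sqrt (- symb g (projPar g M ϱ)) • conormal g M (x ϱ) := rfl
  rw [sqrt_neg_symb_projPar g hM hϱ] at h1
  have h2 : ξMinus g M (projPar g M ϱ) = ξ ϱ := h1.trans (sub_smul_sub_neg_smul _ _ _)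
  rw [h2]
  rfl

theorem withCov_ξPlus_projPar (hM : IsC2Domain n M) (hϱ : ϱ ∈ hypMinus g M) :
    withCov (projPar g M ϱ) (ξPlus g M (projPar g M ϱ)) = reflect g M ϱ := by
  have h1 : ξPlus g M (projPar g M ϱ) =
    (ξ ϱ - coMetric g (ξ ϱ) (conormal g M (x ϱ)) • conormal g M (x ϱ)) +
      Real.sqrt (- symb g (projPar g M ϱ)) • conormal g M (x ϱ) := rfl
  rw [sqrt_neg_symb_projPar g hM hϱ] at h1
  have h2 : ξPlus g M (projPar g M ϱ) =
      ξ ϱ - (2 * coMetric g (ξ ϱ) (conormal g M (x ϱ))) • conormal g M (x ϱ) :=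
    h1.trans (sub_smul_add_neg_smul _ _ _)
  rw [h2]
  rfl

theorem glancing_subset_parGla (hM : IsC2Domain n M) : glancing g M ⊆ parGla g M :=
  fun _ h => ⟨⟨h.1, (Hpz_eq_zero_iff g hM h.1).1 h.2.2⟩, h.2.1⟩

/-- `dz(ξ^♯)` jumps by a multiple of `⟨ξ^+ - ξ^-, n⟩` at reflections. -/
theorem IsBoundaryChart.poisson_reflect (hM : IsC2Domain n M) (hφ : IsBoundaryChart M φ)
    (hϱ : ϱ ∈ hypMinus g M) (hmφ : x ϱ ∈ φ.source) :
    poisson (symb g) (fun ϱ' => lastCoord φ (x ϱ')) (reflect g M ϱ) -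
      poisson (symb g) (fun ϱ' => lastCoord φ (x ϱ')) ϱ =
      2 * Real.sqrt (coMetric g (x := x ϱ) (dcov (lastCoord φ) (x ϱ)) (dcov (lastCoord φ) (x ϱ))) *
        jump g M (projPar g M ϱ) := by
  obtain ⟨k, hk, h⟩ := hφ.dcov_eq_smul_conormal g hM hϱ.1 hmφ
  have h1 := poisson_symb_base g (ϱ := ϱ) (hφ.mdifferentiableAt hmφ)
  have h2 := poisson_symb_base g (ϱ := reflect g M ϱ) (hφ.mdifferentiableAt hmφ)
  rw [h1, h2]
  have h3 : coMetric g (x := x ϱ) (dcov (lastCoord φ) (x ϱ)) (dcov (lastCoord φ) (x ϱ)) = k ^ 2 := by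
    rw [h]
    have := coMetric_conormal_conormal g hM hϱ.1
    refine ((coMetric_smul_left g k _ _).trans (congrArg _ (coMetric_smul_right g k _ _))).trans ?_
    rw [this]; ring
  rw [h3, Real.sqrt_sq hk.le, jump_projPar g hM hϱ]
  change 2 * (dcov (lastCoord φ) (x ϱ)) (sharpL g (x ϱ) (cov ϱ - (2 * coMetric g (ξ ϱ) (conormal g M (x ϱ))) • (show Model n →L[ℝ] ℝ from conormal g M (x ϱ)))) - _ = _
  rw [map_sub, map_smul, map_sub, map_smul]
  have h4 : (dcov (lastCoord φ) (x ϱ)) (sharpL g (x ϱ) (show Model n →L[ℝ] ℝ from conormal g M (x ϱ))) = k := by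
    rw [h]
    refine (coMetric_smul_right g k (conormal g M (x ϱ)) _).trans ?_
    rw [coMetric_conormal_conormal g hM hϱ.1, mul_one]
  rw [h4, smul_eq_mul]
  ring

/-! ### The topology of phase space -/

/-- Points over distinct base points are separated in the base, points of one fibre in a local
trivialization. -/
theorem t2Space_cotBundle [T2Space N] : T2Space (CotBundle n N) := by
  refine ⟨fun p q hpq => ?_⟩
  have hc : Continuous (fun q : CotBundle n N => q.proj) :=
    FiberBundle.continuous_proj (Model n →L[ℝ] ℝ) _
  by_cases h : p.proj = q.proj
  · set e := trivializationAt (Model n →L[ℝ] ℝ) (fun x : N => CotSpace n x) p.proj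
    have hp : p ∈ e.source := FiberBundle.mem_trivializationAt_proj_source
    have hq : q ∈ e.source := by
      rw [e.mem_source, ← h, ← e.mem_source]; exact hp
    have hne : e p ≠ e q := fun h0 => hpq (e.injOn hp hq h0)
    obtain ⟨U, V, hU, hV, hpU, hqV, hUV⟩ := t2_separation hne
    refine ⟨e.source ∩ e ⁻¹' U, e.source ∩ e ⁻¹' V, e.continuousOn.isOpen_inter_preimage
      e.open_source hU, e.continuousOn.isOpen_inter_preimage e.open_source hV, ⟨hp, hpU⟩,
      ⟨hq, hqV⟩, ?_⟩
    exact (hUV.preimage e).mono inter_subset_right inter_subset_right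
  · obtain ⟨U, V, hU, hV, hpU, hqV, hUV⟩ := t2_separation h
    exact ⟨_, _, hU.preimage hc, hV.preimage hc, hpU, hqV, hUV.preimage _⟩

theorem locallyCompactSpace_phaseSpace : LocallyCompactSpace (PhaseSpace n N) :=
  Manifold.locallyCompact_of_finiteDimensional (phaseI n)

theorem secondCountableTopology_cotBundle [SecondCountableTopology N] :
    SecondCountableTopology (CotBundle n N) := by
  obtain ⟨s, hs, hcov⟩ := TopologicalSpace.countable_cover_nhds
    (fun y : N => (chartAt (Model n) y).open_source.mem_nhds (mem_chart_source _ y))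
  have : SecondCountableTopology (ModelProd (Model n) (Model n →L[ℝ] ℝ)) := by
    have : ProperSpace (Model n →L[ℝ] ℝ) := FiniteDimensional.proper_real _
    exact inferInstanceAs (SecondCountableTopology (Model n × (Model n →L[ℝ] ℝ)))
  refine ChartedSpace.secondCountable_of_countable_cover
    (ModelProd (Model n) (Model n →L[ℝ] ℝ)) (s := (fun y => (⟨y, 0⟩ : CotBundle n N)) '' s)
    ?_ (hs.image _)
  refine eq_univ_of_forall fun q => ?_
  obtain ⟨y, hy, hqy⟩ := mem_iUnion₂.1 (hcov.symm ▸ mem_univ q.proj)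
  refine mem_iUnion₂.2 ⟨_, mem_image_of_mem _ hy, ?_⟩
  exact (mem_extChartAt_phase_source (ϱ₀ := ((0, 0), ⟨y, 0⟩)) (ϱ := ((0, 0), q))).2 hqy
    |> fun h => by
      rw [extChartAt_source, prodChartedSpace_chartAt] at h
      exact h.2

/-! ### Generalized bicharacteristics -/

section Curve

variable (g : Metric1 n N) (M : Set N) (B : Set ℝ)

/-- The extension of a generalized bicharacteristic by its left limits. -/
structure IsReflCurve (v : ℝ → PhaseSpace n N) : Prop where
  countable : B.Countable
  mem : ∀ s ∉ B, v s ∈ charSet g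
  notMem_hyp : ∀ s ∉ B, v s ∉ hypPlus g M ∪ hypMinus g M
  mem_hypMinus : ∀ S ∈ B, v S ∈ hypMinus g M
  continuousAt : ∀ s ∉ B, ContinuousAt v s
  tendsto_left : ∀ S ∈ B, Tendsto v (𝓝[<] S) (𝓝 (v S))
  tendsto_right : ∀ S ∈ B, Tendsto v (𝓝[>] S) (𝓝 (reflect g M (v S)))
  hasDerivAt : ∀ s ∉ B, ∀ h : PhaseSpace n N → ℝ, ContMDiffAt (phaseI n) 𝓘(ℝ, ℝ) 1 h (v s) →
    HasDerivAt (h ∘ v) (dPhase h (v s) (genField g M (v s))) s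

end Curve

/-- The function `f` is continuous only near `u s`, so its composition with `v` need not extend `f ∘
u` at all times. Only the points of `B` in a neighbourhood `I` of `s` are treated as exceptional,
which does not change the germ at `s`. -/
theorem IsLeftExt.hasDerivAt_comp {X : Type*} [TopologicalSpace X] [RegularSpace X] {B : Set ℝ}
    {u v : ℝ → X} (h : IsLeftExt B u v) {f : X → ℝ} {s U : ℝ} (hs : s ∉ B)
    (hu : ContinuousWithinAt u Bᶜ s) (hf : ∀ᶠ y in 𝓝 (u s), ContinuousAt f y)
    (hd : HasDerivWithinAt (f ∘ u) U Bᶜ s) : HasDerivAt (f ∘ v) U s := by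
  classical
  have hv := h.continuousAt hs hu
  rw [ContinuousAt, h.eq_of_notMem s hs] at hv
  obtain ⟨I, hI, hIo, hsI⟩ := eventually_nhds_iff.1 (hv.eventually hf)
  have h1 : IsLeftExt (B ∩ I) (f ∘ u) (fun r => if r ∈ B ∩ I then f (v r) else f (u r)) := by
    refine ⟨h.countable.mono inter_subset_left, fun r hr => if_neg hr, fun S hS => ?_⟩
    rw [if_pos hS]
    refine ((hI S hS.2).tendsto.comp (h.tendsto S hS.1)).mono_left (nhdsWithin_le_iff.2 ?_)
    filter_upwards [self_mem_nhdsWithin, nhdsWithin_le_nhds (hIo.mem_nhds hS.2)] with r hr hr2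
    exact ⟨fun hB => hr.1 ⟨hB, hr2⟩, hr.2⟩
  have hd' : HasDerivWithinAt (f ∘ u) U (B ∩ I)ᶜ s := by
    refine hd.mono_of_mem_nhdsWithin ?_
    filter_upwards [self_mem_nhdsWithin, nhdsWithin_le_nhds (hIo.mem_nhds hsI)] with r hr hr2
    exact fun hB => hr ⟨hB, hr2⟩
  have h2 := h1.hasDerivAt (fun h0 => hs h0.1) hd'
  refine h2.congr_of_eventuallyEq ?_
  filter_upwards [hIo.mem_nhds hsI] with r hr
  by_cases hrB : r ∈ B
  · rw [if_pos ⟨hrB, hr⟩]; rfl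
  · rw [if_neg fun h0 => hrB h0.1, Function.comp_apply, h.eq_of_notMem r hrB]

variable {g : Metric1 n N} {M : Set N} {B : Set ℝ} {γ : ℝ → PhaseSpace n N}

theorem IsGenBichar.countable (hγ : IsGenBichar g M univ B γ) : B.Countable :=
  (HereditarilyLindelofSpace.isLindelof B).countable_of_isDiscrete hγ.discrete

/-- The left limits give a curve defined at all times, with the generalized flow as two-sided
derivative off `B`. Differentiability is recorded by testing against `C^1` functions, the only form
used later. -/
theorem IsGenBichar.exists_isReflCurve [T2Space N] (hγ : IsGenBichar g M univ B γ) :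
    ∃ v, IsLeftExt B γ v ∧ IsReflCurve g M B v := by
  classical
  have : T2Space (CotBundle n N) := t2Space_cotBundle
  have : LocallyCompactSpace (PhaseSpace n N) := locallyCompactSpace_phaseSpace
  have : Nonempty (PhaseSpace n N) := ⟨γ 0⟩
  have hB : univ \ B = Bᶜ := (compl_eq_univ_sdiff B).symm
  have hleft : ∀ S ∈ B, ∃ ϱ ∈ hypMinus g M, Tendsto γ (𝓝[Bᶜ ∩ Iio S] S) (𝓝 ϱ) := fun S hS => by
    have := hγ.left S hS ⟨1, one_pos, subset_univ _⟩
    rwa [hB] at this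
  have hright : ∀ S ∈ B, ∃ ϱ ∈ hypPlus g M, Tendsto γ (𝓝[Bᶜ ∩ Ioi S] S) (𝓝 ϱ) := fun S hS => by
    have := hγ.right S hS ⟨1, one_pos, subset_univ _⟩
    rwa [hB] at this
  choose! l hl hlt using hleft
  choose! r hr hrt using hright
  have hrl : ∀ S ∈ B, r S = reflect g M (l S) := fun S hS =>
    hγ.reflection S hS ⟨1, one_pos, subset_univ _⟩ _ _ (by rw [hB]; exact hlt S hS)
      (by rw [hB]; exact hrt S hS)
  set v : ℝ → PhaseSpace n N := fun s => if s ∈ B then l s else γ s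
  have hvB : ∀ S ∈ B, v S = l S := fun S hS => if_pos hS
  have hvn : ∀ s ∉ B, v s = γ s := fun s hs => if_neg hs
  have hv : IsLeftExt B γ v := ⟨hγ.countable, hvn, fun S hS => by rw [hvB S hS]; exact hlt S hS⟩
  have hd : ∀ s ∉ B, HasMFDerivWithinAt 𝓘(ℝ, ℝ) (phaseI n) γ Bᶜ s
      ((1 : ℝ →L[ℝ] ℝ).smulRight (genField g M (γ s))) := fun s hs => by
    have := hγ.hasDeriv s ⟨mem_univ s, hs⟩
    rwa [hB] at this
  refine ⟨v, hv, hγ.countable, fun s hs => ?_, fun s hs => ?_, fun S hS => ?_, fun s hs => ?_,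
    fun S hS => hv.tendsto_left hS, fun S hS => ?_, fun s hs h hh => ?_⟩
  · rw [hvn s hs]; exact (hγ.mem s ⟨mem_univ s, hs⟩).1
  · rw [hvn s hs]; exact hγ.notMem_hyp s ⟨mem_univ s, hs⟩
  · rw [hvB S hS]; exact hl S hS
  · exact hv.continuousAt hs (hd s hs).continuousWithinAt
  · rw [hvB S hS, ← hrl S hS]
    exact hv.tendsto_nhdsWithin isOpen_Ioi (hrt S hS)
  · rw [hvn s hs] at hh ⊢
    refine hv.hasDerivAt_comp hs (hd s hs).continuousWithinAt ?_ ?_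
    · filter_upwards [(contMDiffAt_iff_contMDiffAt_nhds (by simp)).1 hh] with y hy
      exact hy.continuousAt
    · have h1 : HasFDerivWithinAt (h ∘ γ) (dPhase h (γ s) ∘L
          ((1 : ℝ →L[ℝ] ℝ).smulRight (genField g M (γ s) : PhaseModel n))) Bᶜ s :=
        ((hh.mdifferentiableAt one_ne_zero).hasMFDerivAt.comp_hasMFDerivWithinAt s
          (hd s hs)).hasFDerivWithinAt
      refine h1.hasDerivWithinAt.congr_deriv ?_
      change dPhase h (γ s) ((1 : ℝ) • genField g M (γ s)) = _
      exact congrArg _ (one_smul ℝ (genField g M (γ s)))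

/-! ### Conservation of τ and escape from compact sets -/

variable {g : Metric1 n N} {M : Set N} {B : Set ℝ} {v : ℝ → PhaseSpace n N}

theorem contMDiff_fst_comp (L : ℝ × ℝ →L[ℝ] ℝ) :
    ContMDiff (phaseI n) 𝓘(ℝ, ℝ) 1 (fun ϱ : PhaseSpace n N => L ϱ.1) :=
  (L.contDiff.contMDiff (n := 1)).comp contMDiff_fst

theorem dPhase_genField_fst (hM : IsC2Domain n M) (L : ℝ × ℝ →L[ℝ] ℝ) (ϱ : PhaseSpace n N) :
    dPhase (fun ϱ' : PhaseSpace n N => L ϱ'.1) ϱ (genField g M ϱ) = L (-2 * τ ϱ, 0) := by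
  rw [dPhase_genField, poisson_symb_fst, add_eq_left]
  split_ifs with h
  swap
  · rfl
  have h1 := (contMDiffAt_zAt hM h.1.1).mdifferentiableAt two_ne_zero
  exact mul_eq_zero_of_right _ (poisson_base_fst (z := zAt n M (x ϱ)) h1 L)

namespace IsReflCurve

theorem tendsto_left' (hv : IsReflCurve g M B v) (s : ℝ) : Tendsto v (𝓝[<] s) (𝓝 (v s)) := by
  by_cases hs : s ∈ B
  · exact hv.tendsto_left s hs
  · exact (hv.continuousAt s hs).tendsto.mono_left nhdsWithin_le_nhds

/-- Reflections fix `t` and `τ`, and `H_z` has no component along them, so these variables have no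
jumps and evolve by `H_p` alone. -/
theorem fst_sub_fst (hM : IsC2Domain n M) (hv : IsReflCurve g M B v) (L : ℝ × ℝ →L[ℝ] ℝ) {C : ℝ}
    (hC : ∀ s, |L (-2 * τ (v s), 0)| ≤ C) (a b : ℝ) :
    L (v b).1 - L (v a).1 = ∫ s in a..b, L (-2 * τ (v s), 0) := by
  have hc := (contMDiff_fst_comp (n := n) (N := N) L).continuous
  have h := integral_deriv_eq_sub_sub_jumps (u := fun s => L (v s).1)
    (U := fun s => L (-2 * τ (v s), 0)) (j := 0) (a := a) (b := b) (C := C) hv.countable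
    summable_zero (fun s => (hc.tendsto _).comp (hv.tendsto_left' s)) (fun s => ?_)
    fun s hs => ⟨hC s, ?_⟩
  · rw [h]; simp [jumpFun]
  · rw [Pi.zero_apply, add_zero]
    by_cases hs : s ∈ B
    · exact (hc.tendsto (reflect g M (v s))).comp (hv.tendsto_right s hs)
    · exact (hc.tendsto _).comp ((hv.continuousAt s hs).tendsto.mono_left nhdsWithin_le_nhds)
  · rw [← dPhase_genField_fst (g := g) hM L (v s)]
    exact hv.hasDerivAt s hs _ (contMDiff_fst_comp L).contMDiffAt

theorem τ_eq (hM : IsC2Domain n M) (hv : IsReflCurve g M B v) (s : ℝ) : τ (v s) = τ (v 0) := by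
  have h := hv.fst_sub_fst hM (ContinuousLinearMap.snd ℝ ℝ ℝ) (C := 0) (by simp) 0 s
  simp only [ContinuousLinearMap.coe_snd', intervalIntegral.integral_zero] at h
  exact sub_eq_zero.1 h

theorem t_eq (hM : IsC2Domain n M) (hv : IsReflCurve g M B v) (s : ℝ) :
    t (v s) = t (v 0) - 2 * τ (v 0) * s := by
  have h := hv.fst_sub_fst hM (ContinuousLinearMap.fst ℝ ℝ ℝ) (C := |-2 * τ (v 0)|)
    (fun s => by simp [hv.τ_eq hM s]) 0 s
  simp only [ContinuousLinearMap.coe_fst', hv.τ_eq hM, intervalIntegral.integral_const,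
    smul_eq_mul] at h
  change t (v s) - t (v 0) = _ at h
  linarith

theorem injective (hM : IsC2Domain n M) (hv : IsReflCurve g M B v) (hτ : τ (v 0) ≠ 0) :
    Function.Injective v := fun s r h => by
  have h1 := hv.t_eq hM s
  rw [h, hv.t_eq hM r] at h1
  have h2 : τ (v 0) * (s - r) = 0 := by linarith
  exact sub_eq_zero.1 ((mul_eq_zero.1 h2).resolve_left hτ)

/-- The curve leaves every compact set. -/
theorem exists_forall_mem_Icc (hM : IsC2Domain n M) (hv : IsReflCurve g M B v) (hτ : τ (v 0) ≠ 0)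
    {K : Set (PhaseSpace n N)} (hK : IsCompact K) :
    ∃ R > 0, ∀ ϱ ∈ K, ∀ s, t ϱ = t (v s) → s ∈ Icc (-R) R := by
  -- Only the variable `t` is used, so the conclusion also controls the times of reflected and
  -- projected points of the curve.
  have hc : Continuous (fun ϱ : PhaseSpace n N => t ϱ) := continuous_fst.comp continuous_fst
  obtain ⟨C, hC⟩ := (hK.image hc).isBounded.exists_norm_le
  refine ⟨(|C| + |t (v 0)|) / |2 * τ (v 0)| + 1, by positivity, fun ϱ hϱ s hs => ?_⟩
  have h1 : |t (v s)| ≤ |C| := by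
    rw [← hs]; exact (hC _ (mem_image_of_mem _ hϱ)).trans (le_abs_self C)
  have h2 : |2 * τ (v 0)| * |s| ≤ |C| + |t (v 0)| := by
    rw [← abs_mul]
    have : 2 * τ (v 0) * s = t (v 0) - t (v s) := by rw [hv.t_eq hM s]; ring
    rw [this]
    exact (abs_sub _ _).trans (by linarith)
  have h3 : 0 < |2 * τ (v 0)| := by positivity
  rw [mem_Icc, ← abs_le]
  have h4 : |s| ≤ (|C| + |t (v 0)|) / |2 * τ (v 0)| := by
    rw [le_div_iff₀ h3, mul_comm]; exact h2
  linarith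

/-- The curve is continuous off a countable set, so the preimage of an open set is open up to a
countable set. -/
theorem measurable [MeasurableSpace (PhaseSpace n N)] [BorelSpace (PhaseSpace n N)]
    (hv : IsReflCurve g M B v) : Measurable v := by
  refine measurable_of_isOpen fun O hO => ?_
  have h1 : v ⁻¹' O ∩ Bᶜ ⊆ interior (v ⁻¹' O) := fun s hs =>
    mem_interior_iff_mem_nhds.2 ((hv.continuousAt s hs.2) (hO.mem_nhds hs.1))
  have h2 : v ⁻¹' O = interior (v ⁻¹' O) ∪ (v ⁻¹' O ∩ B) := by
    refine Subset.antisymm (fun s hs => ?_) (union_subset interior_subset inter_subset_left)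
    by_cases hB : s ∈ B
    · exact Or.inr ⟨hs, hB⟩
    · exact Or.inl (h1 ⟨hs, hB⟩)
  rw [h2]
  exact isOpen_interior.measurableSet.union (hv.countable.mono inter_subset_right).measurableSet

end IsReflCurve

/-- On the characteristic set `τ² = |ξ|²`, so `τ = 0` would force the whole covector to vanish. -/
theorem IsGenBichar.τ_ne_zero {γ : ℝ → PhaseSpace n N} (hM : IsC2Domain n M)
    (hγ0 : Nontriv univ B γ) (hv : IsLeftExt B γ v) (hv' : IsReflCurve g M B v) :
    τ (v 0) ≠ 0 := by
  obtain ⟨s, hs, h⟩ := hγ0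
  intro h0
  rw [← hv'.τ_eq hM s, hv.eq_of_notMem s hs.2] at h0
  refine h ⟨h0, ?_⟩
  have h1 := hv'.mem s hs.2
  rw [hv.eq_of_notMem s hs.2] at h1
  by_contra h2
  have h3 : - τ (γ s) ^ 2 + coMetric g (ξ (γ s)) (ξ (γ s)) = 0 := h1
  rw [h0] at h3
  have := coMetric_self_pos g h2
  norm_num at h3
  linarith

/-! ### Times at which the curve touches the boundary -/

/-- The function `H_p z`, where `z` is the last coordinate of `φ`. -/
def chartVel (g : Metric1 n N) (φ : OpenPartialHomeomorph N (Model n)) : PhaseSpace n N → ℝ :=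
  poisson (symb g) (fun ϱ' => lastCoord φ (x ϱ'))

/-- The squared norm of `dz`, where `z` is the last coordinate of `φ`. -/
def chartNormSq (g : Metric1 n N) (φ : OpenPartialHomeomorph N (Model n)) (y : N) : ℝ :=
  coMetric g (x := y) (dcov (lastCoord φ) y) (dcov (lastCoord φ) y)

/-- The curvature term `H_p² z / |dz|`. -/
def curvTerm (g : Metric1 n N) (M : Set N) (ϱ : PhaseSpace n N) : ℝ :=
  Hp2z g M ϱ / dzNorm g M (x ϱ)

/-- The times, off `B`, at which the curve is at the boundary. -/
def bdryTimes (M : Set N) (B : Set ℝ) (v : ℝ → PhaseSpace n N) : Set ℝ :=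
  {s | s ∉ B ∧ v s ∈ bdryTL n M}

/-- The points of `B`, and the boundary times that are isolated from the right. -/
def excTimes (M : Set N) (B : Set ℝ) (v : ℝ → PhaseSpace n N) : Set ℝ :=
  B ∪ {s | s ∈ bdryTimes M B v ∧ 𝓝[bdryTimes M B v ∩ Ioi s] s = ⊥}

variable {g : Metric1 n N} {M : Set N} {B : Set ℝ} {v : ℝ → PhaseSpace n N}
  {φ : OpenPartialHomeomorph N (Model n)} {ϱ : PhaseSpace n N}

theorem IsBoundaryChart.contMDiffAt_chartVel (hφ : IsBoundaryChart M φ) (h : x ϱ ∈ φ.source) :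
    ContMDiffAt (phaseI n) 𝓘(ℝ, ℝ) 1 (chartVel g φ) ϱ :=
  contMDiffAt_poisson_symb_base g (hφ.contMDiffAt h)

theorem IsBoundaryChart.poisson_chartVel (hφ : IsBoundaryChart M φ) (h : x ϱ ∈ φ.source) :
    poisson (fun ϱ' => lastCoord φ (x ϱ')) (chartVel g φ) ϱ = - (2 * chartNormSq g φ (x ϱ)) :=
  poisson_base_poisson_symb_base g (hφ.contMDiffAt h) (hφ.mdifferentiableAt h)

theorem IsBoundaryChart.chartNormSq_pos (hφ : IsBoundaryChart M φ) {y : N} (h : y ∈ φ.source) :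
    0 < chartNormSq g φ y :=
  coMetric_self_pos g (hφ.dcov_ne_zero h)

theorem IsBoundaryChart.continuousAt_chartNormSq (hφ : IsBoundaryChart M φ)
    (h : x ϱ ∈ φ.source) : ContinuousAt (fun ϱ' : PhaseSpace n N => chartNormSq g φ (x ϱ')) ϱ := by
  have h1 := (continuousAt_poisson (contMDiffAt_base (hφ.contMDiffAt h))
    (hφ.contMDiffAt_chartVel (g := g) h)).const_mul (-(1 / 2) : ℝ)
  refine h1.congr ?_
  filter_upwards [contMDiff_x.continuous.continuousAt.eventually (φ.open_source.mem_nhds h)]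
    with ϱ' h'
  rw [hφ.poisson_chartVel h']
  ring

theorem IsBoundaryChart.continuousAt_poisson_chartVel (hφ : IsBoundaryChart M φ)
    (h : x ϱ ∈ φ.source) : ContinuousAt (poisson (symb g) (chartVel g φ)) ϱ :=
  continuousAt_poisson (contMDiff_symb g).contMDiffAt (hφ.contMDiffAt_chartVel h)

theorem IsBoundaryChart.chartVel_eq_zero (hM : IsC2Domain n M) (hφ : IsBoundaryChart M φ)
    (h : x ϱ ∈ φ.source) (hϱ : ϱ ∈ glancing g M) : chartVel g φ ϱ = 0 := by
  obtain ⟨k, hk, h1⟩ := hφ.dcov_eq_smul_conormal g hM hϱ.1 h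
  refine (poisson_symb_base g (hφ.mdifferentiableAt h)).trans ?_
  rw [h1]
  have h2 : coMetric g (ξ ϱ) (conormal g M (x ϱ)) = 0 := (Hpz_eq_zero_iff g hM hϱ.1).1 hϱ.2.2
  have h3 : (show Model n →L[ℝ] ℝ from conormal g M (x ϱ)) (sharpL g (x ϱ) (cov ϱ)) = 0 := h2
  rw [smul_apply, h3, smul_zero, mul_zero]

theorem isClosed_bdryTL : IsClosed (bdryTL n M) :=
  isClosed_frontier.preimage contMDiff_x.continuous

/-- The derivative of `H_p z` along the generalized flow, for an arbitrary boundary chart. -/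
theorem IsBoundaryChart.glancing_of_dPhase_chartVel_eq_zero (hM : IsC2Domain n M)
    (h0 : ∀ φ, IsBoundaryChart M φ → x ϱ ∈ φ.source →
      dPhase (chartVel g φ) ϱ (genField g M ϱ) = 0) (hϱ : ϱ ∈ glancing g M)
    (hφ : IsBoundaryChart M φ) (h : x ϱ ∈ φ.source) :
    ϱ ∈ glancing3 g M ∪ gliding g M ∧
      curvTerm g M ϱ = poisson (symb g) (chartVel g φ) ϱ / Real.sqrt (chartNormSq g φ (x ϱ)) := by
  classical
  have hz := hM.isBoundaryChart_bdryChartAt hϱ.1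
  obtain ⟨k, hk, h1⟩ := hφ.dcov_eq_smul_conormal g hM hϱ.1 h
  have hp := dzNorm_pos g hM hϱ.1
  have hN : chartNormSq g φ (x ϱ) = k ^ 2 := by
    rw [chartNormSq, h1]
    refine ((coMetric_smul_left g k _ _).trans (congrArg _ (coMetric_smul_right g k _ _))).trans ?_
    rw [coMetric_conormal_conormal g hM hϱ.1]; ring
  rw [hN, Real.sqrt_sq hk.le, curvTerm]
  have h2 := h0 φ hφ h
  rw [dPhase_genField] at h2
  -- In the gliding case, the vanishing of the derivative of `H_p z` in the chart `φ` expresses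
  -- `H_p² z` for that chart through the one for the reference chart, with ratio `k / |dz|`. In the
  -- other case the field is `H_p`, so `H_p² z` vanishes in both charts; in particular `H_p² z > 0`
  -- is excluded.
  by_cases hg : ϱ ∈ gliding g M
  · refine ⟨Or.inr hg, ?_⟩
    rw [if_pos hg] at h2
    have h3 : poisson (zLift M ϱ) (chartVel g φ) ϱ = - (2 * (k * dzNorm g M (x ϱ))) := by
      refine (poisson_base_poisson_symb_base g (hφ.contMDiffAt h)
        ((contMDiffAt_zAt hM hϱ.1).mdifferentiableAt two_ne_zero)).trans ?_
      have h4 : coMetric g (dz n M (x ϱ)) (k • conormal g M (x ϱ)) = k * dzNorm g M (x ϱ) := by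
        rw [coMetric_smul_right, dz_eq_smul_conormal g hM hϱ.1, coMetric_smul_left,
          coMetric_conormal_conormal g hM hϱ.1, mul_one]
      rw [h1]
      exact congrArg (fun r : ℝ => - (2 * r)) h4
    rw [h3, Hz2p_eq g hM hϱ.1] at h2
    field_simp at h2 ⊢
    linarith
  · rw [if_neg hg, add_zero] at h2
    have h3 := h0 _ hz.1 hz.2
    rw [dPhase_genField, if_neg hg, add_zero] at h3
    have h4 : Hp2z g M ϱ = 0 := h3
    exact ⟨Or.inl ⟨hϱ, h4⟩, by rw [h2, h4, zero_div, zero_div]⟩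

namespace IsReflCurve

/-- Any subset of the line has at most countably many points that are isolated from the right. -/
theorem countable_excTimes (hv : IsReflCurve g M B v) : (excTimes M B v).Countable :=
  hv.countable.union countable_setOfPred_isolated_right_within

theorem mem_glancing (hv : IsReflCurve g M B v) {s : ℝ} (hs : s ∈ bdryTimes M B v) :
    v s ∈ glancing g M := by
  have h1 := hv.notMem_hyp s hs.1
  have h2 := hv.mem s hs.1
  refine ⟨hs.2, h2, ?_⟩
  by_contra h
  rcases lt_or_gt_of_ne h with h | h
  · exact h1 (Or.inr ⟨hs.2, h2, h⟩)
  · exact h1 (Or.inl ⟨hs.2, h2, h⟩)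

/-- The time `s` is a limit of later boundary times off `B`. At all of these, as at `s`, the curve
is glancing and `H_p z` is zero, so the difference quotients along them vanish. -/
theorem dPhase_chartVel_eq_zero (hM : IsC2Domain n M) (hv : IsReflCurve g M B v) {s : ℝ}
    (hs : s ∈ bdryTimes M B v) (hs' : s ∉ excTimes M B v) (hφ : IsBoundaryChart M φ)
    (h : x (v s) ∈ φ.source) : dPhase (chartVel g φ) (v s) (genField g M (v s)) = 0 := by
  have hne : (𝓝[bdryTimes M B v ∩ Ioi s] s).NeBot := ⟨fun h0 => hs' (Or.inr ⟨hs, h0⟩)⟩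
  have h1 := hasDerivAt_iff_tendsto_slope.1
    (hv.hasDerivAt s hs.1 _ (hφ.contMDiffAt_chartVel (g := g) h))
  have h2 := h1.mono_left (nhdsWithin_mono s fun r (hr : r ∈ bdryTimes M B v ∩ Ioi s) =>
    (mem_Ioi.1 hr.2).ne')
  refine tendsto_nhds_unique h2 (tendsto_const_nhds.congr' ?_)
  have h3 := (contMDiff_x.continuous.continuousAt.comp (hv.continuousAt s hs.1)).eventually
    (φ.open_source.mem_nhds h)
  filter_upwards [self_mem_nhdsWithin, nhdsWithin_le_nhds h3] with r hr hr'
  rw [slope_def_field, Function.comp_apply, Function.comp_apply,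
    hφ.chartVel_eq_zero hM hr' (hv.mem_glancing hr.1),
    hφ.chartVel_eq_zero hM h (hv.mem_glancing hs), sub_zero, zero_div]

theorem mem_and_curvTerm_eq (hM : IsC2Domain n M) (hv : IsReflCurve g M B v) {s : ℝ}
    (hs : s ∈ bdryTimes M B v) (hs' : s ∉ excTimes M B v) (hφ : IsBoundaryChart M φ)
    (h : x (v s) ∈ φ.source) : v s ∈ glancing3 g M ∪ gliding g M ∧ curvTerm g M (v s) =
      poisson (symb g) (chartVel g φ) (v s) / Real.sqrt (chartNormSq g φ (x (v s))) :=
  IsBoundaryChart.glancing_of_dPhase_chartVel_eq_zero hM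
    (fun _ hψ h' => hv.dPhase_chartVel_eq_zero hM hs hs' hψ h') (hv.mem_glancing hs) hφ h

theorem mem_glancing3_union_gliding (hM : IsC2Domain n M) (hv : IsReflCurve g M B v) {s : ℝ}
    (hs : s ∈ bdryTimes M B v) (hs' : s ∉ excTimes M B v) :
    v s ∈ glancing3 g M ∪ gliding g M :=
  (hv.mem_and_curvTerm_eq hM hs hs' (hM.isBoundaryChart_bdryChartAt hs.2).1
    (hM.isBoundaryChart_bdryChartAt hs.2).2).1

/-- The reference chart is chosen separately at each point, without any continuity. At these times
the curvature term is also given by one fixed chart near `s`, where continuity is clear. -/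
theorem continuousOn_curvTerm (hM : IsC2Domain n M) (hv : IsReflCurve g M B v) :
    ContinuousOn (fun s => curvTerm g M (v s)) (bdryTimes M B v \ excTimes M B v) := by
  intro s hs
  obtain ⟨hφ, h⟩ := hM.isBoundaryChart_bdryChartAt hs.1.2
  set φ := bdryChartAt (n := n) M (x (v s))
  have hc := hv.continuousAt s hs.1.1
  have h1 : ContinuousAt (fun s => poisson (symb g) (chartVel g φ) (v s) /
      Real.sqrt (chartNormSq g φ (x (v s)))) s := by
    refine ContinuousAt.div ?_ ?_ (Real.sqrt_pos.2 (hφ.chartNormSq_pos h)).ne'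
    · exact ContinuousAt.comp (hφ.continuousAt_poisson_chartVel h) hc
    · exact (ContinuousAt.comp (f := v) (hφ.continuousAt_chartNormSq h) hc).sqrt
  have h3 := (contMDiff_x.continuous.continuousAt.comp hc).eventually (φ.open_source.mem_nhds h)
  refine h1.continuousWithinAt.congr_of_eventuallyEq ?_
    (hv.mem_and_curvTerm_eq hM hs.1 hs.2 hφ h).2
  filter_upwards [self_mem_nhdsWithin, nhdsWithin_le_nhds h3] with r hr hr'
  exact (hv.mem_and_curvTerm_eq hM hr.1 hr.2 hφ hr').2

theorem eventually_of_eventually (hv : IsReflCurve g M B v) {s : ℝ} {P : PhaseSpace n N → Prop}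
    (h1 : ∀ᶠ ϱ in 𝓝 (v s), P ϱ) (h2 : ∀ᶠ ϱ in 𝓝 (reflect g M (v s)), P ϱ) :
    ∀ᶠ r in 𝓝 s, P (v r) := by
  by_cases hs : s ∈ B
  · rw [← nhdsLE_sup_nhdsGT, ← Iio_insert, nhdsWithin_insert, eventually_sup, eventually_sup]
    exact ⟨⟨h1.self_of_nhds, (hv.tendsto_left s hs).eventually h1⟩,
      (hv.tendsto_right s hs).eventually h2⟩
  · exact (hv.continuousAt s hs).eventually h1

end IsReflCurve

variable {g : Metric1 n N} {M : Set N} {B : Set ℝ} {v : ℝ → PhaseSpace n N}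
  {φ : OpenPartialHomeomorph N (Model n)} {ϱ : PhaseSpace n N}

/-! ### Local bounds on the jumps and on the curvature term -/

/-- On the set `W` of times, the sums of the jumps and the curvature term are bounded. -/
def HasJumpBound (g : Metric1 n N) (M : Set N) (B : Set ℝ) (v : ℝ → PhaseSpace n N)
    (W : Set ℝ) : Prop :=
  ∃ C : ℝ, 0 ≤ C ∧ (∀ F : Finset ℝ, ↑F ⊆ B ∩ W → ∑ S ∈ F, jump g M (projPar g M (v S)) ≤ C) ∧
    ∀ s ∈ W, s ∈ bdryTimes M B v → s ∉ excTimes M B v → |curvTerm g M (v s)| ≤ C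

namespace IsReflCurve

theorem jump_nonneg (hM : IsC2Domain n M) (hv : IsReflCurve g M B v) {S : ℝ} (hS : S ∈ B) :
    0 ≤ jump g M (projPar g M (v S)) := by
  have h : projPar g M (v S) ∈ bdryTL n M := (hv.mem_hypMinus S hS).1
  rw [jump_eq g hM h]
  positivity

/-- Apply `sum_jumps_le` to `H_p z` along the curve: reflections make it jump upwards by at least `2
√c` times the mass in `ν_H`, and off a countable set its derivative is zero at boundary times and
`H_p² z ≥ -C` at the others. -/
theorem hasJumpBound_of_chart (hM : IsC2Domain n M) (hv : IsReflCurve g M B v)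
    (hφ : IsBoundaryChart M φ) {a b C c : ℝ} (hab : a < b) (hC : 0 ≤ C) (hc : 0 < c)
    (h : ∀ s ∈ Icc a b, x (v s) ∈ φ.source ∧ |poisson (symb g) (chartVel g φ) (v s)| ≤ C ∧
      c < chartNormSq g φ (x (v s))) : HasJumpBound g M B v (Ico a b) := by
  classical
  set f : ℝ → ℝ := chartVel g φ ∘ v
  set j : ℝ → ℝ := fun S =>
    if S ∈ B then chartVel g φ (reflect g M (v S)) - chartVel g φ (v S) else 0
  have hcs : 0 < 2 * Real.sqrt c := by positivity
  have hj : ∀ S ∈ B, S ∈ Icc a b → 2 * Real.sqrt c * jump g M (projPar g M (v S)) ≤ j S := by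
    intro S hS hS'
    have h1 : j S = 2 * Real.sqrt (chartNormSq g φ (x (v S))) * jump g M (projPar g M (v S)) :=
      (if_pos hS).trans (hφ.poisson_reflect g hM (hv.mem_hypMinus S hS) (h S hS').1)
    rw [h1]
    have h2 := hv.jump_nonneg hM hS
    have h3 := (h S hS').2.2.le
    gcongr
  have hcont : ∀ s ∈ Icc a b, ContinuousAt (chartVel g φ) (v s) := fun s hs =>
    (hφ.contMDiffAt_chartVel (h s hs).1).continuousAt
  have hsum := fun F hF => sum_jumps_le (f := f) (j := j) (C := C) hab.le hv.countable_excTimes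
    (fun s hs => (hcont s (Ioc_subset_Icc_self hs)).tendsto.comp (hv.tendsto_left' s))
    (fun s hs => ?_) (fun s hs hsD => ?_) (fun s hs => ?_) F hF
  rotate_left
  · have hs' := Ico_subset_Icc_self hs
    by_cases hsB : s ∈ B
    · have h1 : f s + j s = chartVel g φ (reflect g M (v s)) := by
        simp only [f, j, if_pos hsB, Function.comp_apply]; ring
      have h2 : ContinuousAt (chartVel g φ) (reflect g M (v s)) :=
        (hφ.contMDiffAt_chartVel (ϱ := reflect g M (v s)) (h s hs').1).continuousAt
      rw [h1]
      exact h2.tendsto.comp (hv.tendsto_right s hsB)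
    · simp only [j, if_neg hsB, add_zero]
      exact (hcont s hs').tendsto.comp
        ((hv.continuousAt s hsB).tendsto.mono_left nhdsWithin_le_nhds)
  · have hs' := Ico_subset_Icc_self hs
    have hsB : s ∉ B := fun h0 => hsD (Or.inl h0)
    refine ⟨_, ?_, hv.hasDerivAt s hsB _ (hφ.contMDiffAt_chartVel (h s hs').1)⟩
    by_cases hb : s ∈ bdryTimes M B v
    · rw [hv.dPhase_chartVel_eq_zero hM hb hsD hφ (h s hs').1]
      linarith
    · rw [dPhase_genField, if_neg fun h0 => hb ⟨hsB, h0.1.1⟩, add_zero]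
      exact (abs_le.1 (h s hs').2.1).1
  · by_cases hsB : s ∈ B
    · exact (mul_nonneg hcs.le (hv.jump_nonneg hM hsB)).trans (hj s hsB (Ico_subset_Icc_self hs))
    · simp [j, if_neg hsB]
  refine ⟨max 0 ((f b - f a + C * (b - a)) / (2 * Real.sqrt c)) + C / Real.sqrt c, by positivity,
    fun F hF => ?_, fun s hs hb hsD => ?_⟩
  · have h1 := hsum F fun S hS => (hF hS).2
    have h2 : ∑ S ∈ F, jump g M (projPar g M (v S)) ≤
        (f b - f a + C * (b - a)) / (2 * Real.sqrt c) := by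
      rw [le_div_iff₀ hcs, Finset.sum_mul]
      refine (Finset.sum_le_sum fun S hS => ?_).trans h1
      rw [mul_comm]
      exact hj S (hF hS).1 (Ico_subset_Icc_self (hF hS).2)
    have h3 : 0 ≤ C / Real.sqrt c := by positivity
    linarith [le_max_right 0 ((f b - f a + C * (b - a)) / (2 * Real.sqrt c))]
  · have hs' := Ico_subset_Icc_self hs
    rw [(hv.mem_and_curvTerm_eq hM hb hsD hφ (h s hs').1).2, abs_div,
      abs_of_nonneg (Real.sqrt_nonneg _)]
    have h1 : |poisson (symb g) (chartVel g φ) (v s)| / Real.sqrt (chartNormSq g φ (x (v s))) ≤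
        C / Real.sqrt c :=
      div_le_div₀ hC (h s hs').2.1 (Real.sqrt_pos.2 hc) (Real.sqrt_le_sqrt (h s hs').2.2.le)
    linarith [le_max_left 0 ((f b - f a + C * (b - a)) / (2 * Real.sqrt c))]

theorem exists_hasJumpBound_nhds (hM : IsC2Domain n M) (hv : IsReflCurve g M B v) (s : ℝ) :
    ∃ W ∈ 𝓝 s, HasJumpBound g M B v W := by
  by_cases hs : v s ∈ bdryTL n M
  · obtain ⟨hφ, hx⟩ := hM.isBoundaryChart_bdryChartAt hs
    set φ := bdryChartAt (n := n) M (x (v s))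
    have hN := hφ.chartNormSq_pos (g := g) hx
    set C := max |poisson (symb g) (chartVel g φ) (v s)|
      |poisson (symb g) (chartVel g φ) (reflect g M (v s))| + 1
    -- If `s` is a reflection time, the curve is near `v s` before `s` and near the reflected point
    -- after it; both have the same base point, so one chart serves for both.
    have key : ∀ ϱ : PhaseSpace n N, x ϱ = x (v s) →
        |poisson (symb g) (chartVel g φ) ϱ| < C → ∀ᶠ ϱ' in 𝓝 ϱ, x ϱ' ∈ φ.source ∧
          |poisson (symb g) (chartVel g φ) ϱ'| ≤ C ∧
          chartNormSq g φ (x (v s)) / 2 < chartNormSq g φ (x ϱ') := by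
      intro ϱ hϱ hϱC
      rw [← hϱ] at hx hN ⊢
      refine (contMDiff_x.continuous.continuousAt.eventually (φ.open_source.mem_nhds hx)).and
        (((hφ.continuousAt_poisson_chartVel hx).abs.eventually (gt_mem_nhds hϱC)).mono
          (fun _ h => h.le) |>.and ?_)
      exact (hφ.continuousAt_chartNormSq hx).eventually (lt_mem_nhds (half_lt_self hN))
    have h1 := hv.eventually_of_eventually
      (key (v s) rfl ((le_max_left _ _).trans_lt (lt_add_one _)))
      (key (reflect g M (v s)) rfl ((le_max_right _ _).trans_lt (lt_add_one _)))
    obtain ⟨ε, hε, h2⟩ := Metric.eventually_nhds_iff_ball.1 h1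
    refine ⟨Ico (s - ε / 2) (s + ε / 2), Ico_mem_nhds (by linarith) (by linarith),
      hv.hasJumpBound_of_chart hM hφ (C := C) (c := chartNormSq g φ (x (v s)) / 2) (by linarith)
        (by positivity) (by positivity) fun r hr => h2 r ?_⟩
    rw [Metric.mem_ball, Real.dist_eq, abs_lt]
    constructor <;> linarith [hr.1, hr.2]
  · have hsB : s ∉ B := fun h => hs (hv.mem_hypMinus s h).1
    refine ⟨_, (hv.continuousAt s hsB).eventually (isClosed_bdryTL.isOpen_compl.mem_nhds hs), 0,
      le_rfl, fun F hF => ?_, fun r hr hb => absurd hb.2 hr⟩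
    rw [Finset.sum_eq_zero fun S hS => absurd (hv.mem_hypMinus S (hF hS).1).1 (hF hS).2]

theorem hasJumpBound_of_isCompact (hM : IsC2Domain n M) (hv : IsReflCurve g M B v) {K : Set ℝ}
    (hK : IsCompact K) : HasJumpBound g M B v K := by
  classical
  refine hK.induction_on ?_ ?_ ?_ fun s _ => ?_
  · refine ⟨0, le_rfl, fun F hF => ?_, fun s hs => hs.elim⟩
    rw [Finset.sum_eq_zero fun S hS => (hF hS).2.elim]
  · rintro W W' hW ⟨C, hC, h1, h2⟩
    exact ⟨C, hC, fun F hF => h1 F (hF.trans (inter_subset_inter_right _ hW)),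
      fun s hs => h2 s (hW hs)⟩
  · rintro W W' ⟨C, hC, h1, h2⟩ ⟨C', hC', h1', h2'⟩
    refine ⟨C + C', by positivity, fun F hF => ?_, ?_⟩
    · rw [← Finset.sum_filter_add_sum_filter_not F (· ∈ W)]
      refine add_le_add (h1 _ fun S hS => ?_) (h1' _ fun S hS => ?_)
      · have := Finset.mem_filter.1 hS
        exact ⟨(hF this.1).1, this.2⟩
      · have := Finset.mem_filter.1 hS
        exact ⟨(hF this.1).1, (hF this.1).2.resolve_left this.2⟩
    · rintro s (hs | hs) hb hD
      · linarith [h2 s hs hb hD]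
      · linarith [h2' s hs hb hD]
  · obtain ⟨W, hW, h⟩ := hv.exists_hasJumpBound_nhds hM s
    exact ⟨W, nhdsWithin_le_nhds hW, h⟩

end IsReflCurve

variable {g : Metric1 n N} {M : Set N} {B : Set ℝ} {v : ℝ → PhaseSpace n N}
  {φ : OpenPartialHomeomorph N (Model n)} {ϱ : PhaseSpace n N} {a : PhaseSpace n N → ℝ}

/-! ### Test functions -/

/-- The derivative of `a` in the fibre in the direction of the conormal. -/
def conormalDeriv (g : Metric1 n N) (M : Set N) (a : PhaseSpace n N → ℝ) (ϱ : PhaseSpace n N) :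
    ℝ :=
  dPhase a ϱ (0, (0, conormal g M (x ϱ)))

theorem dPhase_eq_zero_of_notMem_tsupport (h : ϱ ∉ tsupport a) : dPhase a ϱ = 0 := by
  have h1 : a =ᶠ[𝓝 ϱ] fun _ => 0 := notMem_tsupport_iff_eventuallyEq.1 h
  exact h1.mfderiv_eq.trans mfderiv_const

theorem conormalDeriv_eq_zero_of_notMem_tsupport (h : ϱ ∉ tsupport a) :
    conormalDeriv g M a ϱ = 0 := by
  rw [conormalDeriv, dPhase_eq_zero_of_notMem_tsupport h]; rfl

theorem poisson_eq_zero_of_notMem_tsupport (f : PhaseSpace n N → ℝ) (h : ϱ ∉ tsupport a) :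
    poisson f a ϱ = 0 := by
  rw [poisson, dPhase_eq_zero_of_notMem_tsupport h]; rfl

theorem continuous_poisson_symb (g : Metric1 n N) (ha : ContMDiff (phaseI n) 𝓘(ℝ, ℝ) 1 a) :
    Continuous (poisson (symb g) a) :=
  continuous_iff_continuousAt.2 fun ϱ => continuousAt_poisson (contMDiff_symb g ϱ) (ha ϱ)

theorem hasCompactSupport_poisson (f : PhaseSpace n N → ℝ) (ha : HasCompactSupport a) :
    HasCompactSupport (poisson f a) :=
  ha.mono' fun ϱ h => by
    by_contra h0
    exact h (poisson_eq_zero_of_notMem_tsupport f h0)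

theorem hasDerivAt_conormal (ha : ContMDiff (phaseI n) 𝓘(ℝ, ℝ) 1 a) (ϱ : PhaseSpace n N) (r : ℝ) :
    HasDerivAt (fun r : ℝ => a (withCov ϱ (ξ ϱ + r • conormal g M (x ϱ))))
      (conormalDeriv g M a (withCov ϱ (ξ ϱ + r • conormal g M (x ϱ)))) r := by
  have h1 := hasDerivAt_vertical (ϱ := withCov ϱ (ξ ϱ + r • conormal g M (x ϱ)))
    (ha.mdifferentiable one_ne_zero _) 0 (conormal g M (x ϱ))
  rw [← sub_self r] at h1
  have h3 := h1.comp_sub_const r r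
  refine h3.congr_of_eventuallyEq (Eventually.of_forall fun r' => ?_)
  have h4 : (cov ϱ + r • (show Model n →L[ℝ] ℝ from conormal g M (x ϱ))) +
      (r' - r) • (show Model n →L[ℝ] ℝ from conormal g M (x ϱ)) =
      cov ϱ + r' • (show Model n →L[ℝ] ℝ from conormal g M (x ϱ)) := by module
  have h5 : ϱ.1 + (r' - r) • (0 : ℝ × ℝ) = ϱ.1 := by rw [smul_zero, add_zero]
  exact (congrArg₂ (fun (e : ℝ × ℝ) (η : Model n →L[ℝ] ℝ) =>
    a ((e, ⟨x ϱ, η⟩) : PhaseSpace n N)) h5 h4).symm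

/-- The conormal is built from a pointwise choice of charts, so compactness cannot be applied
directly. In one boundary chart the absolute value of the derivative equals `|{a, z}| / |dz|` on the
boundary, and this is continuous. -/
theorem exists_abs_conormalDeriv_le (hM : IsC2Domain n M)
    (ha : ContMDiff (phaseI n) 𝓘(ℝ, ℝ) 1 a) (hc : HasCompactSupport a) :
    ∃ C : ℝ, 0 ≤ C ∧ ∀ ϱ ∈ bdryTL n M, |conormalDeriv g M a ϱ| ≤ C := by
  have h : ∃ C : ℝ, 0 ≤ C ∧ ∀ ϱ ∈ tsupport a, ϱ ∈ bdryTL n M → |conormalDeriv g M a ϱ| ≤ C := by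
    refine IsCompact.induction_on (p := fun K => ∃ C : ℝ, 0 ≤ C ∧ ∀ ϱ ∈ K, ϱ ∈ bdryTL n M →
      |conormalDeriv g M a ϱ| ≤ C) hc ⟨0, le_rfl, fun ϱ h => h.elim⟩ ?_ ?_ ?_
    · rintro K K' hK ⟨C, hC, h1⟩
      exact ⟨C, hC, fun ϱ hϱ => h1 ϱ (hK hϱ)⟩
    · rintro K K' ⟨C, hC, h1⟩ ⟨C', hC', h1'⟩
      refine ⟨C + C', by positivity, ?_⟩
      rintro ϱ (hϱ | hϱ) hb
      · linarith [h1 ϱ hϱ hb]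
      · linarith [h1' ϱ hϱ hb]
    · intro ϱ₀ _
      by_cases hb : ϱ₀ ∈ bdryTL n M
      swap
      · exact ⟨_, nhdsWithin_le_nhds (isClosed_bdryTL.isOpen_compl.mem_nhds hb), 0, le_rfl,
          fun ϱ hϱ h => absurd h hϱ⟩
      obtain ⟨hφ, hx⟩ := hM.isBoundaryChart_bdryChartAt hb
      set φ := bdryChartAt (n := n) M (x ϱ₀)
      have h1 : ContinuousAt (fun ϱ => |poisson a (fun ϱ' => lastCoord φ (x ϱ')) ϱ| /
          Real.sqrt (chartNormSq g φ (x ϱ))) ϱ₀ :=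
        (continuousAt_poisson (ha ϱ₀) (contMDiffAt_base (hφ.contMDiffAt hx))).abs.div
          (hφ.continuousAt_chartNormSq hx).sqrt (Real.sqrt_pos.2 (hφ.chartNormSq_pos hx)).ne'
      refine ⟨_, nhdsWithin_le_nhds ((h1.eventually (gt_mem_nhds (lt_add_one _))).and
        (contMDiff_x.continuous.continuousAt.eventually (φ.open_source.mem_nhds hx))),
        |poisson a (fun ϱ' => lastCoord φ (x ϱ')) ϱ₀| /
          Real.sqrt (chartNormSq g φ (x ϱ₀)) + 1, by positivity, fun ϱ hϱ hϱb => ?_⟩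
      refine le_trans (le_of_eq ?_) hϱ.1.le
      obtain ⟨k, hk, h2⟩ := hφ.dcov_eq_smul_conormal g hM hϱb hϱ.2
      have h3 : poisson a (fun ϱ' => lastCoord φ (x ϱ')) ϱ = k * conormalDeriv g M a ϱ := by
        rw [poisson_base_right (hφ.mdifferentiableAt hϱ.2), h2]
        have h4 : ((0, (0, k • (show Model n →L[ℝ] ℝ from conormal g M (x ϱ)))) : PhaseModel n) =
            k • ((0, (0, (show Model n →L[ℝ] ℝ from conormal g M (x ϱ)))) : PhaseModel n) := by
          ext <;> simp
        rw [h4, map_smul, smul_eq_mul]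
        rfl
      have hN : chartNormSq g φ (x ϱ) = k ^ 2 := by
        rw [chartNormSq, h2]
        refine ((coMetric_smul_left g k _ _).trans
          (congrArg _ (coMetric_smul_right g k _ _))).trans ?_
        rw [coMetric_conormal_conormal g hM hϱb]; ring
      rw [h3, hN, Real.sqrt_sq hk.le, abs_mul, abs_of_pos hk]
      field_simp
  obtain ⟨C, hC, h⟩ := h
  refine ⟨C, hC, fun ϱ hϱ => ?_⟩
  by_cases h0 : ϱ ∈ tsupport a
  · exact h ϱ h0 hϱ
  · rw [conormalDeriv_eq_zero_of_notMem_tsupport h0, abs_zero]; exact hC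

/-- Mean value inequality on the segment from `ξ^-` to `ξ^+`, whose length is the jump. Through it
the summability of the masses in `ν_H` controls the jumps of every test function. -/
theorem abs_sub_le_jump (hM : IsC2Domain n M) (ha : ContMDiff (phaseI n) 𝓘(ℝ, ℝ) 1 a) {C : ℝ}
    (hC : ∀ ϱ ∈ bdryTL n M, |conormalDeriv g M a ϱ| ≤ C) (hϱ : ϱ ∈ bdryTL n M) :
    |a (withCov ϱ (ξPlus g M ϱ)) - a (withCov ϱ (ξMinus g M ϱ))| ≤ C * jump g M ϱ := by
  have h := Convex.norm_image_sub_le_of_norm_hasDerivWithin_le (C := C) (s := univ)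
    (fun r _ => (hasDerivAt_conormal (g := g) (M := M) ha ϱ r).hasDerivWithinAt)
    (fun r _ => hC _ (show withCov ϱ (ξ ϱ + r • conormal g M (x ϱ)) ∈ bdryTL n M from hϱ))
    convex_univ (mem_univ (-Real.sqrt (-symb g ϱ))) (mem_univ (Real.sqrt (-symb g ϱ)))
  have h1 : ξ ϱ + (-Real.sqrt (-symb g ϱ)) • conormal g M (x ϱ) = ξMinus g M ϱ :=
    (congrArg (ξ ϱ + ·) (neg_smul _ _)).trans (sub_eq_add_neg _ _).symm
  simp only [h1, sub_neg_eq_add, Real.norm_eq_abs, ← two_mul] at h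
  rwa [jump_eq g hM hϱ, ← abs_of_nonneg (show 0 ≤ 2 * Real.sqrt (-symb g ϱ) by positivity)]

theorem bdryQuotient_of_glancing (ha : ContMDiff (phaseI n) 𝓘(ℝ, ℝ) 1 a) (hϱ : symb g ϱ = 0) :
    bdryQuotient g M a ϱ = conormalDeriv g M a ϱ := by
  rw [bdryQuotient, if_neg (by rw [hϱ]; exact lt_irrefl 0)]
  refine (hasDerivAt_conormal ha ϱ 0).deriv.trans ?_
  have h1 : ξ ϱ + (0 : ℝ) • conormal g M (x ϱ) = ξ ϱ := by rw [zero_smul, add_zero]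
  rw [h1]
  rfl

variable {g : Metric1 n N} {M : Set N} {B : Set ℝ} {v : ℝ → PhaseSpace n N}
  {ϱ : PhaseSpace n N} {a : PhaseSpace n N → ℝ}

/-! ### Integration along the curve -/

theorem integrable_of_ae_bounded_Icc {f : ℝ → ℝ} {R C : ℝ} (hf : AEStronglyMeasurable f volume)
    (hC : ∀ᵐ s, |f s| ≤ C) (hR : ∀ s ∉ Icc (-R) R, f s = 0) : Integrable f := by
  have h1 : IntegrableOn f (Icc (-R) R) :=
    Measure.integrableOn_of_bounded (M := C) measure_Icc_lt_top.ne hf (ae_restrict_of_ae hC)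
  refine (integrableOn_iff_integrable_of_support_subset fun s hs => ?_).1 h1
  by_contra h
  exact hs (hR s h)

theorem jumpFun_eq_tsum {j : ℝ → ℝ} {R s : ℝ} (hj : ∀ S ∉ Icc (-R) R, j S = 0) (hs : R < s) :
    jumpFun j s = ∑' S, j S := by
  refine tsum_congr fun S => ?_
  by_cases h : S < s
  · exact indicator_of_mem (mem_Iio.2 h) _
  · rw [indicator_of_notMem (fun h0 => h (mem_Iio.1 h0)), hj S fun h0 => h (h0.2.trans_lt hs)]

theorem jumpFun_eq_zero {j : ℝ → ℝ} {R s : ℝ} (hj : ∀ S ∉ Icc (-R) R, j S = 0) (hs : s ≤ -R) :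
    jumpFun j s = 0 := by
  refine (tsum_congr fun S => ?_).trans tsum_zero
  by_cases h : S < s
  · rw [indicator_of_mem (mem_Iio.2 h), hj S fun h0 => (h0.1.trans_lt h).not_ge hs]
  · exact indicator_of_notMem (fun h0 => h (mem_Iio.1 h0)) _

/-- The jump of `a` along the curve at a reflection. -/
def jumpOf (g : Metric1 n N) (M : Set N) (a : PhaseSpace n N → ℝ) (ϱ : PhaseSpace n N) : ℝ :=
  a (reflect g M ϱ) - a ϱ

open Classical in
-- The factor `1 / 2` of the theorem arises here, from `H_z² p = 2 |dz|²`. At points of order three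
-- both the correction of the field and the curvature term vanish, so one formula covers the whole
-- boundary.
theorem dPhase_genField_eq (hM : IsC2Domain n M) (a : PhaseSpace n N → ℝ)
    (hϱ : ϱ ∈ bdryTL n M → ϱ ∈ glancing3 g M ∪ gliding g M) :
    dPhase a ϱ (genField g M ϱ) = poisson (symb g) a ϱ -
      1 / 2 * (bdryTL n M).indicator (fun ϱ => curvTerm g M ϱ * conormalDeriv g M a ϱ) ϱ := by
  rw [dPhase_genField, sub_eq_add_neg]
  congr 1
  by_cases h : ϱ ∈ bdryTL n M
  · rw [indicator_of_mem h]
    by_cases hg : ϱ ∈ gliding g M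
    · rw [if_pos hg, Hz2p_eq g hM h, curvTerm]
      have h1 : poisson (zLift M ϱ) a ϱ = - dPhase a ϱ (0, (0, dz n M (x ϱ))) :=
        poisson_base_left ((contMDiffAt_zAt hM h).mdifferentiableAt two_ne_zero) a
      have h2 : ((0, (0, dz n M (x ϱ))) : PhaseModel n) =
          dzNorm g M (x ϱ) • ((0, (0, conormal g M (x ϱ))) : PhaseModel n) := by
        rw [dz_eq_smul_conormal g hM h]
        refine Prod.ext (smul_zero _).symm (Prod.ext (smul_zero _).symm rfl)
      rw [h1, h2, map_smul, smul_eq_mul]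
      have := dzNorm_pos g hM h
      rw [conormalDeriv]
      field_simp
    · have h1 : Hp2z g M ϱ = 0 := ((hϱ h).resolve_right hg).2
      rw [if_neg hg, curvTerm, h1]
      simp
  · rw [indicator_of_notMem h, if_neg fun h0 => h h0.1.1]
    simp

namespace IsReflCurve

theorem exists_bounds (hM : IsC2Domain n M) (hv : IsReflCurve g M B v) (hτ : τ (v 0) ≠ 0)
    (ha : ContMDiff (phaseI n) 𝓘(ℝ, ℝ) 1 a) (hc : HasCompactSupport a) :
    ∃ R > 0, ∃ C : ℝ, (∀ s ∉ Icc (-R) R, v s ∉ tsupport a ∧ reflect g M (v s) ∉ tsupport a) ∧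
      (∀ s, |poisson (symb g) a (v s)| ≤ C) ∧
      (∀ s ∉ excTimes M B v, |(bdryTL n M).indicator
        (fun ϱ => curvTerm g M ϱ * conormalDeriv g M a ϱ) (v s)| ≤ C) ∧
      ∀ F : Finset ℝ, ↑F ⊆ B → ∑ S ∈ F, |jumpOf g M a (v S)| ≤ C := by
  classical
  obtain ⟨R, hR, hRt⟩ := hv.exists_forall_mem_Icc hM hτ hc
  have hout : ∀ s ∉ Icc (-R) R, v s ∉ tsupport a ∧ reflect g M (v s) ∉ tsupport a :=
    fun s hs => ⟨fun h => hs (hRt _ h s rfl), fun h => hs (hRt _ h s rfl)⟩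
  obtain ⟨C₁, hC₁⟩ := (continuous_poisson_symb g ha).bounded_above_of_compact_support
    (hasCompactSupport_poisson (symb g) hc)
  obtain ⟨C₂, hC₂, h2⟩ := exists_abs_conormalDeriv_le (g := g) hM ha hc
  obtain ⟨C₃, hC₃, h3, h4⟩ := hv.hasJumpBound_of_isCompact hM (K := Icc (-R) R) isCompact_Icc
  have hC₁0 : 0 ≤ C₁ := (norm_nonneg _).trans (hC₁ (v 0))
  refine ⟨R, hR, C₁ + C₂ * C₃, hout, fun s => ?_, fun s hs => ?_, fun F hF => ?_⟩
  · have := hC₁ (v s)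
    rw [Real.norm_eq_abs] at this
    linarith [mul_nonneg hC₂ hC₃]
  · by_cases hb : v s ∈ bdryTL n M
    swap
    · rw [indicator_of_notMem hb, abs_zero]; positivity
    rw [indicator_of_mem hb]
    by_cases hsR : s ∈ Icc (-R) R
    · have h5 := h4 s hsR ⟨fun h => hs (Or.inl h), hb⟩ hs
      rw [abs_mul, mul_comm C₂]
      have := mul_le_mul h5 (h2 _ hb) (abs_nonneg _) hC₃
      linarith
    · rw [conormalDeriv_eq_zero_of_notMem_tsupport (hout s hsR).1, mul_zero, abs_zero]
      positivity
  · have h5 : ∑ S ∈ F, |jumpOf g M a (v S)| ≤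
        ∑ S ∈ F.filter (· ∈ Icc (-R) R), |jumpOf g M a (v S)| := by
      rw [← Finset.sum_filter_add_sum_filter_not F (· ∈ Icc (-R) R)]
      refine add_le_of_nonpos_right (le_of_eq (Finset.sum_eq_zero fun S hS => ?_))
      have h6 := hout S (Finset.mem_filter.1 hS).2
      rw [jumpOf, image_eq_zero_of_notMem_tsupport h6.1, image_eq_zero_of_notMem_tsupport h6.2,
        sub_zero, abs_zero]
    have h6 : ∀ S ∈ F.filter (· ∈ Icc (-R) R), |jumpOf g M a (v S)| ≤
        C₂ * jump g M (projPar g M (v S)) := fun S hS => by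
      have hS' := hv.mem_hypMinus S (hF (Finset.mem_filter.1 hS).1)
      have h7 := abs_sub_le_jump hM ha h2 (ϱ := projPar g M (v S)) hS'.1
      rwa [withCov_ξMinus_projPar g hM hS', withCov_ξPlus_projPar g hM hS'] at h7
    have h7 := h3 (F.filter (· ∈ Icc (-R) R)) fun S hS =>
      ⟨hF (Finset.mem_filter.1 hS).1, (Finset.mem_filter.1 hS).2⟩
    refine h5.trans ((Finset.sum_le_sum h6).trans ?_)
    rw [← Finset.mul_sum]
    have := mul_le_mul_of_nonneg_left h7 hC₂
    linarith

variable [MeasurableSpace (PhaseSpace n N)] [BorelSpace (PhaseSpace n N)]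

theorem integral_poisson_symb (hM : IsC2Domain n M) (hv : IsReflCurve g M B v)
    (hτ : τ (v 0) ≠ 0) (ha : ContMDiff (phaseI n) 𝓘(ℝ, ℝ) 1 a) (hc : HasCompactSupport a) :
    Integrable (fun s => poisson (symb g) a (v s)) ∧
    Integrable (fun s => (bdryTL n M).indicator
        (fun ϱ => curvTerm g M ϱ * conormalDeriv g M a ϱ) (v s)) ∧
    Summable (fun S : B => jumpOf g M a (v S)) ∧
    ∫ s, poisson (symb g) a (v s) = 1 / 2 * (∫ s, (bdryTL n M).indicator
        (fun ϱ => curvTerm g M ϱ * conormalDeriv g M a ϱ) (v s)) -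
      ∑' S : B, jumpOf g M a (v S) := by
  classical
  obtain ⟨R, hR, C, hout, h1, h2, h3⟩ := hv.exists_bounds hM hτ ha hc
  set V : ℝ → ℝ := fun s => (bdryTL n M).indicator
        (fun ϱ => curvTerm g M ϱ * conormalDeriv g M a ϱ) (v s) with hV
  set P : ℝ → ℝ := fun s => poisson (symb g) a (v s) with hP
  have hD := hv.countable_excTimes
  have hDae : ∀ᵐ s : ℝ, s ∉ excTimes M B v := hD.ae_notMem volume
  set j : ℝ → ℝ := B.indicator fun S => jumpOf g M a (v S) with hj
  have hjs : Summable j := by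
    refine Summable.of_abs (summable_of_sum_le (c := C) (fun S => abs_nonneg _) fun F => ?_)
    refine le_trans (le_of_eq ?_) (h3 (F.filter (· ∈ B)) fun S hS => (Finset.mem_filter.1 hS).2)
    rw [Finset.sum_filter]
    refine Finset.sum_congr rfl fun S _ => ?_
    by_cases hS : S ∈ B
    · rw [hj, indicator_of_mem hS, if_pos hS]
    · rw [hj, indicator_of_notMem hS, if_neg hS, abs_zero]
  have hjR : ∀ S ∉ Icc (-R) R, j S = 0 := fun S hS => by
    by_cases hSB : S ∈ B
    · rw [hj, indicator_of_mem hSB, jumpOf, image_eq_zero_of_notMem_tsupport (hout S hS).1,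
        image_eq_zero_of_notMem_tsupport (hout S hS).2, sub_zero]
    · exact indicator_of_notMem hSB _
  have hVR : ∀ s ∉ Icc (-R) R, V s = 0 := fun s hs => by
    refine indicator_apply_eq_zero.2 fun _ => ?_
    rw [conormalDeriv_eq_zero_of_notMem_tsupport (hout s hs).1, mul_zero]
  have hPR : ∀ s ∉ Icc (-R) R, P s = 0 := fun s hs =>
    poisson_eq_zero_of_notMem_tsupport _ (hout s hs).1
  have hac : Continuous a := ha.continuous
  have hder : ∀ s ∉ excTimes M B v, HasDerivAt (a ∘ v) (P s - 1 / 2 * V s) s := fun s hs => by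
    have hsB : s ∉ B := fun h => hs (Or.inl h)
    have h4 := hv.hasDerivAt s hsB a (ha (v s))
    rwa [dPhase_genField_eq hM a fun hb =>
      hv.mem_glancing3_union_gliding hM ⟨hsB, hb⟩ hs] at h4
  have hPm : Measurable P := (continuous_poisson_symb g ha).measurable.comp hv.measurable
  have hPi : Integrable P :=
    integrable_of_ae_bounded_Icc hPm.aestronglyMeasurable (Eventually.of_forall h1) hPR
  -- The conormal derivative is not known to be measurable by itself; almost everywhere `V` is
  -- recovered from the derivative of `a` along the curve, and a derivative is always measurable.
  have hVm : AEStronglyMeasurable V volume := by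
    have h5 : V =ᵐ[volume] fun s => 2 * (P s - deriv (a ∘ v) s) := by
      filter_upwards [hDae] with s hs
      rw [(hder s hs).deriv]; ring
    exact ((hPm.sub (measurable_deriv _)).const_mul 2).aestronglyMeasurable.congr h5.symm
  have hVi : Integrable V := integrable_of_ae_bounded_Icc hVm (hDae.mono h2) hVR
  -- The margin `1` puts the endpoints strictly outside `[-R, R]`: there `a` vanishes along the
  -- curve, and `jumpFun j` is `0` on the left and the full sum on the right.
  have hFTC := integral_deriv_eq_sub_sub_jumps (u := a ∘ v) (U := fun s => P s - 1 / 2 * V s)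
    (j := j) (a := -(R + 1)) (b := R + 1) (C := C + 1 / 2 * C) hD hjs
    (fun s => (hac.tendsto _).comp (hv.tendsto_left' s)) (fun s => ?_) fun s hs => ⟨?_, hder s hs⟩
  rotate_left
  · by_cases hs : s ∈ B
    · have h6 : (a ∘ v) s + j s = a (reflect g M (v s)) := by
        rw [hj, indicator_of_mem hs, jumpOf, Function.comp_apply]; ring
      rw [h6]
      exact (hac.tendsto _).comp (hv.tendsto_right s hs)
    · rw [hj, indicator_of_notMem hs, add_zero]
      exact (hac.tendsto _).comp ((hv.continuousAt s hs).tendsto.mono_left nhdsWithin_le_nhds)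
  · refine (abs_sub _ _).trans (add_le_add (h1 s) ?_)
    rw [abs_mul, abs_of_pos (by norm_num : (0 : ℝ) < 1 / 2)]
    exact mul_le_mul_of_nonneg_left (h2 s hs) (by norm_num)
  have ha0 : ∀ s ∉ Icc (-R) R, (a ∘ v) s = 0 := fun s hs =>
    image_eq_zero_of_notMem_tsupport (f := a) (hout s hs).1
  rw [ha0 (R + 1) fun h => by linarith [h.2], ha0 (-(R + 1)) fun h => by linarith [h.1],
    jumpFun_eq_tsum hjR (lt_add_one R), jumpFun_eq_zero hjR (by linarith),
    intervalIntegral.integral_of_le (by linarith),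
    setIntegral_eq_integral_of_forall_compl_eq_zero fun s hs => ?_,
    integral_sub hPi (hVi.const_mul _), integral_const_mul] at hFTC
  · refine ⟨hPi, hVi, summable_subtype_iff_indicator.2 hjs, ?_⟩
    rw [tsum_subtype B fun S => jumpOf g M a (v S)]
    linarith
  · have hs' : s ∉ Icc (-R) R := fun h => hs ⟨by linarith [h.1], by linarith [h.2]⟩
    rw [hPR s hs', hVR s hs']; simp

end IsReflCurve

variable {g : Metric1 n N} {M : Set N} {B : Set ℝ} {v γ : ℝ → PhaseSpace n N}
  {ϱ : PhaseSpace n N} {a : PhaseSpace n N → ℝ}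

/-! ### The measures -/

theorem glancing3_union_gliding_subset :
    glancing3 g M ∪ gliding g M ⊆ glancing g M :=
  union_subset inter_subset_left inter_subset_left

theorem curvTerm_nonpos (hM : IsC2Domain n M) (hϱ : ϱ ∈ glancing3 g M ∪ gliding g M) :
    curvTerm g M ϱ ≤ 0 := by
  have h := dzNorm_pos g hM (glancing3_union_gliding_subset hϱ).1
  refine div_nonpos_of_nonpos_of_nonneg ?_ h.le
  rcases hϱ with h | h
  · exact le_of_eq h.2
  · exact le_of_lt h.2

namespace IsReflCurve

/-- Projection preserves `t`, which determines the time. Hence the sum over reflection points in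
`ν_H` can be reindexed by `B` without multiplicities. -/
theorem injective_projPar (hM : IsC2Domain n M) (hv : IsReflCurve g M B v) (hτ : τ (v 0) ≠ 0) :
    Function.Injective fun S : B => projPar g M (v S) := fun S S' h => by
  have h1 := congrArg t h
  change t (v S) = t (v S') at h1
  rw [hv.t_eq hM S, hv.t_eq hM S'] at h1
  have h2 : τ (v 0) * ((S : ℝ) - S') = 0 := by linarith
  exact Subtype.ext (sub_eq_zero.1 ((mul_eq_zero.1 h2).resolve_left hτ))

theorem bdryQuotient_projPar (hM : IsC2Domain n M) (hv : IsReflCurve g M B v)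
    (a : PhaseSpace n N → ℝ) {S : ℝ} (hS : S ∈ B) :
    jump g M (projPar g M (v S)) * bdryQuotient g M a (projPar g M (v S)) =
      jumpOf g M a (v S) := by
  have hS' := hv.mem_hypMinus S hS
  have h1 := projPar_mem_parHyp g hM hS'
  have h2 : jump g M (projPar g M (v S)) ≠ 0 := by
    rw [jump_eq g hM h1.1.1]
    have : 0 < Real.sqrt (-symb g (projPar g M (v S))) := Real.sqrt_pos.2 (neg_pos.2 h1.2)
    positivity
  have h3 : symb g (projPar g M (v S)) < 0 := h1.2
  rw [bdryQuotient, if_pos h3, withCov_ξMinus_projPar g hM hS', withCov_ξPlus_projPar g hM hS',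
    jumpOf, mul_div_cancel₀ _ h2]

theorem reflPoints_eq [T2Space N] (hv : IsLeftExt B γ v) :
    reflPoints g M B γ = range fun S : B => projPar g M (v S) := by
  have : T2Space (CotBundle n N) := t2Space_cotBundle
  ext ϱ
  constructor
  · rintro ⟨S, hS, ϱ₁, h1, rfl⟩
    have := neBot_left_of_countable hv.countable S
    exact ⟨⟨S, hS⟩, congrArg _ (tendsto_nhds_unique (hv.tendsto S hS) h1)⟩
  · rintro ⟨S, rfl⟩
    exact ⟨S, S.2, v S, hv.tendsto S S.2, rfl⟩

section Measurable

variable [MeasurableSpace (PhaseSpace n N)] [BorelSpace (PhaseSpace n N)]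

theorem nuH_eq [T2Space N] (hM : IsC2Domain n M) (hv : IsLeftExt B γ v)
    (hv' : IsReflCurve g M B v) (hτ : τ (v 0) ≠ 0) :
    nuH g M B γ = Measure.sum fun S : B =>
      ENNReal.ofReal (jump g M (projPar g M (v S))) • Measure.dirac (projPar g M (v S)) := by
  have hinj := hv'.injective_projPar hM hτ
  rw [nuH, reflPoints_eq hv]
  ext s hs
  rw [Measure.sum_apply _ hs, Measure.sum_apply _ hs,
    ← (Equiv.ofInjective _ hinj).tsum_eq]
  rfl

/-- Lusin–Souslin: an injective Borel map from the line. Integrals against the image measure can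
then be pulled back without checking measurability on phase space, where the densities involve
arbitrary choices of charts. -/
theorem measurableEmbedding [T2Space N] [SecondCountableTopology N] (hM : IsC2Domain n M)
    (hv : IsReflCurve g M B v) (hτ : τ (v 0) ≠ 0) : MeasurableEmbedding v := by
  have : T2Space (CotBundle n N) := t2Space_cotBundle
  have : SecondCountableTopology (CotBundle n N) := secondCountableTopology_cotBundle
  exact hv.measurable.measurableEmbedding (hv.injective hM hτ)

theorem regular_of_finite_on_compacts [T2Space N] [SecondCountableTopology N]
    (μ : Measure (PhaseSpace n N)) (hμ : ∀ K, IsCompact K → μ K < ⊤) : μ.Regular := by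
  have : T2Space (CotBundle n N) := t2Space_cotBundle
  have : SecondCountableTopology (CotBundle n N) := secondCountableTopology_cotBundle
  have : LocallyCompactSpace (PhaseSpace n N) := locallyCompactSpace_phaseSpace
  have : IsFiniteMeasureOnCompacts μ := ⟨fun K hK => hμ K hK⟩
  have : IsLocallyFiniteMeasure μ := isLocallyFiniteMeasure_of_isFiniteMeasureOnCompacts
  infer_instance

theorem map_apply_lt_top [T2Space N] (hM : IsC2Domain n M) (hv : IsReflCurve g M B v)
    (hτ : τ (v 0) ≠ 0) {K : Set (PhaseSpace n N)} (hK : IsCompact K) :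
    Measure.map v volume K < ⊤ := by
  have : T2Space (CotBundle n N) := t2Space_cotBundle
  obtain ⟨R, _, hR⟩ := hv.exists_forall_mem_Icc hM hτ hK
  rw [Measure.map_apply hv.measurable hK.measurableSet]
  exact (measure_mono fun s hs => hR (v s) hs s rfl).trans_lt measure_Icc_lt_top

/-- Replaces the set in the definition of `ν_G`, whose measurability is unclear, by the closed set
of boundary points: the exceptional times form a null set. -/
theorem ae_mem_glancing3_union_gliding [T2Space N] [SecondCountableTopology N]
    (hM : IsC2Domain n M) (hv : IsReflCurve g M B v) (hτ : τ (v 0) ≠ 0) :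
    (glancing3 g M ∪ gliding g M : Set (PhaseSpace n N)) =ᵐ[Measure.map v volume]
      (bdryTL n M : Set (PhaseSpace n N)) := by
  have h : ∀ᵐ ϱ ∂Measure.map v volume, ϱ ∈ bdryTL n M → ϱ ∈ glancing3 g M ∪ gliding g M := by
    rw [(hv.measurableEmbedding hM hτ).ae_map_iff]
    filter_upwards [hv.countable_excTimes.ae_notMem volume] with s hs hb
    exact hv.mem_glancing3_union_gliding hM ⟨fun h => hs (Or.inl h), hb⟩ hs
  refine eventuallyLE_antisymm_iff.2 ⟨Eventually.of_forall fun ϱ hϱ => ?_, h⟩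
  exact (glancing3_union_gliding_subset hϱ).1

theorem measurableSet_bdryTL : MeasurableSet (bdryTL n M : Set (PhaseSpace n N)) :=
  isClosed_bdryTL.measurableSet

/-- Pulled back to the line, the curvature term is continuous on a Borel set of times that has full
measure among the boundary times. -/
theorem aemeasurable_curvTerm [T2Space N] [SecondCountableTopology N]
    (hM : IsC2Domain n M) (hv : IsReflCurve g M B v) (hτ : τ (v 0) ≠ 0) :
    AEMeasurable (curvTerm g M) ((Measure.map v volume).restrict (bdryTL n M)) := by
  have hemb := hv.measurableEmbedding hM hτ
  rw [hemb.restrict_map, hemb.aemeasurable_map_iff]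
  have h1 : (v ⁻¹' bdryTL n M : Set ℝ) =ᵐ[volume]
      (bdryTimes M B v \ excTimes M B v : Set ℝ) := by
    filter_upwards [hv.countable_excTimes.ae_notMem volume] with s hs
    exact propext ⟨fun h => ⟨⟨fun h0 => hs (Or.inl h0), h⟩, hs⟩, fun h => h.1.2⟩
  rw [Measure.restrict_congr_set h1]
  refine (hv.continuousOn_curvTerm hM).aemeasurable ?_
  have h2 : bdryTimes M B v = Bᶜ ∩ v ⁻¹' bdryTL n M := rfl
  rw [h2]
  exact (hv.countable.measurableSet.compl.inter (hv.measurable measurableSet_bdryTL)).diff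
    hv.countable_excTimes.measurableSet

theorem nuG_eq [T2Space N] [SecondCountableTopology N]
    (hM : IsC2Domain n M) (hv : IsReflCurve g M B v) (hτ : τ (v 0) ≠ 0) :
    nuG g M (Measure.map v volume) =
      ((Measure.map v volume).restrict (bdryTL n M)).withDensity
        (fun ϱ => ENNReal.ofReal (- curvTerm g M ϱ)) := by
  rw [nuG, Measure.restrict_congr_set (hv.ae_mem_glancing3_union_gliding hM hτ)]
  rfl

theorem ae_restrict_bdryTL [T2Space N] [SecondCountableTopology N]
    (hM : IsC2Domain n M) (hv : IsReflCurve g M B v) (hτ : τ (v 0) ≠ 0) :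
    ∀ᵐ ϱ ∂(Measure.map v volume).restrict (bdryTL n M), ϱ ∈ glancing3 g M ∪ gliding g M := by
  rw [ae_restrict_iff' measurableSet_bdryTL]
  exact (hv.ae_mem_glancing3_union_gliding hM hτ).mono fun ϱ h hb => h.mpr hb

theorem ae_nuG [T2Space N] [SecondCountableTopology N]
    (hM : IsC2Domain n M) (hv : IsReflCurve g M B v) (hτ : τ (v 0) ≠ 0) :
    ∀ᵐ ϱ ∂nuG g M (Measure.map v volume), ϱ ∈ glancing3 g M ∪ gliding g M := by
  rw [hv.nuG_eq hM hτ]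
  exact (withDensity_absolutelyContinuous _ _).ae_le (hv.ae_restrict_bdryTL hM hτ)

theorem ae_nuH [T2Space N] (hM : IsC2Domain n M) (hv : IsLeftExt B γ v)
    (hv' : IsReflCurve g M B v) (hτ : τ (v 0) ≠ 0) :
    ∀ᵐ ϱ ∂nuH g M B γ, ϱ ∈ parHyp g M := by
  have : T2Space (CotBundle n N) := t2Space_cotBundle
  have : Countable B := hv.countable
  rw [nuH_eq hM hv hv' hτ, Measure.ae_sum_iff]
  refine fun S => Measure.ae_smul_measure ?_ _
  rw [ae_dirac_eq]
  exact projPar_mem_parHyp g hM (hv'.mem_hypMinus S S.2)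

theorem nuG_lt_top [T2Space N] [SecondCountableTopology N]
    (hM : IsC2Domain n M) (hv : IsReflCurve g M B v) (hτ : τ (v 0) ≠ 0)
    {K : Set (PhaseSpace n N)} (hK : IsCompact K) : nuG g M (Measure.map v volume) K < ⊤ := by
  have : T2Space (CotBundle n N) := t2Space_cotBundle
  obtain ⟨R, _, hR⟩ := hv.exists_forall_mem_Icc hM hτ hK
  obtain ⟨C, hC, -, h2⟩ := hv.hasJumpBound_of_isCompact hM (K := Icc (-R) R) isCompact_Icc
  rw [hv.nuG_eq hM hτ, withDensity_apply _ hK.measurableSet]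
  have h3 : ∀ᵐ ϱ ∂((Measure.map v volume).restrict (bdryTL n M)).restrict K,
      ENNReal.ofReal (- curvTerm g M ϱ) ≤ ENNReal.ofReal C := by
    rw [ae_restrict_iff' hK.measurableSet, ae_restrict_iff' measurableSet_bdryTL,
      (hv.measurableEmbedding hM hτ).ae_map_iff]
    filter_upwards [hv.countable_excTimes.ae_notMem volume] with s hs hb hsK
    refine ENNReal.ofReal_le_ofReal ((neg_le_abs _).trans ?_)
    exact h2 s (hR _ hsK s rfl) ⟨fun h => hs (Or.inl h), hb⟩ hs
  refine (lintegral_mono_ae h3).trans_lt ?_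
  rw [lintegral_const, Measure.restrict_apply_univ]
  refine ENNReal.mul_lt_top ENNReal.ofReal_lt_top ?_
  exact (Measure.restrict_apply_le _ _).trans_lt (hv.map_apply_lt_top hM hτ hK)

theorem nuH_lt_top [T2Space N] (hM : IsC2Domain n M) (hv : IsLeftExt B γ v)
    (hv' : IsReflCurve g M B v) (hτ : τ (v 0) ≠ 0) {K : Set (PhaseSpace n N)}
    (hK : IsCompact K) : nuH g M B γ K < ⊤ := by
  classical
  have : T2Space (CotBundle n N) := t2Space_cotBundle
  obtain ⟨R, _, hR⟩ := hv'.exists_forall_mem_Icc hM hτ hK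
  obtain ⟨C, hC, h1, -⟩ := hv'.hasJumpBound_of_isCompact hM (K := Icc (-R) R) isCompact_Icc
  rw [nuH_eq hM hv hv' hτ, Measure.sum_apply _ hK.measurableSet, ENNReal.tsum_eq_iSup_sum]
  refine (iSup_le fun F => ?_).trans_lt (ENNReal.ofReal_lt_top (r := C))
  have h2 : ∀ S : B, (ENNReal.ofReal (jump g M (projPar g M (v S))) •
      Measure.dirac (projPar g M (v S))) K ≤ if (S : ℝ) ∈ Icc (-R) R then
        ENNReal.ofReal (jump g M (projPar g M (v S))) else 0 := by
    intro S
    rw [Measure.smul_apply, Measure.dirac_apply' _ hK.measurableSet, smul_eq_mul]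
    by_cases h : projPar g M (v S) ∈ K
    · rw [indicator_of_mem h, if_pos (hR _ h S rfl)]
      simp
    · rw [indicator_of_notMem h, mul_zero]
      exact zero_le
  refine (Finset.sum_le_sum fun S _ => h2 S).trans ?_
  rw [← Finset.sum_filter, ← ENNReal.ofReal_sum_of_nonneg
    fun S _ => hv'.jump_nonneg hM S.2]
  refine ENNReal.ofReal_le_ofReal ?_
  have h3 := h1 ((F.filter fun S : B => (S : ℝ) ∈ Icc (-R) R).map (Function.Embedding.subtype _))
    fun S hS => by
      obtain ⟨S', hS', rfl⟩ := Finset.mem_map.1 hS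
      exact ⟨S'.2, (Finset.mem_filter.1 hS').2⟩
  rwa [Finset.sum_map] at h3

end Measurable

end IsReflCurve

variable {g : Metric1 n N} {M : Set N} {B : Set ℝ} {v γ : ℝ → PhaseSpace n N}
  {a : PhaseSpace n N → ℝ} [MeasurableSpace (PhaseSpace n N)] [BorelSpace (PhaseSpace n N)]

/-! ### The transport equation -/

namespace IsReflCurve

theorem integral_nuG [T2Space N] [SecondCountableTopology N] (hM : IsC2Domain n M)
    (hv : IsReflCurve g M B v) (hτ : τ (v 0) ≠ 0) (ha : ContMDiff (phaseI n) 𝓘(ℝ, ℝ) 1 a)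
    (hc : HasCompactSupport a) :
    Integrable (bdryQuotient g M a) (nuG g M (Measure.map v volume)) ∧
    ∫ ϱ, bdryQuotient g M a ϱ ∂nuG g M (Measure.map v volume) =
      - ∫ s, (bdryTL n M).indicator
        (fun ϱ => curvTerm g M ϱ * conormalDeriv g M a ϱ) (v s) := by
  have hemb := hv.measurableEmbedding hM hτ
  obtain ⟨-, h1, -, -⟩ := hv.integral_poisson_symb hM hτ ha hc
  have hm : AEMeasurable (fun ϱ => ENNReal.ofReal (- curvTerm g M ϱ))
      ((Measure.map v volume).restrict (bdryTL n M)) :=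
    (hv.aemeasurable_curvTerm hM hτ).neg.ennreal_ofReal
  have hlt : ∀ᵐ ϱ ∂(Measure.map v volume).restrict (bdryTL n M),
      ENNReal.ofReal (- curvTerm g M ϱ) < ⊤ :=
    Eventually.of_forall fun _ => ENNReal.ofReal_lt_top
  -- Almost every boundary point is gliding or of order three, so the curvature term is nonpositive
  -- and the truncation in `ENNReal.ofReal` loses nothing.
  have hae : (fun ϱ => (ENNReal.ofReal (- curvTerm g M ϱ)).toReal • bdryQuotient g M a ϱ)
      =ᵐ[(Measure.map v volume).restrict (bdryTL n M)]
        fun ϱ => - (curvTerm g M ϱ * conormalDeriv g M a ϱ) := by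
    filter_upwards [hv.ae_restrict_bdryTL hM hτ] with ϱ hϱ
    rw [ENNReal.toReal_ofReal (neg_nonneg.2 (curvTerm_nonpos hM hϱ)),
      bdryQuotient_of_glancing ha (glancing3_union_gliding_subset hϱ).2.1, smul_eq_mul, neg_mul]
  rw [hv.nuG_eq hM hτ, integrable_withDensity_iff_integrable_smul₀' hm hlt,
    integral_withDensity_eq_integral_toReal_smul₀ hm hlt, integrable_congr hae,
    integral_congr_ae hae, integral_neg, ← integral_indicator measurableSet_bdryTL,
    hemb.integral_map]
  refine ⟨Integrable.neg ?_, rfl⟩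
  have h2 : IntegrableOn (fun ϱ => curvTerm g M ϱ * conormalDeriv g M a ϱ) (bdryTL n M)
      (Measure.map v volume) := by
    rw [← integrable_indicator_iff measurableSet_bdryTL, hemb.integrable_map_iff]
    exact h1
  exact h2

theorem integral_nuH [T2Space N] (hM : IsC2Domain n M) (hv : IsLeftExt B γ v)
    (hv' : IsReflCurve g M B v) (hτ : τ (v 0) ≠ 0) (ha : ContMDiff (phaseI n) 𝓘(ℝ, ℝ) 1 a)
    (hc : HasCompactSupport a) :
    Integrable (bdryQuotient g M a) (nuH g M B γ) ∧
    ∫ ϱ, bdryQuotient g M a ϱ ∂nuH g M B γ = ∑' S : B, jumpOf g M a (v S) := by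
  have : T2Space (CotBundle n N) := t2Space_cotBundle
  have : Countable B := hv.countable
  obtain ⟨-, -, h1, -⟩ := hv'.integral_poisson_symb hM hτ ha hc
  have h2 : ∀ S : B, (ENNReal.ofReal (jump g M (projPar g M (v S)))).toReal =
      jump g M (projPar g M (v S)) := fun S =>
    ENNReal.toReal_ofReal (hv'.jump_nonneg hM S.2)
  have h3 : Summable fun S : B => (ENNReal.ofReal (jump g M (projPar g M (v S)))).toReal *
      ‖bdryQuotient g M a (projPar g M (v S))‖ := by
    refine h1.abs.congr fun S => ?_
    rw [h2, ← hv'.bdryQuotient_projPar hM a S.2, abs_mul,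
      abs_of_nonneg (hv'.jump_nonneg hM S.2), Real.norm_eq_abs]
  rw [nuH_eq hM hv hv' hτ]
  refine ⟨integrable_sum_dirac (fun _ => ENNReal.ofReal_ne_top) h3, ?_⟩
  rw [integral_sum_dirac_eq_tsum (fun _ => ENNReal.ofReal_ne_top) h3]
  refine tsum_congr fun S => ?_
  rw [h2, smul_eq_mul, hv'.bdryQuotient_projPar hM a S.2]

theorem ae_mem_parHyp_union_parGla [T2Space N] [SecondCountableTopology N] (hM : IsC2Domain n M)
    (hv : IsLeftExt B γ v) (hv' : IsReflCurve g M B v) (hτ : τ (v 0) ≠ 0) :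
    ∀ᵐ ϱ ∂((1 / 2 : ENNReal) • nuG g M (Measure.map v volume) + nuH g M B γ),
      ϱ ∈ parHyp g M ∪ parGla g M := by
  refine ae_add_measure_iff.2 ⟨Measure.ae_smul_measure ?_ _, ?_⟩
  · exact (hv'.ae_nuG hM hτ).mono fun ϱ h =>
      Or.inr (glancing_subset_parGla g hM (glancing3_union_gliding_subset h))
  · exact (ae_nuH hM hv hv' hτ).mono fun ϱ h => Or.inl h

theorem transportEq [T2Space N] [SecondCountableTopology N] (hM : IsC2Domain n M)
    (hv : IsLeftExt B γ v) (hv' : IsReflCurve g M B v) (hτ : τ (v 0) ≠ 0) :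
    TransportEq g M (fun _ => 0) (Measure.map v volume)
      ((1 / 2 : ENNReal) • nuG g M (Measure.map v volume) + nuH g M B γ) := by
  intro a ha hc
  have hemb := hv'.measurableEmbedding hM hτ
  obtain ⟨h1, -, -, h2⟩ := hv'.integral_poisson_symb hM hτ ha hc
  obtain ⟨hG, hG'⟩ := hv'.integral_nuG hM hτ ha hc
  obtain ⟨hH, hH'⟩ := integral_nuH hM hv hv' hτ ha hc
  have hG2 := hG.smul_measure (c := (1 / 2 : ENNReal)) (by simp)
  -- The measure is already carried by the hyperbolic and glancing regions, so the restriction in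
  -- the transport equation can be dropped.
  have hr := Measure.restrict_eq_self_of_ae_mem (ae_mem_parHyp_union_parGla hM hv hv' hτ)
  refine ⟨hemb.integrable_map_iff.2 h1, by simp, ?_, ?_⟩
  · rw [IntegrableOn, hr]
    exact hG2.add_measure hH
  · rw [hr, integral_add_measure hG2 hH, integral_smul_measure, hG', hH', hemb.integral_map, h2]
    simp only [zero_mul, integral_zero, one_div, ENNReal.toReal_inv, ENNReal.toReal_ofNat,
      smul_eq_mul]
    ring

end IsReflCurve

end GenBichar

end

theorem mainTheorem5 {n : ℕ} {N : Type*} [TopologicalSpace N] [T2Space N]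
    [SecondCountableTopology N] [ChartedSpace (GenBichar.Model n) N]
    [IsManifold 𝓘(ℝ, GenBichar.Model n) 2 N]
    [MeasurableSpace (GenBichar.PhaseSpace n N)] [BorelSpace (GenBichar.PhaseSpace n N)]
    (g : GenBichar.Metric1 n N) (M : Set N) (hM : GenBichar.IsC2Domain n M)
    (B : Set ℝ) (γ : ℝ → GenBichar.PhaseSpace n N)
    (hγ : GenBichar.IsGenBichar g M univ B γ) (hγ0 : GenBichar.Nontriv univ B γ) :
    ∃ μ : Measure (GenBichar.PhaseSpace n N), μ.Regular ∧
      (∀ a : GenBichar.PhaseSpace n N → ℝ, Continuous a → HasCompactSupport a →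
        IntegrableOn (fun s => a (γ s)) Bᶜ volume ∧ ∫ ϱ, a ϱ ∂μ = ∫ s in Bᶜ, a (γ s)) ∧
      ∃ ν : Measure (GenBichar.PhaseSpace n N),
        ν = (1 / 2 : ENNReal) • GenBichar.nuG g M μ + GenBichar.nuH g M B γ ∧
        ν.Regular ∧ ν (GenBichar.parTL g M)ᶜ = 0 ∧
        GenBichar.TransportEq g M (fun _ => 0) μ ν := by
  obtain ⟨v, hv, hv'⟩ := hγ.exists_isReflCurve
  have hτ := GenBichar.IsGenBichar.τ_ne_zero hM hγ0 hv hv'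
  have hemb := hv'.measurableEmbedding hM hτ
  have hreg := GenBichar.IsReflCurve.regular_of_finite_on_compacts (Measure.map v volume)
    fun K hK => hv'.map_apply_lt_top hM hτ hK
  refine ⟨Measure.map v volume, hreg, fun a ha hc => ?_, _, rfl, ?_, ?_,
    GenBichar.IsReflCurve.transportEq hM hv hv' hτ⟩
  · have h1 : EqOn (fun s => a (v s)) (fun s => a (γ s)) Bᶜ := fun s hs =>
      congrArg a (hv.eq_of_notMem s hs)
    have hB := hv.countable.measurableSet.compl
    -- Finiteness of the image measure on compact sets makes `a` integrable, and integrability is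
    -- pulled back to the line.
    have h2 : Integrable fun s => a (v s) :=
      hemb.integrable_map_iff.1 (ha.integrable_of_hasCompactSupport hc)
    have h3 : volume.restrict Bᶜ = volume :=
      Measure.restrict_eq_self_of_ae_mem (hv.countable.ae_notMem volume)
    refine ⟨(integrableOn_congr_fun h1 hB).1 h2.integrableOn, ?_⟩
    rw [hemb.integral_map, ← setIntegral_congr_fun hB h1, h3]
  · refine GenBichar.IsReflCurve.regular_of_finite_on_compacts _ fun K hK => ?_
    rw [Measure.add_apply, Measure.smul_apply, smul_eq_mul]
    exact ENNReal.add_lt_top.2 ⟨ENNReal.mul_lt_top (by simp) (hv'.nuG_lt_top hM hτ hK),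
      GenBichar.IsReflCurve.nuH_lt_top hM hv hv' hτ hK⟩
  · refine mem_ae_iff.1 ((GenBichar.IsReflCurve.ae_mem_parHyp_union_parGla hM hv hv' hτ).mono ?_)
    rintro ϱ (h | h) <;> exact h.1
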